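/- Let $k$ be a global field, i.e. a number field or the function field of a smooth projective geometrically integral curve over a finite field $\mathbb F_q$, with adele ring $\mathbb A$. Then $\mathbb A$ is locally compact, $k$ embeds diagonally in $\mathbb A$ as a discrete subgroup, and $\mathbb A/k$ is compact. Put on $k$ the counting measure, on $\mathbb A/k$ the Haar probability measure, and on $\mathbb A$ the product of the two, which is a Haar measure. For an idele $\alpha=(\alpha_v)$ let $|\alpha|$ be its module (multiplication by $\alpha$ multiplies Haar measures of sets by $|\alpha|$) and let $D_\alpha=-\sum_v v(\alpha_v)[v]$ be its replete divisor, where $v(\cdot)$ is the normalised discrete valuation of $k_v$ if $v$ is non-archimedean, and $v(\cdot)=-\log|\cdot|_v$ with $|\cdot|_v$ the module of $k_v$ if $v$ is archimedean. Let $f_\alpha(u)=f_1(\alpha^{-1}u)$, where $f_1(u)=\prod_v f_{1,v}(u_v)$, $f_{1,v}$ is the characteristic function of $O_v$ if $v$ is non-archimedean, and $f_{1,v}(x)=\exp(-e_v\pi|x|_v^{2/e_v})$, $e_v=[k_v:\mathbb R]$, if $v$ is archimedean. Let $$f_{\alpha,\mathbb A/k}(a+k)=\Bigl(\int_k f_\alpha(a+u)\,du\Bigr)\Bigl(\int_k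 f_\alpha(u)\,du\Bigr)^{-1},$$ $$h^0(D_\alpha)=\log\int_k f_\alpha,\qquad h^1(D_\alpha)=-\log\int_{\mathbb A/k}f_{\alpha,\mathbb A/k},\qquad \chi_{\mathbb A}(D_\alpha)=h^0(D_\alpha)-h^1(D_\alpha).$$ The function $f_\alpha$, and hence these numbers, depend only on $D_\alpha$. All the integrals converge and are positive, and $$\chi_{\mathbb A}(D_\alpha)=\log\int_{\mathbb A}f_\alpha ,\qquad \chi_{\mathbb A}(D_\alpha)-\chi_{\mathbb A}(D_1)=\log|\alpha| .$$ Let $\mathfrak K=-\sum n_v[v]$, the sum being over the non-archimedean places, where $n_v$ is the $v$-valuation of the different $\mathfrak d_v$: if $k$ is a number field, $\mathfrak d_v$ is the different of $k_v$ (the completion at $v$ of the different of $k/\mathbb Q$); if $k$ is a function field, fix a non-trivial continuous character $\psi$ of $\mathbb A$ that vanishes on $k$, and let $\mathfrak d_v^{-1}$ be the largest fractional ideal of $k_v$ on which $\psi$ is trivial. There are ideles $\mathfrak k$ with $D_{\mathfrak k}=\mathfrak K$. For each of them $|\mathfrak k|=|\mathrm{disc}(k)|^{-1}$ if $k$ is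 a number field and $|\mathfrak k|=q^{2-2g}$ if $k$ is a function field of genus $g$, and for every idele $\alpha$ $$\chi_{\mathbb A}(D_\alpha)=\log|\alpha|+\tfrac12\log|\mathfrak k|,\qquad h^1(D_\alpha)=h^0(D_{\mathfrak k^{-1}\alpha^{-1}}),\qquad \chi_{\mathbb A}(D_\alpha)=-\chi_{\mathbb A}(D_{\mathfrak k^{-1}\alpha^{-1}}).$$ Hence the Riemann–Roch theorem: $$h^0(D_\alpha)-h^0(D_{\mathfrak k^{-1}\alpha^{-1}})=\log|\alpha|+\tfrac12\log|\mathfrak k| .$$ If $k$ is a function field then, with $\ell(D)=\dim_{\mathbb F_q}\{x\in k: \mathrm{ord}_v(x)\ge -n_v \text{ for all } v\}$ for $D=\sum n_v[v]$, one has $h^0(D_\alpha)=\ell(D_\alpha)\log q$, $\chi_{\mathbb A}(D_\alpha)-\chi_{\mathbb A}(D_1)=\log q\cdot\deg D_\alpha$, and $$\ell(D_\alpha)-\ell(D_{\mathfrak k^{-1}\alpha^{-1}})=\deg D_\alpha+1-g .$$ -/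

import Mathlib

open scoped WithZero

namespace GlobalAdele

noncomputable section

/-! ### Places, completions, adeles -/

/-- A non-archimedean place of `k`, given by its normalised (surjective) discrete valuation, written
multiplicatively: `v x = exp (-ord_v x)`. -/
def FinitePlace (k : Type*) [Field k] : Type _ :=
  {v : Valuation k ℤᵐ⁰ // Function.Surjective v}

/-- The completion `k_v` at a non-archimedean place. -/
abbrev FinitePlace.Completion {k : Type*} [Field k] (v : FinitePlace k) : Type _ :=
  v.1.Completion

/-- The ring of integers `O_v` of `k_v`. -/
abbrev FinitePlace.integers {k : Type*} [Field k] (v : FinitePlace k) :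
    ValuationSubring v.Completion :=
  Valued.v.valuationSubring

instance (k : Type*) [Field k] :
    Fact (∀ v : FinitePlace k, IsOpen (v.integers : Set v.Completion)) :=
  ⟨fun _ => Valued.isOpen_valuationSubring _⟩

/-- The non-archimedean part of the adeles: the restricted product of the `k_v` with respect to
the `O_v`. -/
abbrev FiniteAdele (k : Type*) [Field k] : Type _ :=
  RestrictedProduct (fun v : FinitePlace k => v.Completion) (fun v => v.integers) Filter.cofinite

/-- The adele ring of `k`. A field of positive characteristic has no archimedean place, and then the
first factor is an empty product. -/
def Adele (k : Type*) [Field k] : Type _ := NumberField.InfiniteAdeleRing k × FiniteAdele k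

variable (k : Type*) [Field k]

instance : CommRing (Adele k) :=
  inferInstanceAs (CommRing (NumberField.InfiniteAdeleRing k × FiniteAdele k))

instance : TopologicalSpace (Adele k) :=
  inferInstanceAs (TopologicalSpace (NumberField.InfiniteAdeleRing k × FiniteAdele k))

instance : IsTopologicalRing (Adele k) :=
  inferInstanceAs (IsTopologicalRing (NumberField.InfiniteAdeleRing k × FiniteAdele k))

instance : MeasurableSpace (Adele k) := borel (Adele k)

instance : BorelSpace (Adele k) := ⟨rfl⟩

variable {k}

/-- The adele `a` is the diagonal image of `x ∈ k`. -/
def IsDiagonal (x : k) (a : Adele k) : Prop :=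
  a.1 = algebraMap k (NumberField.InfiniteAdeleRing k) x ∧
    ∀ v : FinitePlace k, a.2 v = (x : v.Completion)

variable (k)

/-- The subgroup `k ⊆ 𝔸` of principal adeles, that is, of diagonal images of elements of `k`. -/
def principal : AddSubgroup (Adele k) where
  carrier := {a | ∃ x : k, IsDiagonal x a}
  zero_mem' := ⟨0, (map_zero _).symm, fun _ => (UniformSpace.Completion.coe_zero).symm⟩
  add_mem' := by
    rintro a b ⟨x, hx, hx'⟩ ⟨y, hy, hy'⟩
    refine ⟨x + y, ?_, fun v => ?_⟩
    · rw [map_add, ← hx, ← hy]; rfl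
    · have h : (a + b).2 v = a.2 v + b.2 v := rfl
      rw [h, hx', hy']
      exact (UniformSpace.Completion.coe_add _ _).symm
  neg_mem' := by
    rintro a ⟨x, hx, hx'⟩
    refine ⟨-x, ?_, fun v => ?_⟩
    · rw [map_neg, ← hx]; rfl
    · have h : (-a).2 v = -(a.2 v) := rfl
      rw [h, hx']
      exact (UniformSpace.Completion.coe_neg _).symm

/-- The quotient group `𝔸 / k`, with the quotient topology and its Borel sets. -/
def AdeleQuotient : Type _ := Adele k ⧸ principal k

instance : AddCommGroup (AdeleQuotient k) :=
  inferInstanceAs (AddCommGroup (Adele k ⧸ principal k))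

instance : TopologicalSpace (AdeleQuotient k) :=
  inferInstanceAs (TopologicalSpace (Adele k ⧸ principal k))

instance : IsTopologicalAddGroup (AdeleQuotient k) :=
  inferInstanceAs (IsTopologicalAddGroup (Adele k ⧸ principal k))

instance : MeasurableSpace (AdeleQuotient k) := borel _

instance : BorelSpace (AdeleQuotient k) := ⟨rfl⟩

/-! ### Measures -/

open Classical in
/-- The Haar probability measure on the compact group `𝔸 / k`. For a global field `k` the quotient
is compact; the other branch is a convention. -/
def quotientMeasure : MeasureTheory.Measure (AdeleQuotient k) :=
  if h : CompactSpace (AdeleQuotient k) then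
    haveI := h
    MeasureTheory.Measure.addHaarMeasure ⊤
  else 0

/-- The measure on `𝔸` that is the product of the counting measure on `k` and the Haar probability
measure on `𝔸 / k`: one integrates over `𝔸 / k` the counting measures of the cosets of `k`. -/
def adeleMeasure : MeasureTheory.Measure (Adele k) :=
  (quotientMeasure k).bind fun x : Adele k ⧸ principal k =>
    MeasureTheory.Measure.sum fun u : principal k =>
      MeasureTheory.Measure.dirac (x.out + (u : Adele k))

variable {k}

open Classical in
/-- The module `|α|` of an idele: `μ (α P) = |α| μ P` for every Haar measure `μ` on `𝔸` and every
Borel set `P`. For a global field `k` the group `𝔸` is locally compact; the other branch is a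
convention. -/
def ideleModule (α : (Adele k)ˣ) : ℝ :=
  if h : LocallyCompactSpace (Adele k) then
    haveI := h
    (MeasureTheory.distribHaarChar (Adele k) α : ℝ)
  else 1

/-! ### Replete divisors -/

variable (k) in
/-- A replete divisor `∑ n_v [v]`, with integral coefficients at the non-archimedean places and real
coefficients at the archimedean ones. -/
@[ext]
structure RepleteDivisor where
  finite : FinitePlace k → ℤ
  infinite : NumberField.InfinitePlace k → ℝ

/-- The module `|x|_v` of an archimedean completion. -/
def archModule (v : NumberField.InfinitePlace k) (x : v.Completion) : ℝ := ‖x‖ ^ v.mult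

/-- The replete divisor `D_α = -∑ v(α_v) [v]`, where `v(x)` is the normalised discrete valuation for
`v` non-archimedean and `v(x) = -log |x|_v` for `v` archimedean. -/
def ideleDivisor (α : (Adele k)ˣ) : RepleteDivisor k where
  finite v := WithZero.log (Valued.v ((α : Adele k).2 v))
  infinite v := Real.log (archModule v ((α : Adele k).1 v))

/-! ### The functions `f_α` and the numbers `h⁰`, `h¹`, `χ` -/

open Classical in
/-- The function `f_1 = ∏_v f_{1,v}` on `𝔸`: the characteristic function of `O_v` at each
non-archimedean place (where almost all factors are `1`) and
`exp (-e_v π |u_v|_v ^ (2 / e_v))` at the archimedean places, `e_v = [k_v : ℝ]`. -/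
def baseFunction (u : Adele k) : ℝ :=
  (∏ᶠ v : NumberField.InfinitePlace k,
    Real.exp (-(v.mult * Real.pi * archModule v (u.1 v) ^ (2 / v.mult : ℝ)))) *
  ∏ᶠ v : FinitePlace k, if u.2 v ∈ v.integers then (1 : ℝ) else 0

/-- The function `f_α(u) = f_1(α⁻¹ u)`. -/
def ideleFunction (α : (Adele k)ˣ) (u : Adele k) : ℝ :=
  baseFunction (((α⁻¹ : (Adele k)ˣ) : Adele k) * u)

/-- The normalised function on `𝔸 / k` induced by `g : 𝔸 → ℝ`:
`a + k ↦ (∫_k g(a + u) du) (∫_k g(u) du)⁻¹`, with the counting measure on `k`. -/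
def quotientFunction (g : Adele k → ℝ) : AdeleQuotient k → ℝ :=
  Quotient.lift
    (fun a : Adele k =>
      (∑' u : principal k, g (a + u)) * (∑' u : principal k, g (u : Adele k))⁻¹)
    (by
      intro a b hab
      have hab' : -a + b ∈ principal k := QuotientAddGroup.leftRel_apply.mp hab
      refine congrArg (· * _) ?_
      rw [← (Equiv.addLeft (⟨-a + b, hab'⟩ : principal k)).tsum_eq
        fun u : principal k => g (a + u)]
      refine tsum_congr fun u => congrArg g ?_
      simp [← add_assoc])

/-- The number `∫_k f_α`, whose logarithm is `h⁰(D_α)`. -/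
def expH0 (α : (Adele k)ˣ) : ℝ := ∑' u : principal k, ideleFunction α (u : Adele k)

/-- The number `(∫_{𝔸/k} f_{α, 𝔸/k})⁻¹`, whose logarithm is `h¹(D_α)`. -/
def expH1 (α : (Adele k)ˣ) : ℝ :=
  (∫ x, quotientFunction (ideleFunction α) x ∂(quotientMeasure k))⁻¹

/-- `h⁰(D_α)`. -/
def h0 (α : (Adele k)ˣ) : ℝ := Real.log (expH0 α)

/-- `h¹(D_α)`. -/
def h1 (α : (Adele k)ˣ) : ℝ := Real.log (expH1 α)

/-- The Euler characteristic `χ_𝔸(D_α) = h⁰(D_α) - h¹(D_α)`. -/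
def eulerChar (α : (Adele k)ˣ) : ℝ := h0 α - h1 α

/-! ### Global fields -/

/-- `k` is the function field of a smooth projective geometrically integral curve over the finite
field `F`: it is finite over `F(t)` for some transcendental `t`, and `F` is algebraically closed
in `k`. -/
structure IsCurveFunctionField (F : Subfield k) : Prop where
  finite : Finite F
  exists_transcendental :
    ∃ t : k, Transcendental F t ∧ FiniteDimensional (IntermediateField.adjoin F {t}) k
  algebraically_closed : ∀ x : k, IsAlgebraic F x → x ∈ F

variable (k) in
/-- Global fields. -/
def IsGlobalField : Prop := NumberField k ∨ ∃ F : Subfield k, IsCurveFunctionField F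

/-! ### The divisor of the different -/

variable (k) in
/-- For a number field, `𝔎 = -∑ n_v [v]` over the non-archimedean places, where `n_v` is the
`v`-valuation of the different of `k`. -/
def numberFieldDivisor [NumberField k] : RepleteDivisor k where
  finite v := -sInf {n : ℤ | ∃ d : NumberField.RingOfIntegers k,
    d ∈ differentIdeal ℤ (NumberField.RingOfIntegers k) ∧ d ≠ 0 ∧
      n = -WithZero.log (v.1 (d : k))}
  infinite _ := 0

/-- For a function field and a character `ψ` of `𝔸`, the divisor `𝔎 = -∑ n_v [v]`, where `n_v` is
the `v`-valuation of the different of `k_v` with respect to `ψ`; the inverse of that different is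
the largest fractional ideal `{x ∈ k_v : ord_v x ≥ -n_v}` on which `ψ` is trivial. -/
def characterDivisor (ψ : AddChar (Adele k) Circle) : RepleteDivisor k where
  finite v := -sSup {n : ℤ | ∀ a : Adele k, a.1 = 0 → (∀ w, w ≠ v → a.2 w = 0) →
    Valued.v (a.2 v) ≤ WithZero.exp n → ψ a = 1}
  infinite _ := 0

/-- The idele `κ` satisfies `D_κ = 𝔎`. For a function field, `𝔎` is taken with respect to some
non-trivial continuous character of `𝔸` that vanishes on `k`. -/
def IsDifferentIdele (κ : (Adele k)ˣ) : Prop :=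
  (∃ _ : NumberField k, ideleDivisor κ = numberFieldDivisor k) ∨
  ((∃ F : Subfield k, IsCurveFunctionField F) ∧
    ∃ ψ : AddChar (Adele k) Circle, Continuous ψ ∧ ψ ≠ 1 ∧ (∀ a ∈ principal k, ψ a = 1) ∧
      ideleDivisor κ = characterDivisor ψ)

/-! ### Degrees, Riemann–Roch spaces and the genus of a function field -/

theorem FinitePlace.map_finite_le_one (v : FinitePlace k) (F : Subfield k) [Finite F] (c : F) :
    v.1 (c : k) ≤ 1 := by
  rcases eq_or_ne c 0 with rfl | hc
  · simp
  · have h : v.1 (c : k) ^ orderOf (Units.mk0 c hc) = 1 := by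
      rw [← map_pow]
      have h1 : (Units.mk0 c hc) ^ orderOf (Units.mk0 c hc) = 1 := pow_orderOf_eq_one _
      have h2 : c ^ orderOf (Units.mk0 c hc) = 1 := by
        have := congrArg Units.val h1
        rwa [Units.val_pow_eq_pow_val, Units.val_mk0, Units.val_one] at this
      have h3 : (c : k) ^ orderOf (Units.mk0 c hc) = 1 := by exact_mod_cast congrArg Subtype.val h2
      rw [h3, map_one]
    exact ((pow_eq_one_iff_of_nonneg zero_le (orderOf_pos _).ne').mp h).le

/-- The inclusion of the constants in the ring of integers of `k` at `v`. -/
def FinitePlace.constants (v : FinitePlace k) (F : Subfield k) [Finite F] :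
    F →+* v.1.valuationSubring :=
  F.subtype.codRestrict v.1.valuationSubring (v.map_finite_le_one F)

/-- The degree `[k(v) : F]` of a place `v`, where `k(v)` is the residue field. -/
def FinitePlace.degree (v : FinitePlace k) (F : Subfield k) [Finite F] : ℕ :=
  letI := ((IsLocalRing.residue v.1.valuationSubring).comp (v.constants F)).toAlgebra
  Module.finrank F (IsLocalRing.ResidueField v.1.valuationSubring)

/-- The degree `∑ n_v [k(v) : F]` of a divisor `∑ n_v [v]` with finite support. -/
def divisorDegree (F : Subfield k) [Finite F] (n : FinitePlace k → ℤ) : ℤ :=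
  ∑ᶠ v, n v * v.degree F

/-- The space `H⁰(D) = {x ∈ k : ord_v x ≥ -n_v for all v}` of a divisor `D = ∑ n_v [v]`. -/
def riemannRochSpace (F : Subfield k) [Finite F] (n : FinitePlace k → ℤ) : Submodule F k where
  carrier := {x | ∀ v : FinitePlace k, v.1 x ≤ WithZero.exp (n v)}
  zero_mem' v := by simp
  add_mem' hx hy v := v.1.map_add_le (hx v) (hy v)
  smul_mem' c x hx v := by
    have h : v.1 (c • x) = v.1 (c : k) * v.1 x := map_mul v.1 (c : k) x
    rw [h]
    exact (mul_le_of_le_one_left' (v.map_finite_le_one F c)).trans (hx v)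

/-- The dimension `ℓ(D)` of `H⁰(D)` over `F`. -/
def ell (F : Subfield k) [Finite F] (n : FinitePlace k → ℤ) : ℕ :=
  Module.finrank F (riemannRochSpace F n)

/-- The genus: the maximum of `deg D - ℓ(D) + 1` over all divisors `D` (of finite support). -/
def genus (F : Subfield k) [Finite F] : ℤ :=
  sSup {m : ℤ | ∃ n : FinitePlace k →₀ ℤ, m = divisorDegree F n - ell F n + 1}

end

end GlobalAdele

open GlobalAdele

set_option linter.unusedSectionVars false

namespace GlobalAdele

open Filter Topology

/-! ### Local fields with a normalised discrete valuation -/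

section Valued

variable {L : Type*} [Field L] [Valued L ℤᵐ⁰]

/-! Unfolding an integral over `𝔸` into sums over the cosets of `k` gives `∫_{𝔸/k} f_{α,𝔸/k} = (∫_𝔸
f_α) / (∫_k f_α)`. Hence `exp h¹ = exp h⁰ / ∫_𝔸 f_α`, which is `χ(D_α) = log ∫_𝔸 f_α`, and the
substitution `u ↦ α u` gives `χ(D_α) - χ(D_1) = log |α|` (`integral_quotientFunction`,
`eulerChar_eq_log_ideleModule_add`).

Duality is Poisson summation. Fix a non-trivial continuous character `ψ` of `𝔸` that vanishes on
`k`. The characters `a ↦ ψ(x a)`, `x ∈ k`, form a group of characters of the compact group `𝔸/k`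
that separates points, because the annihilator of `k` under `ψ` is `k` itself
(`mem_principal_of_character`). The Fourier coefficient of `f_{α,𝔸/k}` at `x` unfolds to a Fourier
integral over `𝔸`. The Fourier transform of `f_1` at `y` is `(∫ f_1) f_1(κ y)`, where `κ` has the
divisor of the different (`fourier_adelicGaussian`). So the coefficient is `C f_{κ⁻¹α⁻¹}(x)` with `C
= exp(-h¹(D_α))`. These coefficients are summable, so by Stone–Weierstrass the Fourier series
represents the function. At `0`, where the function is `1`, this reads `C exp h⁰(D_{κ⁻¹α⁻¹}) = 1`
(`expH1_eq_expH0`). No self-dual measure is computed: applying duality to both `α` and `κ⁻¹α⁻¹`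
forces `χ(D_1) = ½ log |κ|` (`eulerChar_of_duality`).

What depends on the field is isolated in `IsCocompactAdelic`: finiteness properties of the places,
discreteness of `k`, and a compact set that covers `𝔸` modulo `k`. For number fields these come from
strong approximation over the ring of integers and from integral bases. For function fields they
come from the two integral closures of `F[t]` and `F[t⁻¹]`, which together see all places.

For a number field, `ψ` is `exp(2πi Tr)` of the archimedean part after the finite part has been made
integral by subtracting an element of `k`; its conductor is the different because both describe the
trace dual of the integers. For a function field, `ψ` comes from a finite quotient of `𝔸/k`, and any
non-trivial `ψ` works. The module `|κ|` is the inverse of the index of the different in the number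
field case. In the function field case, Riemann–Roch with the unknown degree of `κ` shows where `deg
D - ℓ(D) + 1` is largest, and this ties that degree to the genus. -/

theorem WithZero.exists_exp_eq {x : ℤᵐ⁰} (hx : x ≠ 0) : ∃ n : ℤ, x = WithZero.exp n :=
  ⟨WithZero.log x, (WithZero.exp_log hx).symm⟩

theorem WithZero.lt_exp_iff {x : ℤᵐ⁰} {n : ℤ} : x < WithZero.exp n ↔ x ≤ WithZero.exp (n - 1) := by
  rcases eq_or_ne x 0 with rfl | hx
  · simp
  · obtain ⟨m, rfl⟩ := WithZero.exists_exp_eq hx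
    simp only [WithZero.exp_lt_exp, WithZero.exp_le_exp]
    omega

/-- The topology is defined by open balls whose radii are units of the value group of the valuation
itself. Surjectivity makes every `exp n` such a radius, and discreteness turns the open ball of
radius `exp n` into the closed one of radius `exp (n - 1)`. -/
theorem valued_mem_nhds_zero (hs : Function.Surjective (Valued.v : Valuation L ℤᵐ⁰)) {s : Set L} :
    s ∈ 𝓝 (0 : L) ↔ ∃ n : ℤ, {x : L | Valued.v x ≤ WithZero.exp n} ⊆ s := by
  rw [Valued.mem_nhds_zero]
  constructor
  · rintro ⟨γ, hγ⟩
    have h0 : MonoidWithZeroHom.ValueGroup₀.embedding γ.1 ≠ 0 := by simp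
    obtain ⟨n, hn⟩ := WithZero.exists_exp_eq h0
    refine ⟨n - 1, fun x hx => hγ ?_⟩
    simp only [Set.mem_ofPred_eq] at hx ⊢
    rw [Valuation.restrict_lt_iff_lt_embedding, hn, WithZero.lt_exp_iff]
    exact hx
  · rintro ⟨n, hn⟩
    obtain ⟨y, hy⟩ := hs (WithZero.exp n)
    have hy0 : (Valued.v : Valuation L ℤᵐ⁰).restrict y ≠ 0 := by
      intro h
      rw [Valuation.restrict_eq_zero_iff] at h
      exact WithZero.exp_ne_zero (hy.symm.trans h)
    refine ⟨Units.mk0 _ hy0, fun x hx => hn ?_⟩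
    simp only [Set.mem_ofPred_eq, Units.val_mk0, Valuation.restrict_lt_iff] at hx ⊢
    rw [← hy]
    exact hx.le

theorem valued_isOpen_le (hs : Function.Surjective (Valued.v : Valuation L ℤᵐ⁰)) (n : ℤ) :
    IsOpen {x : L | Valued.v x ≤ WithZero.exp n} := by
  rw [isOpen_iff_mem_nhds]
  intro x hx
  have h : {z : L | Valued.v z ≤ WithZero.exp n} ∈ 𝓝 (0 : L) :=
    (valued_mem_nhds_zero hs).2 ⟨n, subset_rfl⟩
  have h' : Tendsto (fun z => z - x) (𝓝 x) (𝓝 0) := by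
    have : Continuous fun z : L => z - x := by fun_prop
    simpa using this.tendsto x
  filter_upwards [h' h] with z hz
  have := (Valued.v : Valuation L ℤᵐ⁰).map_add (z - x) x
  rw [sub_add_cancel] at this
  exact this.trans (max_le hz hx)

theorem valued_isClosed_le (hs : Function.Surjective (Valued.v : Valuation L ℤᵐ⁰)) (n : ℤ) :
    IsClosed {x : L | Valued.v x ≤ WithZero.exp n} := by
  rw [← isOpen_compl_iff, isOpen_iff_mem_nhds]
  intro x hx
  have h : {z : L | Valued.v z ≤ WithZero.exp n} ∈ 𝓝 (0 : L) :=
    (valued_mem_nhds_zero hs).2 ⟨n, subset_rfl⟩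
  have h' : Tendsto (fun z => x - z) (𝓝 x) (𝓝 0) := by
    have : Continuous fun z : L => x - z := by fun_prop
    simpa using this.tendsto x
  filter_upwards [h' h] with z hz hz'
  have := (Valued.v : Valuation L ℤᵐ⁰).map_add (x - z) z
  rw [sub_add_cancel] at this
  exact hx (this.trans (max_le hz hz'))

/-- The unit ball of a complete discretely valued field is compact as soon as it meets only
finitely many classes modulo the open unit ball. -/
theorem valued_isCompact_le_one [CompleteSpace L]
    (hs : Function.Surjective (Valued.v : Valuation L ℤᵐ⁰))
    {t : Set L} (ht : t.Finite)
    (hcov : ∀ x : L, Valued.v x ≤ 1 → ∃ y ∈ t, Valued.v (x - y) ≤ WithZero.exp (-1 : ℤ)) :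
    IsCompact {x : L | Valued.v x ≤ 1} := by
  obtain ⟨p, hp⟩ := hs (WithZero.exp (-1 : ℤ))
  have hp0 : p ≠ 0 := by
    rintro rfl
    rw [map_zero] at hp
    exact WithZero.exp_ne_zero hp.symm
  have hclosed : IsClosed {x : L | Valued.v x ≤ 1} := valued_isClosed_le hs 0
  refine isCompact_iff_totallyBounded_isComplete.2 ⟨?_, hclosed.isComplete⟩
  -- Digit expansion: an error of size `exp (-n)` is rescaled by `p ^ n` into the unit ball, where
  -- `t` supplies one more digit.
  have key : ∀ n : ℕ, ∃ s : Set L, s.Finite ∧ ∀ x : L, Valued.v x ≤ 1 →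
      ∃ y ∈ s, Valued.v (x - y) ≤ WithZero.exp (-(n : ℤ)) := by
    intro n
    induction n with
    | zero => exact ⟨{0}, Set.finite_singleton _, fun x hx => ⟨0, rfl, by simpa using hx⟩⟩
    | succ n ih =>
      obtain ⟨s, hsf, hsc⟩ := ih
      refine ⟨Set.image2 (fun y z => y + p ^ n * z) s t, hsf.image2 _ ht, fun x hx => ?_⟩
      obtain ⟨y, hy, hxy⟩ := hsc x hx
      have hvp : Valued.v (p ^ n) = WithZero.exp (-(n : ℤ)) := by
        rw [map_pow, hp, ← WithZero.exp_nsmul]; simp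
      have h1 : Valued.v ((x - y) / p ^ n) ≤ 1 := by
        rw [map_div₀, hvp, div_le_one₀ (by simp)]
        exact hxy
      obtain ⟨z, hz, hxz⟩ := hcov _ h1
      refine ⟨_, ⟨y, hy, z, hz, rfl⟩, ?_⟩
      have h2 : x - (y + p ^ n * z) = p ^ n * ((x - y) / p ^ n - z) := by
        field_simp
        ring
      rw [h2, map_mul, hvp]
      calc _ ≤ WithZero.exp (-(n : ℤ)) * WithZero.exp (-1 : ℤ) := by gcongr
        _ = _ := by rw [← WithZero.exp_add]; congr 1; push_cast; ring
  rw [totallyBounded_iff_subset_finite_iUnion_nhds_zero]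
  intro U hU
  obtain ⟨n, hn⟩ := (valued_mem_nhds_zero hs).1 hU
  obtain ⟨s, hsf, hsc⟩ := key n.natAbs
  refine ⟨s, hsf, fun x hx => ?_⟩
  obtain ⟨y, hy, hxy⟩ := hsc x hx
  refine Set.mem_biUnion hy ?_
  rw [Set.mem_vadd_set]
  refine ⟨x - y, hn ?_, by simp⟩
  refine hxy.trans ?_
  simp only [WithZero.exp_le_exp]
  omega

theorem valued_uniformity_isCountablyGenerated
    (hs : Function.Surjective (Valued.v : Valuation L ℤᵐ⁰)) :
    (uniformity L).IsCountablyGenerated := by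
  rw [uniformity_eq_comap_nhds_zero]
  have : (𝓝 (0 : L)).IsCountablyGenerated := by
    have hb : (𝓝 (0 : L)).HasBasis (fun _ : ℤ => True)
        fun n => {x : L | Valued.v x ≤ WithZero.exp n} :=
      ⟨fun s => by rw [valued_mem_nhds_zero hs]; simp⟩
    exact HasCountableBasis.isCountablyGenerated ⟨hb, Set.to_countable _⟩
  exact Filter.comap.isCountablyGenerated _ _

end Valued

/-! ### The completion at a finite place -/

section FinitePlace

variable {k : Type*} [Field k] (v : FinitePlace k)

/-- The embedding of `k` in `k_v`. -/
noncomputable def FinitePlace.coeHom : k →+* v.Completion :=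
  (UniformSpace.Completion.coeRingHom).comp (WithVal.equiv v.1).symm.toRingHom

@[simp]
theorem FinitePlace.valued_coe (x : k) : Valued.v (x : v.Completion) = v.1 x :=
  Valued.valuedCompletion_apply _

theorem FinitePlace.valued_surjective :
    Function.Surjective (Valued.v : Valuation v.Completion ℤᵐ⁰) := by
  intro y
  obtain ⟨x, hx⟩ := v.2 y
  exact ⟨(x : v.Completion), by rw [v.valued_coe, hx]⟩

theorem FinitePlace.denseRange_coe : DenseRange (fun x : k => (x : v.Completion)) := by
  have h := UniformSpace.Completion.denseRange_coe (α := WithVal v.1)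
  exact h.comp (WithVal.equiv v.1).symm.surjective.denseRange
    (UniformSpace.Completion.continuous_coe _)

theorem FinitePlace.exists_valued_sub_le (y : v.Completion) (n : ℤ) :
    ∃ x : k, Valued.v (y - (x : v.Completion)) ≤ WithZero.exp n := by
  have ho : IsOpen {z : v.Completion | Valued.v (y - z) ≤ WithZero.exp n} :=
    (valued_isOpen_le v.valued_surjective n).preimage (continuous_const.sub continuous_id)
  obtain ⟨x, hx⟩ := v.denseRange_coe.exists_mem_open ho ⟨y, by simp⟩
  exact ⟨x, hx⟩

/-- A prime element of `k` at the place `v`. -/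
theorem FinitePlace.exists_valuation_eq_exp (n : ℤ) : ∃ x : k, x ≠ 0 ∧ v.1 x = WithZero.exp n := by
  obtain ⟨x, hx⟩ := v.2 (WithZero.exp n)
  exact ⟨x, by
    rintro rfl
    rw [map_zero] at hx
    exact WithZero.exp_ne_zero hx.symm, hx⟩

theorem FinitePlace.mem_nhds_zero {s : Set v.Completion} :
    s ∈ 𝓝 (0 : v.Completion) ↔
      ∃ n : ℤ, {x : v.Completion | Valued.v x ≤ WithZero.exp n} ⊆ s :=
  valued_mem_nhds_zero v.valued_surjective

theorem FinitePlace.secondCountableTopology [Countable k] :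
    SecondCountableTopology v.Completion := by
  have := valued_uniformity_isCountablyGenerated v.valued_surjective
  have : TopologicalSpace.SeparableSpace v.Completion :=
    ⟨⟨_, Set.countable_range _, v.denseRange_coe⟩⟩
  exact UniformSpace.secondCountable_of_separable _

/-- A finite residue field of `k` at `v` makes `O_v` compact. -/
theorem FinitePlace.compactSpace_integers
    [Finite (IsLocalRing.ResidueField v.1.valuationSubring)] : CompactSpace v.integers := by
  refine isCompact_iff_compactSpace.1 ?_
  let f : IsLocalRing.ResidueField v.1.valuationSubring → v.Completion := fun c =>
    (((Function.surjInv (IsLocalRing.residue_surjective (R := v.1.valuationSubring)) c :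
      v.1.valuationSubring) : k) : v.Completion)
  refine valued_isCompact_le_one v.valued_surjective (t := Set.range f) (Set.finite_range f)
    fun y hy => ?_
  obtain ⟨x, hx⟩ := v.exists_valued_sub_le y (-1)
  have hx1 : v.1 x ≤ 1 := by
    rw [← v.valued_coe]
    have h := (Valued.v : Valuation v.Completion ℤᵐ⁰).map_sub y (y - (x : v.Completion))
    rw [sub_sub_cancel] at h
    refine h.trans (max_le hy (hx.trans ?_))
    rw [← WithZero.exp_zero, WithZero.exp_le_exp]; omega
  set c := IsLocalRing.residue v.1.valuationSubring ⟨x, hx1⟩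
  refine ⟨f c, ⟨c, rfl⟩, ?_⟩
  have hc := Function.surjInv_eq (IsLocalRing.residue_surjective (R := v.1.valuationSubring)) c
  set z := Function.surjInv (IsLocalRing.residue_surjective (R := v.1.valuationSubring)) c
  have hz : (⟨x, hx1⟩ : v.1.valuationSubring) - z ∈ IsLocalRing.maximalIdeal _ := by
    rw [← IsLocalRing.residue_eq_zero_iff, map_sub, hc, sub_self]
  have hz' : v.1 (x - z) < 1 := (v.1.mem_maximalIdeal_iff).1 hz
  have hz'' : Valued.v (((x - (z : k) : k)) : v.Completion) ≤ WithZero.exp (-1 : ℤ) := by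
    rw [v.valued_coe]
    rw [← WithZero.exp_zero, WithZero.lt_exp_iff] at hz'
    simpa using hz'
  have he : y - f c = (y - (x : v.Completion)) + (((x - (z : k) : k)) : v.Completion) := by
    have : (((x - (z : k) : k)) : v.Completion) = (x : v.Completion) - ((z : k) : v.Completion) :=
      map_sub v.coeHom x z
    rw [this]; simp [f, z]
  rw [he]
  exact ((Valued.v : Valuation v.Completion ℤᵐ⁰).map_add _ _).trans (max_le hx hz'')

end FinitePlace

end GlobalAdele

/-! ### Haar measure and Poisson summation for a discrete cocompact subgroup -/

namespace GlobalAdele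

open Filter Topology MeasureTheory ENNReal

/-- A second countable locally compact group is Polish. -/
theorem polishSpace_of_locallyCompact_addGroup {G : Type*} [AddCommGroup G] [TopologicalSpace G]
    [IsTopologicalAddGroup G] [LocallyCompactSpace G] [T2Space G] [SecondCountableTopology G] :
    PolishSpace G := by
  let := IsTopologicalAddGroup.rightUniformSpace G
  have : IsUniformAddGroup G := isUniformAddGroup_of_addCommGroup
  have : (uniformity G).IsCountablyGenerated :=
    IsUniformAddGroup.uniformity_countably_generated
  have : CompleteSpace G := IsRightUniformAddGroup.completeSpace_of_weaklyLocallyCompactSpace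
  infer_instance


section Lattice

variable {G Q : Type*} [AddCommGroup G] [TopologicalSpace G] [AddCommGroup Q] [TopologicalSpace Q]

/-- `π : G → Q` exhibits `Q` as the topological quotient of `G` by the subgroup `Γ`. -/
structure IsLatticeQuotient (Γ : AddSubgroup G) (π : G →+ Q) : Prop where
  isOpenQuotientMap : IsOpenQuotientMap π
  ker_eq : π.ker = Γ

variable {Γ : AddSubgroup G} {π : G →+ Q}

theorem IsLatticeQuotient.map_eq_zero_iff (h : IsLatticeQuotient Γ π) {a : G} :
    π a = 0 ↔ a ∈ Γ := by
  rw [← h.ker_eq]; rfl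

theorem IsLatticeQuotient.exists_add_eq (h : IsLatticeQuotient Γ π) {a b : G} (hab : π a = π b) :
    ∃ u : Γ, b = a + u :=
  ⟨⟨-a + b, h.map_eq_zero_iff.1 (by rw [map_add, map_neg, hab, neg_add_cancel])⟩, by simp⟩

theorem IsLatticeQuotient.tsum_congr {E : Type*} [AddCommMonoid E] [TopologicalSpace E]
    (h : IsLatticeQuotient Γ π) (f : G → E) {a b : G} (hab : π a = π b) :
    ∑' u : Γ, f (a + u) = ∑' u : Γ, f (b + u) := by
  obtain ⟨w, rfl⟩ := h.exists_add_eq hab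
  rw [← (Equiv.addLeft w).tsum_eq fun u : Γ => f (a + u)]
  simp [add_assoc]

/-- The measure on `G` that is the product of the counting measure on `Γ` and the measure `ν` on the
quotient, for a set-theoretic section `s` of the quotient map. -/
noncomputable def cosetMeasure (Γ : AddSubgroup G) [MeasurableSpace G] [MeasurableSpace Q]
    (s : Q → G) (ν : Measure Q) : Measure G :=
  ν.bind fun x => Measure.sum fun u : Γ => Measure.dirac (s x + (u : G))

variable [IsTopologicalAddGroup G] [LocallyCompactSpace G] [T2Space G]
  [SecondCountableTopology G] [MeasurableSpace G] [BorelSpace G]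
  [IsTopologicalAddGroup Q] [T2Space Q] [MeasurableSpace Q] [BorelSpace Q]
  [Countable Γ] {s : Q → G}

/-- A continuous surjection from a Polish space onto a second countable Hausdorff space detects
Borel sets. This matters because the section `s` is chosen set-theoretically and need not be
measurable; only functions pulled back to `G` are visibly measurable. -/
theorem IsLatticeQuotient.measurable_of_comp {E : Type*} [MeasurableSpace E]
    (h : IsLatticeQuotient Γ π) {g : Q → E} (hg : Measurable fun a => g (π a)) : Measurable g := by
  have hq := h.isOpenQuotientMap
  have : SecondCountableTopology Q :=
    hq.isQuotientMap.secondCountableTopology hq.isOpenMap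
  have : PolishSpace G := polishSpace_of_locallyCompact_addGroup
  exact (hq.continuous.measurable.measurable_comp_iff_of_surjective hq.surjective).1 hg

/-- A sum over a coset does not depend on its representative, so pulled back to `G` the section
disappears. -/
theorem IsLatticeQuotient.measurable_tsum (h : IsLatticeQuotient Γ π) (hs : ∀ x, π (s x) = x)
    {f : G → ℝ≥0∞} (hf : Measurable f) : Measurable fun x => ∑' u : Γ, f (s x + u) := by
  refine h.measurable_of_comp ?_
  have : (fun a => ∑' u : Γ, f (s (π a) + u)) = fun a => ∑' u : Γ, f (a + u) :=
    funext fun a => h.tsum_congr f (hs _)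
  rw [this]
  exact Measurable.tsum fun u => hf.comp (measurable_id.add_const _)

theorem IsLatticeQuotient.measurable_kernel (h : IsLatticeQuotient Γ π) (hs : ∀ x, π (s x) = x) :
    Measurable fun x : Q => Measure.sum fun u : Γ => Measure.dirac (s x + (u : G)) := by
  refine Measure.measurable_of_measurable_coe _ fun B hB => ?_
  have := h.measurable_tsum hs (f := B.indicator 1) (measurable_one.indicator hB)
  convert this using 2 with x
  rw [Measure.sum_apply _ hB]
  simp [Measure.dirac_apply' _ hB]

variable (ν : Measure Q)

theorem IsLatticeQuotient.lintegral_cosetMeasure (h : IsLatticeQuotient Γ π)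
    (hs : ∀ x, π (s x) = x) {f : G → ℝ≥0∞} (hf : Measurable f) :
    ∫⁻ a, f a ∂(cosetMeasure Γ s ν) = ∫⁻ x, ∑' u : Γ, f (s x + u) ∂ν := by
  rw [cosetMeasure, Measure.lintegral_bind (h.measurable_kernel hs).aemeasurable hf.aemeasurable]
  refine lintegral_congr fun x => ?_
  rw [lintegral_sum_measure]
  exact _root_.tsum_congr fun u => lintegral_dirac' _ hf

theorem IsLatticeQuotient.cosetMeasure_apply (h : IsLatticeQuotient Γ π)
    (hs : ∀ x, π (s x) = x) {B : Set G} (hB : MeasurableSet B) :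
    cosetMeasure Γ s ν B = ∫⁻ x, ∑' u : Γ, B.indicator 1 (s x + (u : G)) ∂ν := by
  rw [← h.lintegral_cosetMeasure ν hs (measurable_one.indicator hB), lintegral_indicator_one hB]

variable {ν} in
/-- Unfolding: an integral over `G` is the integral over `Q` of the sums over the cosets. -/
theorem IsLatticeQuotient.integral_cosetMeasure (h : IsLatticeQuotient Γ π)
    (hs : ∀ x, π (s x) = x) {f : G → ℂ} (hf : Integrable f (cosetMeasure Γ s ν))
    (hsum : ∀ a, Summable fun u : Γ => f (a + u)) :
    Integrable (fun x => ∑' u : Γ, f (s x + u)) ν ∧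
    ∫ a, f a ∂(cosetMeasure Γ s ν) = ∫ x, ∑' u : Γ, f (s x + u) ∂ν := by
  -- Regarding the measure as a composition of kernels makes the unfolding an instance of Fubini for
  -- kernels.
  let κ : ProbabilityTheory.Kernel Q G := ⟨_, h.measurable_kernel hs⟩
  have e : cosetMeasure Γ s ν = (κ.comp (ProbabilityTheory.Kernel.const Unit ν)) () := by
    rw [ProbabilityTheory.Kernel.comp_apply, ProbabilityTheory.Kernel.const_apply]; rfl
  have hκ : ∀ x, ∫ y, f y ∂κ x = ∑' u : Γ, f (s x + u) := by
    intro x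
    have := integral_sum_dirac_eq_tsum (x := fun u : Γ => s x + (u : G)) (c := fun _ => 1) (f := f)
      (by simp) (by simpa using (hsum (s x)).norm)
    simpa [κ] using! this
  rw [e] at hf ⊢
  constructor
  · have := hf.integral_comp
    simp only [hκ, ProbabilityTheory.Kernel.const_apply] at this
    exact this
  · rw [ProbabilityTheory.Kernel.integral_comp hf]
    simp only [hκ, ProbabilityTheory.Kernel.const_apply]

/-- A neighbourhood of zero that is disjoint from its translates by a discrete subgroup. -/
theorem exists_nhds_zero_translates_disjoint {G : Type*} [AddCommGroup G] [TopologicalSpace G]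
    [IsTopologicalAddGroup G] {Γ : AddSubgroup G} [DiscreteTopology Γ] :
    ∃ V ∈ 𝓝 (0 : G), IsOpen V ∧ ∀ x ∈ V, ∀ y ∈ V, y - x ∈ Γ → x = y := by
  obtain ⟨U, hU, hUΓ⟩ : ∃ U ∈ 𝓝 (0 : G), ∀ u : Γ, (u : G) ∈ U → u = 0 := by
    have h0 : ({0} : Set Γ) ∈ 𝓝 (0 : Γ) := by simp
    rw [nhds_subtype_eq_comap, mem_comap] at h0
    obtain ⟨U, hU, h⟩ := h0
    exact ⟨U, hU, fun u hu => h hu⟩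
  have ht : Tendsto (fun p : G × G => p.2 - p.1) (𝓝 0 ×ˢ 𝓝 0) (𝓝 0) := by
    have : Continuous fun p : G × G => p.2 - p.1 := by fun_prop
    have := this.tendsto (0, 0)
    rwa [nhds_prod_eq, sub_zero] at this
  obtain ⟨V, hV, hVU⟩ := mem_prod_same_iff.1 (ht hU)
  refine ⟨interior V, interior_mem_nhds.2 hV, isOpen_interior, fun x hx y hy hxy => ?_⟩
  have h2 := hUΓ ⟨y - x, hxy⟩ (hVU (Set.mk_mem_prod (interior_subset hx) (interior_subset hy)))
  exact (sub_eq_zero.1 (congrArg Subtype.val h2)).symm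

variable [DiscreteTopology Γ] [IsProbabilityMeasure ν] [ν.IsAddHaarMeasure]

/-- Invariance: translation by `b` carries coset sums to coset sums and moves the base point by `π
b`, which `ν` ignores. Local finiteness: a small open set meets each coset at most once, so its
measure is at most `ν Q = 1`. Positivity: an open `U` has measure at least `ν (π '' U)`. -/
theorem IsLatticeQuotient.isAddHaarMeasure_cosetMeasure (h : IsLatticeQuotient Γ π)
    (hs : ∀ x, π (s x) = x) : (cosetMeasure Γ s ν).IsAddHaarMeasure := by
  have hinv : (cosetMeasure Γ s ν).IsAddLeftInvariant := by
    refine ⟨fun b => ?_⟩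
    refine Measure.ext fun B hB => ?_
    rw [Measure.map_apply (measurable_const_add b) hB,
      h.cosetMeasure_apply ν hs (measurable_const_add b hB), h.cosetMeasure_apply ν hs hB,
      ← lintegral_add_left_eq_self (μ := ν)
        (fun x => ∑' u : Γ, B.indicator (1 : G → ℝ≥0∞) (s x + (u : G))) (π b)]
    refine lintegral_congr fun x => ?_
    have h1 : ∀ u : Γ, ((b + ·) ⁻¹' B).indicator (1 : G → ℝ≥0∞) (s x + u)
        = B.indicator 1 ((b + s x) + u) := by
      intro u
      rw [add_assoc]
      rfl
    simp_rw [h1]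
    exact h.tsum_congr (B.indicator (1 : G → ℝ≥0∞)) (by rw [map_add, hs, hs])
  have hfin : IsFiniteMeasureOnCompacts (cosetMeasure Γ s ν) := by
    have : IsLocallyFiniteMeasure (cosetMeasure Γ s ν) := by
      obtain ⟨V, hV, hVo, hVΓ⟩ := exists_nhds_zero_translates_disjoint (Γ := Γ)
      refine ⟨fun a => ⟨(fun z => z - a) ⁻¹' V, ?_, ?_⟩⟩
      · have : Tendsto (fun z => z - a) (𝓝 a) (𝓝 0) := by
          have : Continuous fun z : G => z - a := by fun_prop
          simpa using this.tendsto a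
        exact this hV
      · have hm : MeasurableSet ((fun z => z - a) ⁻¹' V) :=
          (hVo.preimage (continuous_id.sub continuous_const)).measurableSet
        rw [h.cosetMeasure_apply ν hs hm]
        refine lt_of_le_of_lt (lintegral_mono (g := fun _ => 1) fun x => ?_) (by simp)
        by_cases hx : ∃ u : Γ, s x + (u : G) - a ∈ V
        · obtain ⟨u, hu⟩ := hx
          rw [tsum_eq_single u]
          · exact Set.indicator_le_self' (fun _ _ => zero_le) _
          · intro w hw
            refine Set.indicator_of_notMem (fun hw' => hw ?_) _
            have h3 := hVΓ _ hu _ hw' (by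
              have : s x + (w : G) - a - (s x + (u : G) - a) = ((w - u : Γ) : G) := by
                push_cast; abel
              rw [this]; exact (w - u).2)
            exact Subtype.ext (by simpa using h3.symm)
        · push Not at hx
          have : ∀ u : Γ, ((fun z => z - a) ⁻¹' V).indicator (1 : G → ℝ≥0∞) (s x + (u : G)) = 0 :=
            fun u => Set.indicator_of_notMem (s := (fun z => z - a) ⁻¹' V) (hx u) _
          simp [this]
    infer_instance
  refine { toIsFiniteMeasureOnCompacts := hfin, toIsAddLeftInvariant := hinv, toIsOpenPosMeasure := ⟨?_⟩ }
  intro U hU hne h0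
  have h1 : 0 < ν (π '' U) :=
    (h.isOpenQuotientMap.isOpenMap U hU).measure_pos ν (hne.image _)
  have h2 : ν (π '' U) ≤ cosetMeasure Γ s ν U := by
    rw [h.cosetMeasure_apply ν hs hU.measurableSet,
      ← lintegral_indicator_one (h.isOpenQuotientMap.isOpenMap U hU).measurableSet]
    refine lintegral_mono fun x => ?_
    by_cases hx : x ∈ π '' U
    swap
    · rw [Set.indicator_of_notMem hx]
      exact zero_le
    obtain ⟨a, ha, rfl⟩ := hx
    obtain ⟨u, hu⟩ := h.exists_add_eq (hs (π a))
    refine le_trans ?_ (ENNReal.le_tsum u)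
    rw [← hu]
    exact (Set.indicator_le_self' (fun _ _ => zero_le) _).trans (by simp [ha])
  exact absurd (h2.trans_eq h0) (not_le.2 h1)

end Lattice

/-! ### Summability over a discrete subgroup -/

section Decay

variable {G : Type*} [AddCommGroup G] [TopologicalSpace G] [IsTopologicalAddGroup G]
  [LocallyCompactSpace G] [T2Space G] [SecondCountableTopology G] [MeasurableSpace G] [BorelSpace G]
  {Γ : AddSubgroup G} [Countable Γ] [DiscreteTopology Γ] (μ : Measure G) [μ.IsAddHaarMeasure]

/-- A function that is locally dominated by an integrable function is summable over the cosets of a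
discrete subgroup. -/
theorem summable_of_locally_dominated {f g : G → ℝ} (hf : ∀ a, 0 ≤ f a) 
    (hg : Integrable g μ) {V : Set G} (hV : V ∈ 𝓝 (0 : G))
    (hfg : ∀ a, ∀ w ∈ V, f a ≤ g (a + w)) (a : G) : Summable fun u : Γ => f (a + u) := by
  obtain ⟨W, hW, hWo, hWΓ⟩ := exists_nhds_zero_translates_disjoint (Γ := Γ)
  set T := W ∩ interior V with hT
  have hTo : IsOpen T := hWo.inter isOpen_interior
  have hT0 : (0 : G) ∈ T := ⟨mem_of_mem_nhds hW, mem_interior_iff_mem_nhds.2 hV⟩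
  obtain ⟨K, hK, hKT⟩ := exists_compact_subset hTo hT0
  set T' := interior K
  have hpos : 0 < μ T' := isOpen_interior.measure_pos μ ⟨0, hKT.1⟩
  have hfin : μ T' < ∞ := (measure_mono interior_subset).trans_lt hK.measure_lt_top
  have hT'T : T' ⊆ T := interior_subset.trans hKT.2
  have hm : ∀ u : Γ, MeasurableSet ((fun z => z - (a + (u : G))) ⁻¹' T') := fun u =>
    (isOpen_interior.preimage (continuous_id.sub continuous_const)).measurableSet
  -- The translates of `T'` to the points `a + u` are disjoint, have equal positive measure, and `g`
  -- is at least `f (a + u)` on the one at `a + u`. So the sum times `μ T'` is bounded by the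
  -- integral of `g`.
  have key : ∑' u : Γ, ENNReal.ofReal (f (a + u)) * μ T' ≤ ∫⁻ z, ENNReal.ofReal (g z) ∂μ := by
    calc ∑' u : Γ, ENNReal.ofReal (f (a + u)) * μ T'
        ≤ ∑' u : Γ, ∫⁻ z in (fun z => z - (a + (u : G))) ⁻¹' T', ENNReal.ofReal (g z) ∂μ := by
          refine ENNReal.tsum_le_tsum fun u => ?_
          have : μ ((fun z => z - (a + (u : G))) ⁻¹' T') = μ T' := by
            simp_rw [sub_eq_add_neg]
            exact measure_preimage_add_right μ _ _
          rw [← this, ← setLIntegral_const]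
          refine setLIntegral_mono' (hm u) fun z hz => ENNReal.ofReal_le_ofReal ?_
          have := hfg (a + u) _ (interior_subset (hT'T hz).2)
          simpa using this
      _ = ∫⁻ z in ⋃ u : Γ, (fun z => z - (a + (u : G))) ⁻¹' T', ENNReal.ofReal (g z) ∂μ := by
          rw [lintegral_iUnion hm]
          intro u w huw
          refine Set.disjoint_left.2 fun z hz hz' => huw ?_
          have h3 := hWΓ _ (hT'T hz).1 _ (hT'T hz').1 (by
            have : z - (a + (w : G)) - (z - (a + (u : G))) = ((u - w : Γ) : G) := by
              push_cast; abel
            rw [this]; exact (u - w).2)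
          exact Subtype.ext (by simpa using h3)
      _ ≤ _ := setLIntegral_le_lintegral _ _
  have hlt : ∫⁻ z, ENNReal.ofReal (g z) ∂μ < ∞ := by
    have := hg.lintegral_lt_top
    exact this
  rw [ENNReal.tsum_mul_right] at key
  have hne : ∑' u : Γ, ENNReal.ofReal (f (a + u)) ≠ ∞ := by
    intro htop
    rw [htop, ENNReal.top_mul hpos.ne'] at key
    exact absurd hlt (not_lt.2 key)
  have := ENNReal.summable_toReal hne
  simpa [ENNReal.toReal_ofReal (hf _)] using this

end Decay

/-! ### Fourier series on a compact abelian group -/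

section Fourier

variable {Q : Type*} [AddCommGroup Q] [TopologicalSpace Q] [IsTopologicalAddGroup Q]
  [CompactSpace Q] [T2Space Q] [MeasurableSpace Q] [BorelSpace Q] (ν : Measure Q)
  [IsProbabilityMeasure ν] [ν.IsAddHaarMeasure] {ι : Type*} [AddCommGroup ι]

/-- A non-trivial character of a compact group has integral zero. -/
theorem integral_character_eq_zero {χ : Q → ℂ} (hadd : ∀ a b, χ (a + b) = χ a * χ b) {b : Q}
    (hb : χ b ≠ 1) : ∫ q, χ q ∂ν = 0 := by
  have h1 : ∫ q, χ q ∂ν = χ b * ∫ q, χ q ∂ν := by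
    rw [← integral_const_mul, ← integral_add_left_eq_self _ b]
    simp_rw [hadd]
  have h2 : (χ b - 1) * ∫ q, χ q ∂ν = 0 := by rw [sub_mul, ← h1]; ring
  exact (mul_eq_zero.1 h2).resolve_left (sub_ne_zero.2 hb)

/-- A continuous function on a compact group that is orthogonal to a separating group of characters
vanishes. -/
theorem eq_zero_of_forall_integral_mul_character_eq_zero (e : ι → C(Q, ℂ))
    (e_zero : e 0 = 1) (e_add : ∀ x y, e (x + y) = e x * e y) (e_neg : ∀ x, e (-x) = star (e x))
    (hsep : ∀ a b : Q, a ≠ b → ∃ x, e x a ≠ e x b) (f : C(Q, ℂ))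
    (hf : ∀ x, ∫ q, f q * e x q ∂ν = 0) : f = 0 := by
  let S : StarSubalgebra ℂ C(Q, ℂ) :=
    { Algebra.adjoin ℂ (Set.range e) with
      star_mem' := by
        intro g hg
        change star g ∈ Algebra.adjoin ℂ (Set.range e)
        induction hg using Algebra.adjoin_induction with
        | mem g hg =>
          obtain ⟨x, rfl⟩ := hg
          rw [← e_neg]
          exact Algebra.subset_adjoin ⟨_, rfl⟩
        | algebraMap c =>
          have : star (algebraMap ℂ C(Q, ℂ) c) = algebraMap ℂ C(Q, ℂ) (star c) := by
            ext; simp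
          rw [this]
          exact Subalgebra.algebraMap_mem _ _
        | add g h _ _ hg hh => rw [star_add]; exact add_mem hg hh
        | mul g h _ _ hg hh => rw [star_mul']; exact mul_mem hg hh }
  have hS : S.topologicalClosure = ⊤ := by
    refine ContinuousMap.starSubalgebra_topologicalClosure_eq_top_of_separatesPoints S ?_
    intro a b hab
    obtain ⟨x, hx⟩ := hsep a b hab
    exact ⟨_, ⟨e x, Algebra.subset_adjoin ⟨x, rfl⟩, rfl⟩, hx⟩
  have hcont : Continuous fun g : C(Q, ℂ) => ∫ q, f q * g q ∂ν := by
    have h1 : Continuous fun g : C(Q, ℂ) => ContinuousMap.toLp 1 ν ℂ (f * g) :=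
      (ContinuousLinearMap.continuous _).comp (continuous_const.mul continuous_id)
    have h2 := continuous_integral.comp h1
    convert h2 using 2 with g
    exact integral_congr_ae ((ContinuousMap.coeFn_toLp (p := 1) (𝕜 := ℂ) ν (f * g)).symm)
  have hint : ∀ g : C(Q, ℂ), Integrable (fun q => f q * g q) ν := fun g =>
    (f * g).continuous.integrable_of_hasCompactSupport (HasCompactSupport.of_compactSpace _)
  have hadj : ∀ g ∈ Algebra.adjoin ℂ (Set.range e), ∫ q, f q * g q ∂ν = 0 := by
    intro g hg
    rw [← Subalgebra.mem_toSubmodule, Algebra.adjoin_eq_span] at hg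
    -- The given characters are closed under products, so the algebra they generate is just their
    -- linear span; on it orthogonality to `f` is linear.
    have hcl : (Submonoid.closure (Set.range e) : Set C(Q, ℂ)) ⊆ Set.range e := by
      intro g hg
      induction hg using Submonoid.closure_induction with
      | mem g hg => exact hg
      | one => exact ⟨0, e_zero⟩
      | mul g h _ _ hg hh =>
        obtain ⟨x, rfl⟩ := hg
        obtain ⟨y, rfl⟩ := hh
        exact ⟨x + y, e_add x y⟩
    induction hg using Submodule.span_induction with
    | mem g hg => obtain ⟨x, rfl⟩ := hcl hg; exact hf x
    | zero => simp
    | add g h _ _ hg hh =>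
      simp only [ContinuousMap.add_apply, mul_add]
      rw [integral_add (hint g) (hint h), hg, hh, add_zero]
    | smul c g _ hg =>
      simp only [ContinuousMap.smul_apply, smul_eq_mul, mul_left_comm _ c]
      rw [integral_const_mul, hg, mul_zero]
  have hall : ∀ g : C(Q, ℂ), ∫ q, f q * g q ∂ν = 0 := by
    intro g
    have hg : g ∈ S.topologicalClosure := by rw [hS]; trivial
    have hclosed : IsClosed {g : C(Q, ℂ) | ∫ q, f q * g q ∂ν = 0} :=
      isClosed_eq hcont continuous_const
    have hg' : g ∈ closure (S : Set C(Q, ℂ)) := hg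
    exact closure_minimal (fun g hg => hadj g hg) hclosed hg'
  -- By density `f` is orthogonal to every continuous function, in particular to its own conjugate.
  have h0 := hall (star f)
  have h1 : ∫ q, ‖f q‖ ^ 2 ∂ν = 0 := by
    have : ∀ q, f q * (star f) q = ((‖f q‖ ^ 2 : ℝ) : ℂ) := by
      intro q
      rw [ContinuousMap.star_apply, RCLike.star_def, RCLike.mul_conj]
      push_cast
      rfl
    simp_rw [this] at h0
    rw [integral_complex_ofReal] at h0
    exact_mod_cast h0
  have hc : Continuous fun q => ‖f q‖ ^ 2 := by fun_prop
  have h2 := (hc.integral_pos_of_hasCompactSupport_nonneg_nonzero (μ := ν) (x := ·)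
    (HasCompactSupport.of_compactSpace _) (fun q => by positivity))
  ext q
  by_contra hq
  exact (h2 q (by simpa using hq)).ne' h1

/-- Absolutely convergent Fourier series represent their functions. -/
theorem tsum_fourier_coefficients (e : ι → C(Q, ℂ))
    (e_zero : e 0 = 1) (e_add : ∀ x y, e (x + y) = e x * e y) (e_neg : ∀ x, e (-x) = star (e x))
    (hchar : ∀ x a b, e x (a + b) = e x a * e x b) (hnorm : ∀ x a, ‖e x a‖ = 1)
    (hnt : ∀ x, x ≠ 0 → ∃ a, e x a ≠ 1)
    (hsep : ∀ a b : Q, a ≠ b → ∃ x, e x a ≠ e x b) (f : C(Q, ℂ))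
    (hsum : Summable fun x => ‖∫ q, f q * e x q ∂ν‖) :
    ∑' x, (∫ q, f q * e x q ∂ν) = f 0 := by
  classical
  set c : ι → ℂ := fun x => ∫ q, f q * e x q ∂ν with hc
  have hterm : ∀ x, ‖c x • e (-x)‖ ≤ ‖c x‖ := by
    intro x
    refine (norm_smul_le _ _).trans (mul_le_of_le_one_right (norm_nonneg _) ?_)
    exact (ContinuousMap.norm_le _ zero_le_one).2 fun q => (hnorm _ _).le
  have hS : Summable fun x => c x • e (-x) := Summable.of_norm_bounded hsum hterm
  -- The sum of the Fourier series converges uniformly; it is identified with `f` by comparing all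
  -- Fourier coefficients. The sign occurs because `c x` pairs `f` with `e x` rather than with its
  -- conjugate.
  set g : C(Q, ℂ) := ∑' x, c x • e (-x) with hg
  have horth : ∀ x y, ∫ q, e (-x) q * e y q ∂ν = if x = y then 1 else 0 := by
    intro x y
    have : ∀ q, e (-x) q * e y q = e (y - x) q := by
      intro q
      rw [sub_eq_neg_add, e_add]; rfl
    simp_rw [this]
    split_ifs with hxy
    · subst hxy
      simp [e_zero]
    · obtain ⟨a, ha⟩ := hnt (y - x) (sub_ne_zero.2 (Ne.symm hxy))
      exact integral_character_eq_zero ν (hchar _) ha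
  have hgf : f - g = 0 := by
    refine eq_zero_of_forall_integral_mul_character_eq_zero ν e e_zero e_add e_neg hsep _ fun y => ?_
    -- Taking the coefficient at `y` is a continuous functional for the uniform norm, so it may be
    -- applied to the series term by term.
    let Λ : C(Q, ℂ) →L[ℂ] ℂ :=
      (L1.integralCLM' ℂ (α := Q) (E := ℂ) (μ := ν)).comp
        ((ContinuousMap.toLp 1 ν ℂ).comp (ContinuousLinearMap.mul ℂ C(Q, ℂ) (e y)))
    have hΛ : ∀ h : C(Q, ℂ), Λ h = ∫ q, h q * e y q ∂ν := by
      intro h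
      have : Λ h = ∫ q, (ContinuousMap.toLp 1 ν ℂ (e y * h)) q ∂ν := by
        rw [← L1.integral_eq_integral, L1.integral_eq' ℂ]
        rfl
      rw [this]
      refine (integral_congr_ae (ContinuousMap.coeFn_toLp (p := 1) (𝕜 := ℂ) ν (e y * h))).trans ?_
      exact integral_congr_ae (ae_of_all _ fun q => mul_comm _ _)
    rw [← hΛ, map_sub, hg, Λ.map_tsum hS, hΛ f]
    have : ∀ x, Λ (c x • e (-x)) = if x = y then c x else 0 := by
      intro x
      rw [map_smul, hΛ, horth, smul_eq_mul]
      split_ifs <;> simp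
    simp_rw [this]
    rw [tsum_ite_eq]
    simp [hc]
  rw [sub_eq_zero] at hgf
  rw [hgf]
  have h0 : ∀ x, e x 0 = 1 := by
    intro x
    have h1 := hchar x 0 0
    rw [add_zero] at h1
    have h2 : e x 0 ≠ 0 := by rw [← norm_ne_zero_iff, hnorm]; norm_num
    exact (mul_eq_left₀ h2).1 h1.symm
  have := (ContinuousMap.hasSum_apply hS.hasSum 0).tsum_eq
  rw [← hg] at this
  rw [← this]
  simp [h0]

end Fourier

end GlobalAdele

namespace GlobalAdele

open Filter Topology

/-! ### The adele ring of a field with finite residue fields -/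

/-- The elementary finiteness properties of the places of a global field. -/
class IsAdelic (k : Type*) [Field k] : Prop where
  countable : Countable k
  infinite : Infinite k
  finite_infinitePlace : Finite (NumberField.InfinitePlace k)
  finite_residueField : ∀ v : FinitePlace k, Finite (IsLocalRing.ResidueField v.1.valuationSubring)
  finite_ne_one : ∀ x : k, x ≠ 0 → {v : FinitePlace k | v.1 x ≠ 1}.Finite

attribute [instance] IsAdelic.countable IsAdelic.infinite IsAdelic.finite_infinitePlace
  IsAdelic.finite_residueField

section Coordinates

variable {k : Type*} [Field k]

theorem Adele.ext {a b : Adele k} (h1 : ∀ w, a.1 w = b.1 w) (h2 : ∀ v, a.2 v = b.2 v) : a = b :=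
  Prod.ext (funext h1) (RestrictedProduct.ext _ _ h2)

@[simp] theorem Adele.add_fst (a b : Adele k) (w) : (a + b).1 w = a.1 w + b.1 w := rfl
@[simp] theorem Adele.add_snd (a b : Adele k) (v) : (a + b).2 v = a.2 v + b.2 v := rfl
@[simp] theorem Adele.sub_fst (a b : Adele k) (w) : (a - b).1 w = a.1 w - b.1 w := rfl
@[simp] theorem Adele.sub_snd (a b : Adele k) (v) : (a - b).2 v = a.2 v - b.2 v := rfl
@[simp] theorem Adele.neg_fst (a : Adele k) (w) : (-a).1 w = -a.1 w := rfl
@[simp] theorem Adele.neg_snd (a : Adele k) (v) : (-a).2 v = -a.2 v := rfl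
@[simp] theorem Adele.mul_fst (a b : Adele k) (w) : (a * b).1 w = a.1 w * b.1 w := rfl
@[simp] theorem Adele.mul_snd (a b : Adele k) (v) : (a * b).2 v = a.2 v * b.2 v := rfl
@[simp] theorem Adele.zero_fst (w) : (0 : Adele k).1 w = 0 := rfl
@[simp] theorem Adele.zero_snd (v) : (0 : Adele k).2 v = 0 := rfl
@[simp] theorem Adele.one_fst (w) : (1 : Adele k).1 w = 1 := rfl
@[simp] theorem Adele.one_snd (v) : (1 : Adele k).2 v = 1 := rfl

theorem Adele.continuous_fst : Continuous fun a : Adele k => a.1 := _root_.continuous_fst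

theorem Adele.continuous_snd : Continuous fun a : Adele k => a.2 := _root_.continuous_snd

theorem Adele.continuous_fst_apply (w : NumberField.InfinitePlace k) :
    Continuous fun a : Adele k => a.1 w := (continuous_apply w).comp Adele.continuous_fst

instance : T2Space (Adele k) :=
  inferInstanceAs (T2Space ((∀ w : NumberField.InfinitePlace k, w.Completion) × FiniteAdele k))

theorem Adele.eventually_le_one (a : Adele k) :
    {v : FinitePlace k | ¬ Valued.v (a.2 v) ≤ 1}.Finite :=
  a.2.2

/-- The adele with prescribed coordinates. -/
def Adele.mk (x : ∀ w : NumberField.InfinitePlace k, w.Completion)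
    (y : ∀ v : FinitePlace k, v.Completion) (hy : {v | ¬ Valued.v (y v) ≤ 1}.Finite) : Adele k :=
  (x, ⟨y, hy⟩)

@[simp] theorem Adele.mk_fst (x : ∀ w : NumberField.InfinitePlace k, w.Completion)
    (y : ∀ v : FinitePlace k, v.Completion) (hy) (w) : (Adele.mk x y hy).1 w = x w := rfl
@[simp] theorem Adele.mk_snd (x : ∀ w : NumberField.InfinitePlace k, w.Completion)
    (y : ∀ v : FinitePlace k, v.Completion) (hy) (v) : (Adele.mk x y hy).2 v = y v := rfl

variable (k) in
/-- The adeles that are integral at all non-archimedean places. -/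
def integralAdeles : AddSubgroup (Adele k) where
  carrier := {a | ∀ v, Valued.v (a.2 v) ≤ 1}
  zero_mem' v := by simp
  add_mem' ha hb v := ((Valued.v).map_add _ _).trans (max_le (ha v) (hb v))
  neg_mem' ha v := by rw [Adele.neg_snd, Valuation.map_neg]; exact ha v

theorem mem_integralAdeles {a : Adele k} : a ∈ integralAdeles k ↔ ∀ v, Valued.v (a.2 v) ≤ 1 :=
  Iff.rfl

theorem isOpen_integralAdeles : IsOpen (integralAdeles k : Set (Adele k)) :=
  (RestrictedProduct.isOpen_forall_mem (fun v : FinitePlace k =>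
    Valued.isOpen_valuationSubring v.Completion)).preimage Adele.continuous_snd

theorem isClosed_integralAdeles : IsClosed (integralAdeles k : Set (Adele k)) :=
  AddSubgroup.isClosed_of_isOpen _ isOpen_integralAdeles

open Classical in
/-- The coordinate embedding of `k_v` in the adeles. -/
noncomputable def Adele.single (v : FinitePlace k) (y : v.Completion) : Adele k :=
  Adele.mk 0 (Pi.single v y) ((Set.finite_singleton v).subset fun w hw => by
    by_contra h
    refine hw ?_
    rw [Pi.single_eq_of_ne h]
    simp)

@[simp] theorem Adele.single_fst (v : FinitePlace k) (y : v.Completion) (w) :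
    (Adele.single v y).1 w = 0 := rfl

open Classical in
@[simp] theorem Adele.single_snd_self (v : FinitePlace k) (y : v.Completion) :
    (Adele.single v y).2 v = y := Pi.single_eq_same (M := fun v : FinitePlace k => v.Completion) v y

open Classical in
theorem Adele.single_snd_of_ne {v w : FinitePlace k} (h : w ≠ v) (y : v.Completion) :
    (Adele.single v y).2 w = 0 := Pi.single_eq_of_ne h y

theorem Adele.eq_single {a : Adele k} {v : FinitePlace k} (h1 : a.1 = 0)
    (h2 : ∀ w, w ≠ v → a.2 w = 0) : a = Adele.single v (a.2 v) := by
  refine Adele.ext (fun w => by rw [h1]; rfl) fun w => ?_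
  by_cases h : w = v
  · subst h; rw [Adele.single_snd_self]
  · rw [h2 w h, Adele.single_snd_of_ne h]

theorem Adele.single_sub (v : FinitePlace k) (y z : v.Completion) :
    Adele.single v (y - z) = Adele.single v y - Adele.single v z := by
  refine Adele.ext (fun w => by simp) fun w => ?_
  by_cases h : w = v
  · subst h; simp
  · simp [Adele.single_snd_of_ne h]

theorem Adele.single_mul (v : FinitePlace k) (y : v.Completion) (a : Adele k) :
    Adele.single v y * a = Adele.single v (y * a.2 v) := by
  refine Adele.ext (fun w => by simp) fun w => ?_
  by_cases h : w = v
  · subst h; simp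
  · simp [Adele.single_snd_of_ne h]

/-- Basic neighbourhoods of zero in the adele ring. -/
theorem Adele.exists_box_subset {s : Set (Adele k)} (hs : s ∈ 𝓝 (0 : Adele k))
    [Finite (NumberField.InfinitePlace k)] :
    ∃ ε > 0, ∃ S : Finset (FinitePlace k), ∃ n : ℤ, ∀ a : Adele k, (∀ w, ‖a.1 w‖ < ε) →
      (∀ v, Valued.v (a.2 v) ≤ 1) → (∀ v ∈ S, Valued.v (a.2 v) ≤ WithZero.exp n) → a ∈ s := by
  have hs' : s ∈ 𝓝 (0 : ∀ w : NumberField.InfinitePlace k, w.Completion) ×ˢ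
      𝓝 (0 : FiniteAdele k) := by
    rw [← nhds_prod_eq]; exact hs
  obtain ⟨U, hU, T, hT, hUT⟩ := mem_prod_iff.1 hs'
  cases nonempty_fintype (NumberField.InfinitePlace k)
  obtain ⟨ε, hε, hεU⟩ := Metric.mem_nhds_iff.1 hU
  have hT' : T ∈ 𝓝 (RestrictedProduct.structureMap (fun v : FinitePlace k => v.Completion)
      (fun v => v.integers) cofinite 0) := hT
  rw [RestrictedProduct.nhds_eq_map_structureMap (fun v : FinitePlace k =>
    Valued.isOpen_valuationSubring v.Completion), mem_map, nhds_pi, Filter.mem_pi] at hT'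
  obtain ⟨I, hI, t, ht, hIt⟩ := hT'
  have ht' : ∀ v, ∃ n : ℤ, ∀ y : v.integers, Valued.v (y : v.Completion) ≤ WithZero.exp n →
      y ∈ t v := by
    intro v
    have := ht v
    rw [nhds_subtype_eq_comap, mem_comap] at this
    obtain ⟨r, hr, hrt⟩ := this
    obtain ⟨n, hn⟩ := v.mem_nhds_zero.1 hr
    exact ⟨n, fun y hy => hrt (hn hy)⟩
  choose n hn using ht'
  obtain ⟨m, hm⟩ := (hI.image n).bddBelow
  refine ⟨ε, hε, hI.toFinset, m, fun a h1 h2 h3 => hUT ⟨hεU ?_, ?_⟩⟩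
  · rw [Metric.mem_ball, dist_zero_right, pi_norm_lt_iff hε]
    exact h1
  · have : a.2 = RestrictedProduct.structureMap (fun v : FinitePlace k => v.Completion)
        (fun v => v.integers) cofinite (fun v => ⟨a.2 v, h2 v⟩) := rfl
    change a.2 ∈ T
    rw [this]
    refine hIt fun v hv => hn v _ ((h3 v (hI.mem_toFinset.2 hv)).trans ?_)
    exact WithZero.exp_le_exp.2 (hm ⟨v, hv, rfl⟩)

end Coordinates

section IsAdelic

variable (k : Type*) [Field k] [IsAdelic k]

/-- Every place is non-trivial on some `x ≠ 0`, each such `x` is responsible for finitely many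
places, and `k` is countable. -/
instance : Countable (FinitePlace k) := by
  have h : (⋃ x : {x : k // x ≠ 0}, {v : FinitePlace k | v.1 x ≠ 1}) = Set.univ := by
    refine Set.eq_univ_of_forall fun v => ?_
    obtain ⟨x, hx, hvx⟩ := v.exists_valuation_eq_exp 1
    refine Set.mem_iUnion.2 ⟨⟨x, hx⟩, ?_⟩
    change v.1 x ≠ 1
    rw [hvx, ← WithZero.exp_zero]
    intro h
    exact one_ne_zero (WithZero.exp_injective h)
  rw [← Set.countable_univ_iff, ← h]
  exact Set.countable_iUnion fun x => (IsAdelic.finite_ne_one _ x.2).countable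

instance (v : FinitePlace k) : CompactSpace v.integers := v.compactSpace_integers

instance : LocallyCompactSpace (Adele k) :=
  inferInstanceAs (LocallyCompactSpace
    ((∀ w : NumberField.InfinitePlace k, w.Completion) × FiniteAdele k))

variable {k}

theorem isCompact_infinite_closedBall (w : NumberField.InfinitePlace k) (r : ℝ) :
    IsCompact {x : w.Completion | ‖x‖ ≤ r} := by
  have he := NumberField.InfinitePlace.Completion.isometry_extensionEmbedding w
  have hc : Topology.IsClosedEmbedding
      (NumberField.InfinitePlace.Completion.extensionEmbedding w) :=
    he.isClosedEmbedding
  have := hc.isCompact_preimage (isCompact_closedBall (0 : ℂ) r)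
  convert this using 1
  ext x
  have h0 := he.norm_map_of_map_zero (map_zero _) x
  simp [h0]

/-- The product of archimedean balls of radius `r` and the rings of integers `O_v`. -/
def adeleBox (k : Type*) [Field k] (r : ℝ) : Set (Adele k) :=
  {a | (∀ w, ‖a.1 w‖ ≤ r) ∧ ∀ v, Valued.v (a.2 v) ≤ 1}

theorem isCompact_adeleBox (r : ℝ) : IsCompact (adeleBox k r) := by
  have h1 : IsCompact (Set.univ.pi fun w : NumberField.InfinitePlace k =>
      {x : w.Completion | ‖x‖ ≤ r}) :=
    isCompact_univ_pi fun w => isCompact_infinite_closedBall w r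
  have h2 : IsCompact (Set.range (RestrictedProduct.structureMap
      (fun v : FinitePlace k => v.Completion) (fun v => v.integers) cofinite)) := by
    have : CompactSpace ((v : FinitePlace k) → v.integers) := Pi.compactSpace
    exact isCompact_range RestrictedProduct.isEmbedding_structureMap.continuous
  have h3 := h1.prod h2
  have : adeleBox k r = (Set.univ.pi fun w : NumberField.InfinitePlace k =>
      {x : w.Completion | ‖x‖ ≤ r}) ×ˢ (Set.range (RestrictedProduct.structureMap
      (fun v : FinitePlace k => v.Completion) (fun v => v.integers) cofinite)) := by
    rw [RestrictedProduct.range_structureMap]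
    ext a
    constructor
    · rintro ⟨h, h'⟩
      exact ⟨fun w _ => h w, h'⟩
    · rintro ⟨h, h'⟩
      exact ⟨fun w => h w trivial, h'⟩
  rw [this]
  exact h3

theorem adeleBox_mem_nhds {r : ℝ} (hr : 0 < r) : adeleBox k r ∈ 𝓝 (0 : Adele k) := by
  have h1 : ∀ᶠ a : Adele k in 𝓝 0, ∀ w, ‖a.1 w‖ ≤ r := by
    rw [eventually_all]
    intro w
    have := (Adele.continuous_fst_apply w).norm.tendsto (0 : Adele k)
    simp only [Adele.zero_fst, norm_zero] at this
    exact (this.eventually_lt_const hr).mono fun a h => h.le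
  have h2 : ∀ᶠ a : Adele k in 𝓝 0, a ∈ integralAdeles k :=
    isOpen_integralAdeles.mem_nhds (zero_mem _)
  exact h1.and h2

theorem finite_valued_coe_gt (x : k) :
    {v : FinitePlace k | ¬ Valued.v ((x : v.Completion)) ≤ 1}.Finite := by
  rcases eq_or_ne x 0 with rfl | hx
  · refine Set.finite_empty.subset fun v hv => hv ?_
    rw [v.valued_coe]; simp
  · refine (IsAdelic.finite_ne_one x hx).subset fun v hv h => hv ?_
    rw [v.valued_coe, h]

variable (k) in
/-- The diagonal embedding. -/
noncomputable def diag : k →+* Adele k where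
  toFun x := Adele.mk (algebraMap k (NumberField.InfiniteAdeleRing k) x) (fun v => v.coeHom x)
    (finite_valued_coe_gt x)
  map_one' := Adele.ext (fun w => by
      change algebraMap k (NumberField.InfiniteAdeleRing k) 1 w = 1
      rw [map_one]; rfl) (fun v => map_one v.coeHom)
  map_mul' x y := Adele.ext (fun w => by
      change algebraMap k (NumberField.InfiniteAdeleRing k) (x * y) w = _
      rw [map_mul]; rfl) (fun v => map_mul v.coeHom x y)
  map_zero' := Adele.ext (fun w => by
      change algebraMap k (NumberField.InfiniteAdeleRing k) 0 w = 0
      rw [map_zero]; rfl) (fun v => map_zero v.coeHom)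
  map_add' x y := Adele.ext (fun w => by
      change algebraMap k (NumberField.InfiniteAdeleRing k) (x + y) w = _
      rw [map_add]; rfl) (fun v => map_add v.coeHom x y)

@[simp] theorem diag_fst (x : k) (w : NumberField.InfinitePlace k) :
    (diag k x).1 w = (x : w.Completion) := rfl

@[simp] theorem diag_snd (x : k) (v : FinitePlace k) : (diag k x).2 v = (x : v.Completion) := rfl

theorem isDiagonal_iff {x : k} {a : Adele k} : IsDiagonal x a ↔ a = diag k x := by
  constructor
  · rintro ⟨h1, h2⟩
    exact Adele.ext (fun w => by rw [h1]; rfl) h2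
  · rintro rfl
    exact ⟨rfl, fun _ => rfl⟩

theorem mem_principal {a : Adele k} : a ∈ principal k ↔ ∃ x, diag k x = a := by
  change (∃ x : k, IsDiagonal x a) ↔ _
  simp only [isDiagonal_iff, eq_comm]

theorem diag_mem_principal (x : k) : diag k x ∈ principal k := mem_principal.2 ⟨x, rfl⟩

theorem Adele.nontrivial_of_finitePlace [Nonempty (FinitePlace k)] :
    Nontrivial (Adele k) := by
  obtain ⟨v⟩ := ‹Nonempty (FinitePlace k)›
  refine ⟨0, Adele.single v 1, fun h => ?_⟩
  have := congrArg (fun a : Adele k => a.2 v) h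
  simp at this

/-- The bijection between `k` and the group of principal adeles. -/
noncomputable def principalEquiv [Nontrivial (Adele k)] : k ≃+ principal k :=
  AddEquiv.ofBijective
    (AddMonoidHom.codRestrict (diag k : k →+* Adele k).toAddMonoidHom (principal k)
      diag_mem_principal)
    ⟨fun x y h => (diag k).injective (congrArg Subtype.val h), fun a => by
      obtain ⟨x, hx⟩ := mem_principal.1 a.2
      exact ⟨x, Subtype.ext hx⟩⟩

@[simp] theorem coe_principalEquiv [Nontrivial (Adele k)] (x : k) :
    (principalEquiv x : Adele k) = diag k x := rfl

instance : Countable (principal k) := by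
  have : Function.Surjective fun x : k => (⟨diag k x, diag_mem_principal x⟩ : principal k) := by
    intro a
    obtain ⟨x, hx⟩ := mem_principal.1 a.2
    exact ⟨x, Subtype.ext hx⟩
  exact this.countable

end IsAdelic

/-! ### Ideles -/

section Idele

variable {k : Type*} [Field k]

theorem idele_fst_ne_zero (α : (Adele k)ˣ) (w : NumberField.InfinitePlace k) :
    (α : Adele k).1 w ≠ 0 := fun h => by
  have := congrArg (fun a : Adele k => a.1 w) α.mul_inv
  simp only [Adele.mul_fst, h, zero_mul, Adele.one_fst, zero_ne_one] at this

theorem idele_snd_ne_zero (α : (Adele k)ˣ) (v : FinitePlace k) : (α : Adele k).2 v ≠ 0 := fun h => by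
  have := congrArg (fun a : Adele k => a.2 v) α.mul_inv
  simp only [Adele.mul_snd, h, zero_mul, Adele.one_snd, zero_ne_one] at this

theorem idele_inv_fst (α : (Adele k)ˣ) (w : NumberField.InfinitePlace k) :
    ((α⁻¹ : (Adele k)ˣ) : Adele k).1 w = ((α : Adele k).1 w)⁻¹ := by
  have := congrArg (fun a : Adele k => a.1 w) α.mul_inv
  exact (eq_inv_of_mul_eq_one_right this)

theorem idele_inv_snd (α : (Adele k)ˣ) (v : FinitePlace k) :
    ((α⁻¹ : (Adele k)ˣ) : Adele k).2 v = ((α : Adele k).2 v)⁻¹ := by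
  have := congrArg (fun a : Adele k => a.2 v) α.mul_inv
  exact (eq_inv_of_mul_eq_one_right this)

theorem valued_idele (α : (Adele k)ˣ) (v : FinitePlace k) :
    Valued.v ((α : Adele k).2 v) = WithZero.exp ((ideleDivisor α).finite v) :=
  (WithZero.exp_log ((Valuation.ne_zero_iff _).2 (idele_snd_ne_zero α v))).symm

theorem ideleDivisor_mul_finite (α β : (Adele k)ˣ) (v : FinitePlace k) :
    (ideleDivisor (α * β)).finite v = (ideleDivisor α).finite v + (ideleDivisor β).finite v := by
  apply WithZero.exp_injective
  rw [WithZero.exp_add, ← valued_idele, ← valued_idele, ← valued_idele, Units.val_mul,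
    Adele.mul_snd, map_mul]

theorem ideleDivisor_inv_finite (α : (Adele k)ˣ) (v : FinitePlace k) :
    (ideleDivisor α⁻¹).finite v = -(ideleDivisor α).finite v := by
  apply WithZero.exp_injective
  rw [WithZero.exp_neg, ← valued_idele, ← valued_idele, idele_inv_snd, map_inv₀]

theorem finite_support_ideleDivisor (α : (Adele k)ˣ) :
    (Function.support (ideleDivisor α).finite).Finite := by
  refine ((Adele.eventually_le_one (α : Adele k)).union
    (Adele.eventually_le_one ((α⁻¹ : (Adele k)ˣ) : Adele k))).subset fun v hv => ?_
  by_contra h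
  simp only [Set.mem_union, Set.mem_ofPred_eq, not_or, not_not, valued_idele,
    ideleDivisor_inv_finite, ← WithZero.exp_zero, WithZero.exp_le_exp] at h
  exact hv (by omega)

theorem ideleDivisor_infinite_eq_zero_iff (α : (Adele k)ˣ) (w : NumberField.InfinitePlace k) :
    (ideleDivisor α).infinite w = 0 ↔ ‖(α : Adele k).1 w‖ = 1 := by
  have h0 : 0 < ‖(α : Adele k).1 w‖ := norm_pos_iff.2 (idele_fst_ne_zero α w)
  have hm : w.mult ≠ 0 := NumberField.InfinitePlace.mult_ne_zero
  change Real.log (‖(α : Adele k).1 w‖ ^ w.mult) = 0 ↔ _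
  rw [Real.log_pow, mul_eq_zero, Real.log_eq_zero]
  constructor
  · rintro (h | h | h | h)
    · exact absurd (by exact_mod_cast h) hm
    · exact absurd h h0.ne'
    · exact h
    · linarith
  · intro h; right; right; left; exact h

/-- An idele with prescribed divisor and trivial archimedean components. -/
theorem exists_idele (n : FinitePlace k → ℤ) (hn : (Function.support n).Finite) :
    ∃ α : (Adele k)ˣ, (α : Adele k).1 = 1 ∧ (ideleDivisor α).finite = n := by
  have hx : ∀ v : FinitePlace k, ∃ y : v.Completion, Valued.v y = WithZero.exp (n v) :=
    fun v => v.valued_surjective _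
  choose y hy using hx
  have hy0 : ∀ v, y v ≠ 0 := fun v h => WithZero.exp_ne_zero (a := n v) (by rw [← hy, h, map_zero])
  let a : Adele k := Adele.mk 1 y (hn.subset fun v hv h => hv (by rw [hy, h]; simp))
  let b : Adele k := Adele.mk 1 (fun v => (y v)⁻¹)
    (hn.subset fun v hv h => hv (by rw [map_inv₀, hy, h]; simp))
  refine ⟨⟨a, b, Adele.ext (fun w => by simp [a, b]) fun v => by simp [a, b, hy0],
    Adele.ext (fun w => by simp [a, b]) fun v => by simp [a, b, hy0]⟩, rfl, ?_⟩
  funext v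
  apply WithZero.exp_injective
  rw [← valued_idele, ← hy]
  rfl

end Idele

end GlobalAdele

/-! ### The adele class group and its Haar measures -/

namespace GlobalAdele

open Filter Topology MeasureTheory

/-- Fields whose diagonal image in the adele ring is discrete and cocompact. -/
class IsCocompactAdelic (k : Type*) [Field k] : Prop extends IsAdelic k where
  nonempty_finitePlace : Nonempty (FinitePlace k)
  discreteTopology : DiscreteTopology (principal k)
  cocompact : ∃ α : (Adele k)ˣ, ∃ r : ℝ, ∀ a : Adele k, ∃ x : k, ∃ b ∈ adeleBox k r,
    a = diag k x + α * b

attribute [instance] IsCocompactAdelic.nonempty_finitePlace IsCocompactAdelic.discreteTopology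

variable {k : Type*} [Field k]

section Countability

variable [IsAdelic k]

instance (w : NumberField.InfinitePlace k) : SecondCountableTopology w.Completion :=
  (NumberField.InfinitePlace.Completion.isometry_extensionEmbedding w).isEmbedding.secondCountableTopology

instance (v : FinitePlace k) : SecondCountableTopology v.Completion := v.secondCountableTopology

/-- The product of the archimedean completions and the rings `O_v`, as a subspace of the adeles. -/
def integralAdelesMap (p : (∀ w : NumberField.InfinitePlace k, w.Completion) ×
    (∀ v : FinitePlace k, v.integers)) : Adele k :=
  (p.1, RestrictedProduct.structureMap _ _ cofinite p.2)

theorem isOpenEmbedding_integralAdelesMap : IsOpenEmbedding (integralAdelesMap (k := k)) :=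
  IsOpenEmbedding.id.prodMap (RestrictedProduct.isOpenEmbedding_structureMap
    (fun v : FinitePlace k => Valued.isOpen_valuationSubring v.Completion))

theorem range_integralAdelesMap : Set.range (integralAdelesMap (k := k)) = integralAdeles k := by
  ext a
  constructor
  · rintro ⟨p, rfl⟩ v
    exact (p.2 v).2
  · intro ha
    exact ⟨(a.1, fun v => ⟨a.2 v, ha v⟩), rfl⟩

theorem secondCountableTopology_adele_of_cover {C : Set (Adele k)} (hC : C.Countable)
    (hcov : ∀ a : Adele k, ∃ c ∈ C, a - c ∈ integralAdeles k) :
    SecondCountableTopology (Adele k) := by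
  have : Countable C := hC
  have he : ∀ c : Adele k, IsOpenEmbedding (fun p => c + integralAdelesMap (k := k) p) := fun c =>
    (Homeomorph.addLeft c).isOpenEmbedding.comp isOpenEmbedding_integralAdelesMap
  have hO : ∀ v : FinitePlace k, SecondCountableTopology v.integers := fun v =>
    TopologicalSpace.Subtype.secondCountableTopology _
  have hw : SecondCountableTopology (∀ w : NumberField.InfinitePlace k, w.Completion) :=
    inferInstance
  have hv : SecondCountableTopology (∀ v : FinitePlace k, v.integers) :=
    @TopologicalSpace.instSecondCountableTopologyForallOfCountable _ _ _ _ hO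
  have hsec : ∀ c : C, SecondCountableTopology
      (Set.range (fun p => (c : Adele k) + integralAdelesMap (k := k) p)) :=
    fun c => (he c).toIsEmbedding.toHomeomorph.symm.secondCountableTopology
  refine TopologicalSpace.secondCountableTopology_of_countable_cover
    (fun c : C => (he c).isOpen_range) ?_
  refine Set.eq_univ_of_forall fun a => ?_
  obtain ⟨c, hc, hac⟩ := hcov a
  have hac' : a - c ∈ (integralAdeles k : Set (Adele k)) := hac
  rw [← range_integralAdelesMap] at hac'
  obtain ⟨p, hp⟩ := hac'
  exact Set.mem_iUnion.2 ⟨⟨c, hc⟩, p, by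
    change c + integralAdelesMap p = a
    rw [hp]; abel⟩

end Countability

section Quotient

variable [IsCocompactAdelic k]

/-- The translate `α` of the box is compact. Number fields use the radius `r`; function fields use
`α`, which allows bounded poles at the places over infinity. -/
theorem exists_isCompact_cover :
    ∃ K : Set (Adele k), IsCompact K ∧ ∀ a : Adele k, ∃ x : k, a - diag k x ∈ K := by
  obtain ⟨α, r, h⟩ := IsCocompactAdelic.cocompact (k := k)
  refine ⟨(fun b => (α : Adele k) * b) '' adeleBox k r,
    (isCompact_adeleBox r).image (continuous_const.mul continuous_id), fun a => ?_⟩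
  obtain ⟨x, b, hb, rfl⟩ := h a
  exact ⟨x, b, hb, by simp⟩

/-- Finitely many translates of the open group of integral adeles cover a compact set of
representatives modulo `k`. Since `k` is countable, countably many translates cover `𝔸`, and each is
second countable. -/
instance : SecondCountableTopology (Adele k) := by
  obtain ⟨K, hK, hcov⟩ := exists_isCompact_cover (k := k)
  obtain ⟨t, ht⟩ := hK.elim_finite_subcover (fun c : Adele k => (fun a => a - c) ⁻¹'
    (integralAdeles k : Set (Adele k)))
    (fun c => isOpen_integralAdeles.preimage (continuous_id.sub continuous_const))
    (fun a _ => Set.mem_iUnion.2 ⟨a, by simp⟩)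
  refine secondCountableTopology_adele_of_cover (C := Set.image2 (fun x c => diag k x + c)
    Set.univ (t : Set (Adele k))) (Set.countable_univ.image2 t.countable_toSet _) fun a => ?_
  obtain ⟨x, hx⟩ := hcov a
  obtain ⟨c, hc, hac⟩ := Set.mem_iUnion₂.1 (ht hx)
  refine ⟨_, ⟨x, trivial, c, hc, rfl⟩, ?_⟩
  rw [← sub_sub]
  exact hac

instance : Nontrivial (Adele k) := Adele.nontrivial_of_finitePlace

instance : IsClosed (principal k : Set (Adele k)) := by
  have : DiscreteTopology (principal k) := inferInstance
  exact AddSubgroup.isClosed_of_discrete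

variable (k) in
/-- The quotient map from the adeles to the adele class group. -/
noncomputable def toAdeleQuotient : Adele k →+ AdeleQuotient k := QuotientAddGroup.mk' (principal k)

theorem isLatticeQuotient_adele : IsLatticeQuotient (principal k) (toAdeleQuotient k) where
  isOpenQuotientMap := QuotientAddGroup.isOpenQuotientMap_mk
  ker_eq := QuotientAddGroup.ker_mk' _

instance : T2Space (AdeleQuotient k) := inferInstanceAs (T2Space (Adele k ⧸ principal k))

instance : CompactSpace (AdeleQuotient k) := by
  obtain ⟨K, hK, hcov⟩ := exists_isCompact_cover (k := k)
  have hc : Continuous (toAdeleQuotient k) := isLatticeQuotient_adele.isOpenQuotientMap.continuous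
  refine ⟨?_⟩
  have : (Set.univ : Set (AdeleQuotient k)) = toAdeleQuotient k '' K := by
    refine (Set.eq_univ_of_forall fun q => ?_).symm
    obtain ⟨a, rfl⟩ := isLatticeQuotient_adele.isOpenQuotientMap.surjective q
    obtain ⟨x, hx⟩ := hcov a
    refine ⟨_, hx, ?_⟩
    rw [map_sub, isLatticeQuotient_adele.map_eq_zero_iff.2 (diag_mem_principal x), sub_zero]
  rw [this]
  exact hK.image hc

theorem quotientMeasure_eq :
    quotientMeasure k = (Measure.addHaarMeasure ⊤ : Measure (AdeleQuotient k)) :=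
  dif_pos (inferInstance : CompactSpace (AdeleQuotient k))

instance : Measure.IsAddHaarMeasure (quotientMeasure k) := by
  rw [quotientMeasure_eq]; infer_instance

instance : IsProbabilityMeasure (quotientMeasure k) := by
  refine ⟨?_⟩
  rw [quotientMeasure_eq]
  exact Measure.addHaarMeasure_self

theorem adeleMeasure_eq : adeleMeasure k =
    cosetMeasure (principal k) (fun x : AdeleQuotient k => Quotient.out
      (s := QuotientAddGroup.leftRel (principal k)) x) (quotientMeasure k) := rfl

theorem toAdeleQuotient_out (x : AdeleQuotient k) : toAdeleQuotient k (Quotient.out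
      (s := QuotientAddGroup.leftRel (principal k)) x) = x :=
  Quotient.out_eq x

instance : Measure.IsAddHaarMeasure (adeleMeasure k) := by
  rw [adeleMeasure_eq]
  exact isLatticeQuotient_adele.isAddHaarMeasure_cosetMeasure _ toAdeleQuotient_out

instance : Measure.Regular (adeleMeasure k) := inferInstance

theorem ideleModule_eq (α : (Adele k)ˣ) :
    ideleModule α = (distribHaarChar (Adele k) α : ℝ) :=
  dif_pos (inferInstance : LocallyCompactSpace (Adele k))

theorem ideleModule_pos (α : (Adele k)ˣ) : 0 < ideleModule α := by
  rw [ideleModule_eq]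
  exact_mod_cast distribHaarChar_pos

theorem ideleModule_mul (α β : (Adele k)ˣ) : ideleModule (α * β) = ideleModule α * ideleModule β := by
  simp [ideleModule_eq]

theorem ideleModule_inv (α : (Adele k)ˣ) : ideleModule α⁻¹ = (ideleModule α)⁻¹ := by
  simp [ideleModule_eq]

theorem adeleMeasure_image (α : (Adele k)ˣ) (s : Set (Adele k)) :
    adeleMeasure k ((fun a => (α : Adele k) * a) '' s) =
      ENNReal.ofReal (ideleModule α) * adeleMeasure k s := by
  rw [ideleModule_eq, ENNReal.ofReal_coe_nnreal]
  exact (distribHaarChar_mul (adeleMeasure k) α s).symm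

/-- Multiplication by an idele as a homeomorphism. -/
noncomputable def ideleHomeomorph (α : (Adele k)ˣ) : Adele k ≃ₜ Adele k where
  toFun a := α * a
  invFun a := ((α⁻¹ : (Adele k)ˣ) : Adele k) * a
  left_inv a := by simp
  right_inv a := by simp
  continuous_toFun := continuous_const.mul continuous_id
  continuous_invFun := continuous_const.mul continuous_id

/-- The preimage of `s` under multiplication by `α` is `α⁻¹ s`, whence the inverse module. -/
theorem map_ideleHomeomorph (α : (Adele k)ˣ) :
    (adeleMeasure k).map (ideleHomeomorph α) =
      ENNReal.ofReal (ideleModule α)⁻¹ • adeleMeasure k := by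
  ext s hs
  rw [Measure.map_apply (ideleHomeomorph α).continuous.measurable hs, Measure.smul_apply,
    smul_eq_mul, ← ideleModule_inv, ← adeleMeasure_image]
  congr 1
  exact (Homeomorph.image_symm (ideleHomeomorph α)).symm ▸ rfl

theorem integral_comp_idele_mul {E : Type*} [NormedAddCommGroup E] [NormedSpace ℝ E]
    (α : (Adele k)ˣ) (f : Adele k → E) :
    ∫ u, f (((α⁻¹ : (Adele k)ˣ) : Adele k) * u) ∂(adeleMeasure k) =
      ideleModule α • ∫ u, f u ∂(adeleMeasure k) := by
  have h := (ideleHomeomorph α⁻¹).measurableEmbedding.integral_map (μ := adeleMeasure k) f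
  rw [map_ideleHomeomorph, integral_smul_measure, ideleModule_inv, inv_inv,
    ENNReal.toReal_ofReal (ideleModule_pos α).le] at h
  exact h.symm

theorem integrable_comp_idele_mul {E : Type*} [NormedAddCommGroup E]
    (α : (Adele k)ˣ) {f : Adele k → E} (hf : Integrable f (adeleMeasure k)) :
    Integrable (fun u => f (((α⁻¹ : (Adele k)ˣ) : Adele k) * u)) (adeleMeasure k) := by
  have h := integrable_map_equiv (μ := adeleMeasure k) (ideleHomeomorph α⁻¹).toMeasurableEquiv f
  change Integrable f ((adeleMeasure k).map (ideleHomeomorph α⁻¹)) ↔ _ at h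
  rw [map_ideleHomeomorph] at h
  exact h.1 (hf.smul_measure ENNReal.ofReal_ne_top)

end Quotient

end GlobalAdele

namespace GlobalAdele

open Filter Topology MeasureTheory
open scoped ComplexConjugate InnerProductSpace

variable {k : Type*} [Field k]

/-! ### The archimedean part -/

noncomputable instance [IsAdelic k] : Fintype (NumberField.InfinitePlace k) := Fintype.ofFinite _

section Arch

variable [IsAdelic k]

variable (k) in
/-- The real Euclidean space spanned by the archimedean completions. -/
def archSpace : Submodule ℝ (PiLp 2 fun _ : NumberField.InfinitePlace k => ℂ) where
  carrier := {x | ∀ w, w.IsReal → (x w).im = 0}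
  zero_mem' w _ := rfl
  add_mem' hx hy w hw := by
    rw [PiLp.add_apply, Complex.add_im, hx w hw, hy w hw, add_zero]
  smul_mem' c x hx w hw := by
    rw [PiLp.smul_apply, Complex.smul_im, hx w hw, smul_zero]

open NumberField.InfinitePlace.Completion in
/-- The scaled embedding of the archimedean completions in a Euclidean space. -/
noncomputable def archEmbedding : NumberField.InfiniteAdeleRing k →+ archSpace k where
  toFun a := ⟨WithLp.toLp 2 fun w => (√(w.mult : ℝ) : ℂ) * extensionEmbedding w (a w), fun w hw => by
    change ((√(w.mult : ℝ) : ℂ) * extensionEmbedding w (a w)).im = 0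
    rw [← extensionEmbeddingOfIsReal_apply hw, ← Complex.ofReal_mul, Complex.ofReal_im]⟩
  map_zero' := Subtype.ext <| PiLp.ext fun w => by
    change (√(w.mult : ℝ) : ℂ) * extensionEmbedding w 0 = 0
    rw [map_zero, mul_zero]
  map_add' a b := Subtype.ext <| PiLp.ext fun w => by
    change (√(w.mult : ℝ) : ℂ) * extensionEmbedding w (a w + b w) =
      (√(w.mult : ℝ) : ℂ) * extensionEmbedding w (a w) +
      (√(w.mult : ℝ) : ℂ) * extensionEmbedding w (b w)
    rw [map_add, mul_add]

open NumberField.InfinitePlace.Completion in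
theorem archEmbedding_apply (a : NumberField.InfiniteAdeleRing k) (w) :
    (archEmbedding a : PiLp 2 fun _ : NumberField.InfinitePlace k => ℂ) w =
      (√(w.mult : ℝ) : ℂ) * extensionEmbedding w (a w) := rfl

theorem norm_extensionEmbedding {w : NumberField.InfinitePlace k} (x : w.Completion) :
    ‖NumberField.InfinitePlace.Completion.extensionEmbedding w x‖ = ‖x‖ := by
  have := (NumberField.InfinitePlace.Completion.isometry_extensionEmbedding w).dist_eq x 0
  simpa using this

/-- The weighted sum of squares of the archimedean absolute values. -/
noncomputable def archNormSq (a : NumberField.InfiniteAdeleRing k) : ℝ := ∑ w, w.mult * ‖a w‖ ^ 2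

/-- The factors `√e_w` of the embedding are chosen so that the archimedean part of `f_1` becomes the
standard Gaussian `exp (-π ‖x‖²)`, which is its own Fourier transform. -/
theorem norm_archEmbedding_sq (a : NumberField.InfiniteAdeleRing k) :
    ‖archEmbedding a‖ ^ 2 = archNormSq a := by
  rw [Submodule.coe_norm, PiLp.norm_sq_eq_of_L2]
  refine Finset.sum_congr rfl fun w _ => ?_
  rw [archEmbedding_apply, norm_mul, norm_extensionEmbedding, mul_pow, Complex.norm_real,
    Real.norm_of_nonneg (Real.sqrt_nonneg _), Real.sq_sqrt (Nat.cast_nonneg _)]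

theorem norm_le_norm_archEmbedding (a : NumberField.InfiniteAdeleRing k)
    (w : NumberField.InfinitePlace k) : ‖a w‖ ≤ ‖archEmbedding a‖ := by
  refine le_of_sq_le_sq ?_ (norm_nonneg _)
  rw [norm_archEmbedding_sq]
  have h1 : (w.mult : ℝ) * ‖a w‖ ^ 2 ≤ archNormSq a :=
    Finset.single_le_sum (f := fun w : NumberField.InfinitePlace k => (w.mult : ℝ) * ‖a w‖ ^ 2)
      (fun _ _ => by positivity) (Finset.mem_univ w)
  have h2 : (1 : ℝ) ≤ w.mult := by exact_mod_cast NumberField.InfinitePlace.mult_pos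
  nlinarith [sq_nonneg ‖a w‖]

theorem continuous_archEmbedding : Continuous (archEmbedding (k := k)) := by
  refine Continuous.subtype_mk ?_ _
  refine (PiLp.continuous_toLp 2 _).comp (continuous_pi fun w => continuous_const.mul ?_)
  exact (NumberField.InfinitePlace.Completion.isometry_extensionEmbedding w).continuous.comp
    (continuous_apply w)

theorem continuous_archNormSq : Continuous (archNormSq (k := k)) := by
  simp_rw [← funext_iff.2 (norm_archEmbedding_sq (k := k))]
  exact continuous_archEmbedding.norm.pow 2

open NumberField.InfinitePlace.Completion in
theorem archEmbedding_surjective : Function.Surjective (archEmbedding (k := k)) := by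
  intro x
  have h : ∀ w : NumberField.InfinitePlace k, ∃ a : w.Completion,
      (√(w.mult : ℝ) : ℂ) * extensionEmbedding w a =
        (x : PiLp 2 fun _ : NumberField.InfinitePlace k => ℂ) w := by
    intro w
    have h0 : (√(w.mult : ℝ) : ℂ) ≠ 0 := by
      rw [Complex.ofReal_ne_zero, Real.sqrt_ne_zero']
      exact_mod_cast NumberField.InfinitePlace.mult_pos
    rcases w.isReal_or_isComplex with hw | hw
    · obtain ⟨a, ha⟩ := surjective_extensionEmbeddingOfIsReal hw
        ((√(w.mult : ℝ))⁻¹ * ((x : PiLp 2 fun _ : NumberField.InfinitePlace k => ℂ) w).re)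
      refine ⟨a, ?_⟩
      rw [← extensionEmbeddingOfIsReal_apply hw, ha, Complex.ofReal_mul, Complex.ofReal_inv,
        mul_inv_cancel_left₀ h0]
      exact Complex.ext rfl (by simpa using (x.2 w hw).symm)
    · obtain ⟨a, ha⟩ := surjective_extensionEmbedding_of_isComplex hw
        ((√(w.mult : ℝ) : ℂ)⁻¹ * (x : PiLp 2 fun _ : NumberField.InfinitePlace k => ℂ) w)
      exact ⟨a, by rw [ha, mul_inv_cancel_left₀ h0]⟩
  choose a ha using h
  exact ⟨a, Subtype.ext (PiLp.ext ha)⟩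

theorem archNormSq_add_le (a b : NumberField.InfiniteAdeleRing k) :
    archNormSq (a + b) ≤ 2 * archNormSq a + 2 * archNormSq b := by
  rw [← norm_archEmbedding_sq, ← norm_archEmbedding_sq, ← norm_archEmbedding_sq, map_add]
  have := norm_add_le (archEmbedding a) (archEmbedding b)
  nlinarith [sq_nonneg (‖archEmbedding a‖ - ‖archEmbedding b‖), norm_nonneg (archEmbedding a + archEmbedding b)]

/-- The linear form `∑ e_w Re σ_w(x_w)` on the archimedean part. -/
noncomputable def archTrace (a : NumberField.InfiniteAdeleRing k) : ℝ :=
  ∑ w, w.mult * (NumberField.InfinitePlace.Completion.extensionEmbedding w (a w)).re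

/-- The complex conjugation of the Euclidean space of the archimedean completions. -/
noncomputable def archConj (x : archSpace k) : archSpace k :=
  ⟨WithLp.toLp 2 fun w => conj ((x : PiLp 2 fun _ : NumberField.InfinitePlace k => ℂ) w),
    fun w hw => by
      change (conj ((x : PiLp 2 fun _ : NumberField.InfinitePlace k => ℂ) w)).im = 0
      rw [Complex.conj_im, x.2 w hw, neg_zero]⟩

theorem norm_archConj (x : archSpace k) : ‖archConj x‖ = ‖x‖ := by
  rw [Submodule.coe_norm, Submodule.coe_norm, PiLp.norm_eq_of_L2, PiLp.norm_eq_of_L2]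
  congr 1
  refine Finset.sum_congr rfl fun w _ => ?_
  change ‖conj ((x : PiLp 2 fun _ : NumberField.InfinitePlace k => ℂ) w)‖ ^ 2 = _
  rw [RCLike.norm_conj]

open NumberField.InfinitePlace.Completion in
-- `Re (z w)` is the real inner product of `w` with the conjugate of `z`, and two factors `√e_w`
-- give the weight `e_w`. Thus multiplying the argument of the trace character by `a` amounts to
-- choosing a frequency in the Euclidean space.
theorem archTrace_mul (a b : NumberField.InfiniteAdeleRing k) :
    archTrace (a * b) = ⟪archEmbedding b, archConj (archEmbedding a)⟫_ℝ := by
  rw [Submodule.coe_inner, PiLp.inner_apply]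
  refine Finset.sum_congr rfl fun w _ => ?_
  change _ = ⟪(archEmbedding b : PiLp 2 fun _ : NumberField.InfinitePlace k => ℂ) w,
    conj ((archEmbedding a : PiLp 2 fun _ : NumberField.InfinitePlace k => ℂ) w)⟫_ℝ
  rw [Complex.inner, archEmbedding_apply, archEmbedding_apply]
  have : (a * b) w = a w * b w := rfl
  rw [this, map_mul, map_mul, map_mul, Complex.conj_ofReal]
  have hs : √(w.mult : ℝ) * √(w.mult : ℝ) = w.mult := Real.mul_self_sqrt (Nat.cast_nonneg _)
  simp only [Complex.mul_re, Complex.mul_im, Complex.ofReal_re, Complex.ofReal_im,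
    Complex.conj_re, Complex.conj_im]
  linear_combination -(((extensionEmbedding w) (a w)).re * ((extensionEmbedding w) (b w)).re -
     ((extensionEmbedding w) (a w)).im * ((extensionEmbedding w) (b w)).im) * hs

end Arch

end GlobalAdele

/-! ### The adelic Gaussian -/

namespace GlobalAdele

open Filter Topology MeasureTheory
open scoped ComplexConjugate InnerProductSpace FourierTransform

variable {k : Type*} [Field k]

section Gauss

variable [IsAdelic k]

open Classical in
/-- The product of the Gaussian of width parameter `c` at the archimedean places and of the
characteristic functions of the `O_v`. -/
noncomputable def adelicGaussian (c : ℝ) (u : Adele k) : ℝ :=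
  if u ∈ integralAdeles k then Real.exp (-(c * Real.pi * archNormSq u.1)) else 0

theorem adelicGaussian_of_mem (c : ℝ) {u : Adele k} (hu : u ∈ integralAdeles k) :
    adelicGaussian c u = Real.exp (-(c * Real.pi * archNormSq u.1)) := if_pos hu

theorem adelicGaussian_of_notMem (c : ℝ) {u : Adele k} (hu : u ∉ integralAdeles k) :
    adelicGaussian c u = 0 := if_neg hu

theorem adelicGaussian_nonneg (c : ℝ) (u : Adele k) : 0 ≤ adelicGaussian c u := by
  rw [adelicGaussian]; split_ifs <;> positivity

theorem adelicGaussian_zero (c : ℝ) : adelicGaussian c (0 : Adele k) = 1 := by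
  rw [adelicGaussian_of_mem c (zero_mem _)]
  have : archNormSq (0 : Adele k).1 = 0 := by
    rw [← norm_archEmbedding_sq]
    change ‖archEmbedding (0 : NumberField.InfiniteAdeleRing k)‖ ^ 2 = 0
    rw [map_zero]; simp
  rw [this]; simp

theorem adelicGaussian_congr (c : ℝ) {u v : Adele k} (h1 : archNormSq u.1 = archNormSq v.1)
    (h2 : u ∈ integralAdeles k ↔ v ∈ integralAdeles k) :
    adelicGaussian c u = adelicGaussian c v := by
  by_cases hu : u ∈ integralAdeles k
  · rw [adelicGaussian_of_mem c hu, adelicGaussian_of_mem c (h2.1 hu), h1]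
  · rw [adelicGaussian_of_notMem c hu, adelicGaussian_of_notMem c fun h => hu (h2.2 h)]

theorem continuous_adelicGaussian (c : ℝ) : Continuous (adelicGaussian (k := k) c) := by
  classical
  refine Continuous.if (fun a ha => ?_) ?_ continuous_const
  · have : IsClopen {a : Adele k | a ∈ integralAdeles k} :=
      ⟨isClosed_integralAdeles, isOpen_integralAdeles⟩
    rw [this.frontier_eq] at ha
    exact ha.elim
  · exact Real.continuous_exp.comp (continuous_const.mul
      (continuous_archNormSq.comp Adele.continuous_fst)).neg

/-- From `‖a + b‖² ≤ 2 ‖a‖² + 2 ‖b‖²`: halving the parameter absorbs a bounded translation at the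
price of a constant. This local domination gives the summability over `k` and the continuity of the
periodised functions. -/
theorem adelicGaussian_le {c : ℝ} (hc : 0 ≤ c) {a b : Adele k} (hb : b ∈ adeleBox k 1) :
    adelicGaussian c a ≤
      Real.exp (c * Real.pi * ∑ w : NumberField.InfinitePlace k, (w.mult : ℝ)) *
        adelicGaussian (c / 2) (a + b) := by
  by_cases ha : a ∈ integralAdeles k
  · rw [adelicGaussian_of_mem c ha, adelicGaussian_of_mem _ (add_mem ha hb.2), ← Real.exp_add]
    refine Real.exp_le_exp.2 ?_
    have h1 : archNormSq (a + b).1 ≤ 2 * archNormSq a.1 + 2 * archNormSq b.1 :=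
      archNormSq_add_le a.1 b.1
    have h2 : archNormSq b.1 ≤ ∑ w : NumberField.InfinitePlace k, (w.mult : ℝ) := by
      refine Finset.sum_le_sum fun w _ => ?_
      have := pow_le_one₀ (norm_nonneg _) (hb.1 w) (n := 2)
      exact mul_le_of_le_one_right (Nat.cast_nonneg _) this
    have h3 : 0 ≤ c * Real.pi := by positivity
    nlinarith
  · rw [adelicGaussian_of_notMem c ha]
    exact mul_nonneg (Real.exp_nonneg _) (adelicGaussian_nonneg _ _)

/-- The exponent `2 / e_w` undoes the power `e_w` in the module, so each archimedean factor is a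
Gaussian in `‖u_w‖²` with weight `e_w`. -/
theorem baseFunction_eq : (baseFunction : Adele k → ℝ) = adelicGaussian 1 := by
  classical
  funext u
  have h1 : (∏ᶠ w : NumberField.InfinitePlace k,
      Real.exp (-(w.mult * Real.pi * archModule w (u.1 w) ^ (2 / w.mult : ℝ)))) =
      Real.exp (-(1 * Real.pi * archNormSq u.1)) := by
    rw [finprod_eq_prod_of_fintype, ← Real.exp_sum, archNormSq, Finset.mul_sum,
      ← Finset.sum_neg_distrib]
    refine congrArg _ (Finset.sum_congr rfl fun w _ => ?_)
    have hm : (w.mult : ℝ) ≠ 0 := by exact_mod_cast NumberField.InfinitePlace.mult_ne_zero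
    rw [archModule, ← Real.rpow_natCast ‖u.1 w‖ w.mult, ← Real.rpow_mul (norm_nonneg _),
      mul_div_cancel₀ _ hm, Real.rpow_two]
    ring
  by_cases hu : u ∈ integralAdeles k
  · have h2 : ∀ v : FinitePlace k, (if u.2 v ∈ v.integers then (1 : ℝ) else 0) = 1 :=
      fun v => if_pos (hu v)
    simp only [baseFunction, h1, h2, finprod_one, mul_one]
    rw [adelicGaussian_of_mem 1 hu]
  · rw [adelicGaussian_of_notMem 1 hu]
    obtain ⟨v, hv⟩ := not_forall.1 hu
    have h3 : ∏ᶠ v : FinitePlace k, (if u.2 v ∈ v.integers then (1 : ℝ) else 0) = 0 := by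
      refine finprod_eq_zero _ v (if_neg hv) ((Adele.eventually_le_one u).subset fun w hw h => ?_)
      exact hw (if_pos h)
    simp only [baseFunction, h3, mul_zero]

theorem ideleFunction_apply (α : (Adele k)ˣ) (u : Adele k) :
    ideleFunction α u = adelicGaussian 1 (((α⁻¹ : (Adele k)ˣ) : Adele k) * u) := by
  rw [ideleFunction, baseFunction_eq]

theorem archNormSq_idele_congr {α β : (Adele k)ˣ} (h : ideleDivisor α = ideleDivisor β)
    (u : Adele k) : archNormSq (((α⁻¹ : (Adele k)ˣ) : Adele k) * u).1 =
      archNormSq (((β⁻¹ : (Adele k)ˣ) : Adele k) * u).1 := by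
  refine Finset.sum_congr rfl fun w _ => ?_
  have h1 : Real.log (‖(α : Adele k).1 w‖ ^ w.mult) = Real.log (‖(β : Adele k).1 w‖ ^ w.mult) :=
    congrArg (fun D : RepleteDivisor k => D.infinite w) h
  have hp : ∀ γ : (Adele k)ˣ, 0 < ‖(γ : Adele k).1 w‖ := fun γ =>
    norm_pos_iff.2 (idele_fst_ne_zero γ w)
  have h2 := Real.log_injOn_pos (pow_pos (hp α) _) (pow_pos (hp β) _) h1
  have h3 := (pow_left_inj₀ (hp α).le (hp β).le NumberField.InfinitePlace.mult_ne_zero).1 h2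
  rw [Adele.mul_fst, Adele.mul_fst, norm_mul, norm_mul, idele_inv_fst, idele_inv_fst, norm_inv,
    norm_inv, h3]

theorem idele_mul_mem_integralAdeles_iff (α : (Adele k)ˣ) (u : Adele k) :
    ((α⁻¹ : (Adele k)ˣ) : Adele k) * u ∈ integralAdeles k ↔
      ∀ v, Valued.v (u.2 v) ≤ WithZero.exp ((ideleDivisor α).finite v) := by
  refine forall_congr' fun v => ?_
  rw [Adele.mul_snd, idele_inv_snd, map_mul, map_inv₀, valued_idele,
    inv_mul_le_one₀ (WithZero.exp_pos)]

theorem ideleFunction_congr {α β : (Adele k)ˣ} (h : ideleDivisor α = ideleDivisor β) :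
    ideleFunction α = ideleFunction β := by
  funext u
  rw [ideleFunction_apply, ideleFunction_apply]
  refine adelicGaussian_congr 1 (archNormSq_idele_congr h u) ?_
  rw [idele_mul_mem_integralAdeles_iff, idele_mul_mem_integralAdeles_iff, h]

end Gauss

/-! ### Reduction of Gaussian integrals to Euclidean space -/

section HaarReduction

variable [IsCocompactAdelic k]

instance : FiniteDimensional ℝ (archSpace k) := inferInstance

/-- The map from the adeles to the Euclidean space of the archimedean part. -/
noncomputable def toArch (a : Adele k) : archSpace k := archEmbedding a.1

theorem toArch_add (a b : Adele k) : toArch (a + b) = toArch a + toArch b := map_add _ _ _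

theorem continuous_toArch : Continuous (toArch (k := k)) :=
  continuous_archEmbedding.comp Adele.continuous_fst

variable (k) in
/-- The measure of `S × ∏ O_v` as a measure of `S`. -/
noncomputable def archMeasure : Measure (archSpace k) :=
  ((adeleMeasure k).restrict (integralAdeles k : Set (Adele k))).map toArch

theorem exists_toArch_eq (x : archSpace k) :
    ∃ a : Adele k, toArch a = x ∧ ∀ v, a.2 v = 0 := by
  obtain ⟨y, hy⟩ := archEmbedding_surjective x
  exact ⟨Adele.mk y 0 (by simp), hy, fun v => rfl⟩

theorem archMeasure_apply {B : Set (archSpace k)} (hB : MeasurableSet B) :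
    archMeasure k B = adeleMeasure k (toArch ⁻¹' B ∩ (integralAdeles k : Set (Adele k))) := by
  rw [archMeasure, Measure.map_apply continuous_toArch.measurable hB,
    Measure.restrict_apply (continuous_toArch.measurable hB)]

/-- A vector lifts to an adele with zero finite part, and translation by it preserves integrality.
By uniqueness of Haar measure, integrals over the integral adeles of functions of the archimedean
part are therefore Lebesgue integrals up to one constant, without a product formula for the measure
on `𝔸`. -/
instance : Measure.IsAddHaarMeasure (archMeasure k) := by
  have hinv : (archMeasure k).IsAddLeftInvariant := by
    refine ⟨fun x => Measure.ext fun B hB => ?_⟩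
    obtain ⟨a, rfl, ha⟩ := exists_toArch_eq x
    rw [Measure.map_apply (measurable_const_add _) hB,
      archMeasure_apply (measurable_const_add _ hB), archMeasure_apply hB,
      ← measure_preimage_add (adeleMeasure k) a (toArch ⁻¹' B ∩ _)]
    congr 1
    ext b
    have : (∀ v, Valued.v ((a + b).2 v) ≤ 1) ↔ ∀ v, Valued.v (b.2 v) ≤ 1 := by
      simp [ha]
    simp only [Set.mem_inter_iff, Set.mem_preimage, toArch_add, SetLike.mem_coe,
      mem_integralAdeles, this]
  have hfin : IsFiniteMeasureOnCompacts (archMeasure k) := by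
    refine ⟨fun K hK => ?_⟩
    obtain ⟨r, hr⟩ := hK.isBounded.subset_closedBall 0
    rw [archMeasure_apply hK.measurableSet]
    refine lt_of_le_of_lt (measure_mono (t := adeleBox k r) ?_)
      (isCompact_adeleBox r).measure_lt_top
    rintro a ⟨ha, ha'⟩
    refine ⟨fun w => (norm_le_norm_archEmbedding _ _).trans ?_, ha'⟩
    have := hr ha
    rwa [mem_closedBall_zero_iff] at this
  have hopen : (archMeasure k).IsOpenPosMeasure := by
    refine ⟨fun U hU hne => ?_⟩
    obtain ⟨x, hx⟩ := hne
    obtain ⟨a, rfl, ha⟩ := exists_toArch_eq x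
    rw [archMeasure_apply hU.measurableSet]
    refine ((hU.preimage continuous_toArch).inter isOpen_integralAdeles).measure_ne_zero _
      ⟨a, hx, fun v => ?_⟩
    rw [ha, map_zero]; exact zero_le
  exact {}

variable (k) in
/-- The Lebesgue measure of the Euclidean space of the archimedean part. -/
noncomputable def archVolume : Measure (archSpace k) := @volume _ measureSpaceOfInnerProductSpace

instance : Measure.IsAddHaarMeasure (archVolume k) := by
  let _ : MeasureSpace (archSpace k) := measureSpaceOfInnerProductSpace
  exact inferInstanceAs (Measure.IsAddHaarMeasure (volume : Measure (archSpace k)))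

variable (k) in
theorem exists_archMeasure_eq : ∃ c : NNReal, 0 < c ∧
    archMeasure k = c • archVolume k :=
  ⟨_, Measure.addHaarScalarFactor_pos_of_isAddHaarMeasure _ _,
    Measure.isAddLeftInvariant_eq_smul (archMeasure k) (archVolume k)⟩

theorem integral_archMeasure {E : Type*} [NormedAddCommGroup E] [NormedSpace ℝ E]
    {g : archSpace k → E} (hg : Continuous g) :
    ∫ x, g x ∂(archMeasure k) = ∫ a, (integralAdeles k : Set (Adele k)).indicator
      (fun a => g (toArch a)) a ∂(adeleMeasure k) := by
  have : SecondCountableTopology (archSpace k) := inferInstance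
  rw [archMeasure, integral_map continuous_toArch.measurable.aemeasurable
    hg.aestronglyMeasurable, integral_indicator isOpen_integralAdeles.measurableSet]

theorem integrable_archMeasure {E : Type*} [NormedAddCommGroup E]
    {g : archSpace k → E} (hg : Continuous g) :
    Integrable g (archMeasure k) ↔ Integrable ((integralAdeles k : Set (Adele k)).indicator
      (fun a => g (toArch a))) (adeleMeasure k) := by
  rw [archMeasure, integrable_map_measure hg.aestronglyMeasurable
    continuous_toArch.measurable.aemeasurable,
    integrable_indicator_iff isOpen_integralAdeles.measurableSet]
  rfl

theorem adelicGaussian_eq_indicator (c : ℝ) : (fun a : Adele k => (adelicGaussian c a : ℂ)) =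
    (integralAdeles k : Set (Adele k)).indicator
      (fun a => Complex.exp (-(c * Real.pi : ℝ) * ‖toArch a‖ ^ 2)) := by
  funext a
  by_cases ha : a ∈ integralAdeles k
  · rw [Set.indicator_of_mem ha, adelicGaussian_of_mem c ha, toArch, ← norm_archEmbedding_sq]
    push_cast
    congr 1
    ring
  · rw [Set.indicator_of_notMem ha, adelicGaussian_of_notMem c ha, Complex.ofReal_zero]

theorem integrable_adelicGaussian {c : ℝ} (hc : 0 < c) :
    Integrable (adelicGaussian (k := k) c) (adeleMeasure k) := by
  have h : Integrable (fun a : Adele k => (adelicGaussian c a : ℂ)) (adeleMeasure k) := by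
    rw [adelicGaussian_eq_indicator]
    rw [← integrable_archMeasure (g := fun x => Complex.exp (-(c * Real.pi : ℝ) * ‖x‖ ^ 2))
      (by fun_prop)]
    obtain ⟨r, hr, h⟩ := exists_archMeasure_eq k
    rw [h]
    refine Integrable.smul_measure_nnreal ?_
    have := GaussianFourier.integrable_cexp_neg_mul_sq_norm_add (b := ((c * Real.pi : ℝ) : ℂ))
      (by simpa using mul_pos hc Real.pi_pos) 0 (0 : archSpace k)
    exact this.congr (.of_forall fun v => by simp only [zero_mul, add_zero])
  simpa using h.re

theorem integral_adelicGaussian_pos {c : ℝ} (hc : 0 < c) :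
    0 < ∫ u : Adele k, adelicGaussian c u ∂(adeleMeasure k) := by
  refine integral_pos_of_integrable_nonneg_nonzero (continuous_adelicGaussian c)
    (integrable_adelicGaussian hc) (adelicGaussian_nonneg c) (x := 0) ?_
  rw [adelicGaussian_zero]
  exact one_ne_zero

/-- The Fourier transform of the adelic Gaussian at a point for which the character is trivial on the
finite integral adeles. -/
theorem integral_adelicGaussian_mul_character (y : NumberField.InfiniteAdeleRing k) :
    ∫ u : Adele k, (adelicGaussian 1 u : ℂ) *
      Complex.exp (2 * Real.pi * Complex.I * archTrace (y * u.1)) ∂(adeleMeasure k) =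
    (∫ u : Adele k, adelicGaussian 1 u ∂(adeleMeasure k)) *
      Real.exp (-(Real.pi * archNormSq y)) := by
  obtain ⟨r, hr, h⟩ := exists_archMeasure_eq k
  -- The frequency is the negative of the conjugate of `z`, because the Fourier transform is
  -- normalised with `exp (-2πi⟪x, y⟫)`; norm and Gaussian do not see sign or conjugation.
  have key : ∀ z : NumberField.InfiniteAdeleRing k, ∫ u : Adele k, (adelicGaussian 1 u : ℂ) *
      Complex.exp (2 * Real.pi * Complex.I * archTrace (z * u.1)) ∂(adeleMeasure k) =
      r * Real.exp (-(Real.pi * archNormSq z)) := by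
    intro z
    have h1 : (fun u : Adele k => (adelicGaussian 1 u : ℂ) *
        Complex.exp (2 * Real.pi * Complex.I * archTrace (z * u.1))) =
        (integralAdeles k : Set (Adele k)).indicator (fun a =>
          (fun x => Complex.exp (↑(-2 * Real.pi * ⟪x, -archConj (archEmbedding z)⟫_ℝ) * Complex.I) •
            Complex.exp (-(Real.pi : ℂ) * ‖x‖ ^ 2)) (toArch a)) := by
      funext u
      rw [congrFun (adelicGaussian_eq_indicator 1) u]
      by_cases hu : u ∈ (integralAdeles k : Set (Adele k))
      · rw [Set.indicator_of_mem hu, Set.indicator_of_mem hu, archTrace_mul, one_mul]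
        change _ = Complex.exp (↑(-2 * Real.pi *
          ⟪archEmbedding u.1, -archConj (archEmbedding z)⟫_ℝ) * Complex.I) * _
        rw [mul_comm, inner_neg_right]
        congr 2
        push_cast
        ring
      · rw [Set.indicator_of_notMem hu, Set.indicator_of_notMem hu, zero_mul]
    rw [h1, ← integral_archMeasure (g := fun x => Complex.exp (↑(-2 * Real.pi *
      ⟪x, -archConj (archEmbedding z)⟫_ℝ) * Complex.I) • Complex.exp (-(Real.pi : ℂ) * ‖x‖ ^ 2))
      (by fun_prop), h, integral_smul_nnreal_measure]
    have h2 := fourier_gaussian_innerProductSpace (V := archSpace k) (b := (Real.pi : ℂ))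
      (by simpa using Real.pi_pos) (-archConj (archEmbedding z))
    rw [Real.fourier_eq'] at h2
    refine (congrArg (r • ·) h2).trans ?_
    rw [div_self (by exact_mod_cast Real.pi_ne_zero), Complex.one_cpow, one_mul, norm_neg,
      norm_archConj, NNReal.smul_def, Complex.real_smul, ← norm_archEmbedding_sq]
    congr 1
    push_cast
    congr 1
    have : (Real.pi : ℂ) ≠ 0 := by exact_mod_cast Real.pi_ne_zero
    field_simp
  -- Frequency zero identifies the unknown Haar factor `r` with the integral of the Gaussian.
  have h0 := key 0
  have hz : archNormSq (0 : NumberField.InfiniteAdeleRing k) = 0 := by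
    rw [← norm_archEmbedding_sq, map_zero]; simp
  have ht : archTrace (0 : NumberField.InfiniteAdeleRing k) = 0 := by
    rw [archTrace]
    refine Finset.sum_eq_zero fun w _ => ?_
    change (w.mult : ℝ) * (NumberField.InfinitePlace.Completion.extensionEmbedding w 0).re = 0
    simp
  simp only [zero_mul, ht, hz, mul_zero, Complex.ofReal_zero, Complex.exp_zero, mul_one, neg_zero,
    Real.exp_zero, Complex.ofReal_one, integral_complex_ofReal] at h0
  rw [key y, ← h0]

end HaarReduction

end GlobalAdele

/-! ### Convergence, unfolding and the Euler characteristic -/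

namespace GlobalAdele

open Filter Topology MeasureTheory

variable {k : Type*} [Field k] [IsCocompactAdelic k]

theorem summable_adelicGaussian {c : ℝ} (hc : 0 < c) (α : (Adele k)ˣ) (a : Adele k) :
    Summable fun u : principal k => adelicGaussian c (((α⁻¹ : (Adele k)ˣ) : Adele k) * (a + (u : Adele k))) := by
  refine summable_of_locally_dominated (adeleMeasure k)
    (f := fun a => adelicGaussian c (((α⁻¹ : (Adele k)ˣ) : Adele k) * a))
    (g := fun a => Real.exp (c * Real.pi * ∑ w : NumberField.InfinitePlace k, (w.mult : ℝ)) *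
      adelicGaussian (c / 2) (((α⁻¹ : (Adele k)ˣ) : Adele k) * a))
    (fun a => adelicGaussian_nonneg _ _) ?_
    (V := (fun a => ((α⁻¹ : (Adele k)ˣ) : Adele k) * a) ⁻¹' adeleBox k 1) ?_ ?_ a
  · exact (integrable_comp_idele_mul α (integrable_adelicGaussian (half_pos hc))).const_mul _
  · refine (continuous_const.mul continuous_id).continuousAt.preimage_mem_nhds ?_
    convert adeleBox_mem_nhds (k := k) one_pos using 2
    exact mul_zero _
  · intro a w hw
    rw [mul_add]
    exact adelicGaussian_le hc.le hw

theorem summable_ideleFunction (α : (Adele k)ˣ) (a : Adele k) :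
    Summable fun u : principal k => ideleFunction α (a + u) := by
  simp_rw [ideleFunction_apply]
  exact summable_adelicGaussian one_pos α a

theorem continuous_ideleFunction (α : (Adele k)ˣ) : Continuous (ideleFunction α) := by
  rw [funext (ideleFunction_apply α)]
  exact (continuous_adelicGaussian 1).comp (continuous_const.mul continuous_id)

theorem ideleFunction_nonneg (α : (Adele k)ˣ) (u : Adele k) : 0 ≤ ideleFunction α u := by
  rw [ideleFunction_apply]; exact adelicGaussian_nonneg _ _

theorem integrable_ideleFunction (α : (Adele k)ˣ) :
    Integrable (ideleFunction α) (adeleMeasure k) := by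
  rw [funext (ideleFunction_apply α)]
  exact integrable_comp_idele_mul α (integrable_adelicGaussian one_pos)

theorem integral_ideleFunction (α : (Adele k)ˣ) : ∫ u, ideleFunction α u ∂(adeleMeasure k) =
    ideleModule α * ∫ u, adelicGaussian 1 u ∂(adeleMeasure k) := by
  rw [funext (ideleFunction_apply α)]
  exact integral_comp_idele_mul α _

theorem integral_ideleFunction_pos (α : (Adele k)ˣ) :
    0 < ∫ u, ideleFunction α u ∂(adeleMeasure k) := by
  rw [integral_ideleFunction]
  exact mul_pos (ideleModule_pos α) (integral_adelicGaussian_pos one_pos)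

theorem continuous_tsum_ideleFunction (α : (Adele k)ˣ) :
    Continuous fun a : Adele k => ∑' u : principal k, ideleFunction α (a + u) := by
  rw [continuous_iff_continuousAt]
  intro a
  have hs := (summable_adelicGaussian one_half_pos α a).mul_left
    (Real.exp (1 * Real.pi * ∑ w : NumberField.InfinitePlace k, (w.mult : ℝ)))
  -- For `b` in this neighbourhood of `a`, each term at `b + u` is bounded by a constant times the
  -- wider Gaussian at `a + u`, so the series converges uniformly there.
  have hV : (fun b : Adele k => ((α⁻¹ : (Adele k)ˣ) : Adele k) * (a - b)) ⁻¹' adeleBox k 1 ∈ 𝓝 a := by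
    refine (continuous_const.mul (continuous_const.sub continuous_id)).continuousAt.preimage_mem_nhds
      ?_
    convert adeleBox_mem_nhds (k := k) one_pos using 2
    exact (congrArg _ (sub_self a)).trans (mul_zero _)
  refine (continuousOn_tsum (fun u => ?_) hs fun u b hb => ?_).continuousAt hV
  · exact ((continuous_ideleFunction α).comp (continuous_id.add continuous_const)).continuousOn
  · rw [Real.norm_of_nonneg (ideleFunction_nonneg _ _), ideleFunction_apply]
    have h := adelicGaussian_le (zero_le_one (α := ℝ))
      (a := ((α⁻¹ : (Adele k)ˣ) : Adele k) * (b + (u : Adele k))) hb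
    rwa [← mul_add, show b + (u : Adele k) + (a - b) = a + u by abel] at h

theorem ideleFunction_zero (α : (Adele k)ˣ) : ideleFunction α 0 = 1 := by
  rw [ideleFunction_apply, mul_zero, adelicGaussian_zero]

theorem expH0_pos (α : (Adele k)ˣ) : 0 < expH0 α := by
  have h := summable_ideleFunction α 0
  simp only [zero_add] at h
  refine h.tsum_pos (fun u => ideleFunction_nonneg α u) 0 ?_
  rw [ZeroMemClass.coe_zero, ideleFunction_zero]
  exact one_pos

theorem quotientFunction_apply (α : (Adele k)ˣ) (a : Adele k) :
    quotientFunction (ideleFunction α) (toAdeleQuotient k a) =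
      (∑' u : principal k, ideleFunction α (a + u)) * (expH0 α)⁻¹ := rfl

theorem continuous_quotientFunction (α : (Adele k)ˣ) :
    Continuous (quotientFunction (ideleFunction α)) := by
  rw [(isLatticeQuotient_adele (k := k)).isOpenQuotientMap.isQuotientMap.continuous_iff]
  exact (continuous_tsum_ideleFunction α).mul continuous_const

theorem integrable_quotientFunction (α : (Adele k)ˣ) :
    Integrable (quotientFunction (ideleFunction α)) (quotientMeasure k) :=
  (continuous_quotientFunction α).integrable_of_hasCompactSupport (HasCompactSupport.of_compactSpace _)

/-- Unfolding over the adele class group. -/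
theorem integral_adele_eq {f : Adele k → ℂ} (hf : Integrable f (adeleMeasure k))
    (hsum : ∀ a, Summable fun u : principal k => f (a + u)) (F : AdeleQuotient k → ℂ)
    (hF : ∀ a, F (toAdeleQuotient k a) = ∑' u : principal k, f (a + u)) :
    ∫ a, f a ∂(adeleMeasure k) = ∫ x, F x ∂(quotientMeasure k) := by
  rw [adeleMeasure_eq] at hf ⊢
  rw [(isLatticeQuotient_adele.integral_cosetMeasure toAdeleQuotient_out hf hsum).2]
  refine integral_congr_ae (.of_forall fun x => ?_)
  conv_rhs => rw [← toAdeleQuotient_out x]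
  exact (hF _).symm

/-- Before normalisation the function on `𝔸/k` is the coset sum of `f_α`, so its integral is that of
`f_α` over `𝔸`. -/
theorem integral_quotientFunction (α : (Adele k)ˣ) :
    ∫ x, quotientFunction (ideleFunction α) x ∂(quotientMeasure k) =
      (∫ u, ideleFunction α u ∂(adeleMeasure k)) * (expH0 α)⁻¹ := by
  have h := integral_adele_eq (f := fun a => (ideleFunction α a : ℂ))
    (integrable_ideleFunction α).ofReal (fun a => by exact_mod_cast summable_ideleFunction α a)
    (fun x => ((quotientFunction (ideleFunction α) x * expH0 α : ℝ) : ℂ)) (fun a => by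
      rw [quotientFunction_apply, inv_mul_cancel_right₀ (expH0_pos α).ne', Complex.ofReal_tsum])
  rw [integral_complex_ofReal, integral_complex_ofReal, integral_mul_const] at h
  rw [Complex.ofReal_injective h, mul_inv_cancel_right₀ (expH0_pos α).ne']

theorem expH1_eq (α : (Adele k)ˣ) :
    expH1 α = expH0 α * (∫ u, ideleFunction α u ∂(adeleMeasure k))⁻¹ := by
  rw [expH1, integral_quotientFunction, mul_inv_rev, inv_inv]

theorem expH1_pos (α : (Adele k)ˣ) : 0 < expH1 α := by
  rw [expH1_eq]
  exact mul_pos (expH0_pos α) (inv_pos.2 (integral_ideleFunction_pos α))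

theorem eulerChar_eq (α : (Adele k)ˣ) :
    eulerChar α = Real.log (∫ u, ideleFunction α u ∂(adeleMeasure k)) := by
  rw [eulerChar, h0, h1, expH1_eq, Real.log_mul (expH0_pos α).ne'
    (inv_ne_zero (integral_ideleFunction_pos α).ne'), Real.log_inv]
  ring

theorem eulerChar_eq_log_ideleModule_add (α : (Adele k)ˣ) :
    eulerChar α = Real.log (ideleModule α) + eulerChar (1 : (Adele k)ˣ) := by
  rw [eulerChar_eq, eulerChar_eq, integral_ideleFunction, integral_ideleFunction,
    Real.log_mul (ideleModule_pos α).ne' (integral_adelicGaussian_pos one_pos).ne',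
    Real.log_mul (ideleModule_pos 1).ne' (integral_adelicGaussian_pos one_pos).ne']
  have : ideleModule (1 : (Adele k)ˣ) = 1 := by simp [ideleModule_eq]
  rw [this, Real.log_one]
  ring

/-- The formal consequences of duality. -/
theorem eulerChar_of_duality {κ : (Adele k)ˣ}
    (h : ∀ α : (Adele k)ˣ, h1 α = h0 (κ⁻¹ * α⁻¹)) (α : (Adele k)ˣ) :
    eulerChar α = -eulerChar (κ⁻¹ * α⁻¹) ∧
    eulerChar α = Real.log (ideleModule α) + 1 / 2 * Real.log (ideleModule κ) ∧
    h0 α - h0 (κ⁻¹ * α⁻¹) = Real.log (ideleModule α) + 1 / 2 * Real.log (ideleModule κ) := by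
  have hneg : ∀ α : (Adele k)ˣ, eulerChar α = -eulerChar (κ⁻¹ * α⁻¹) := by
    intro α
    -- The map `α ↦ κ⁻¹α⁻¹` is an involution, so duality at the dual idele exchanges the roles of
    -- `h⁰` and `h¹`.
    have h2 := h (κ⁻¹ * α⁻¹)
    rw [mul_inv_rev, inv_inv, inv_inv, mul_comm α κ, inv_mul_cancel_left] at h2
    rw [eulerChar, eulerChar, h α, h2]
    ring
  have hlog : ∀ α : (Adele k)ˣ, eulerChar α =
      Real.log (ideleModule α) + 1 / 2 * Real.log (ideleModule κ) := by
    intro α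
    -- With `c = χ(D_1)`, the values `log |α| + c` and `-log |κ| - log |α| + c` are opposite, which
    -- determines `c = ½ log |κ|`.
    have h1' := eulerChar_eq_log_ideleModule_add α
    have h2 := eulerChar_eq_log_ideleModule_add (κ⁻¹ * α⁻¹)
    rw [ideleModule_mul, ideleModule_inv, ideleModule_inv, Real.log_mul
      (inv_ne_zero (ideleModule_pos _).ne') (inv_ne_zero (ideleModule_pos _).ne'), Real.log_inv,
      Real.log_inv] at h2
    have h3 := hneg α
    linarith
  refine ⟨hneg α, hlog α, ?_⟩
  rw [← h α]
  exact hlog α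

end GlobalAdele

/-! ### Characters of the adele class group -/

namespace GlobalAdele

open Filter Topology MeasureTheory

/-- The circle has no small subgroups. -/
theorem Circle.eq_one_of_forall_norm_pow_sub_one_le {z : Circle}
    (h : ∀ n : ℕ, ‖((z ^ n : Circle) : ℂ) - 1‖ ≤ 1 / 2) : z = 1 := by
  -- Squaring multiplies `w - 1` by `w + 1`, of norm at least `3 / 2` while `w` stays within `1 / 2`
  -- of `1`; so a non-zero distance would grow without bound.
  have key : ∀ n : ℕ, (3 / 2 : ℝ) ^ n * ‖(z : ℂ) - 1‖ ≤ ‖((z ^ 2 ^ n : Circle) : ℂ) - 1‖ := by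
    intro n
    induction n with
    | zero => simp
    | succ n ih =>
      set w : ℂ := ((z ^ 2 ^ n : Circle) : ℂ) with hw
      have h1 : ((z ^ 2 ^ (n + 1) : Circle) : ℂ) - 1 = (w - 1) * (2 + (w - 1)) := by
        rw [pow_succ, pow_mul, Circle.coe_pow, ← hw]; ring
      have h2 : 3 / 2 ≤ ‖2 + (w - 1)‖ := by
        have h3 := norm_sub_le (2 + (w - 1)) (w - 1)
        have h4 := h (2 ^ n)
        rw [← hw] at h4
        simp only [add_sub_cancel_right, Complex.norm_ofNat] at h3
        linarith
      rw [h1, norm_mul, pow_succ]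
      nlinarith [norm_nonneg (w - 1)]
  have h0 : ‖(z : ℂ) - 1‖ = 0 := by
    by_contra hne
    have hpos : 0 < ‖(z : ℂ) - 1‖ := lt_of_le_of_ne (norm_nonneg _) (Ne.symm hne)
    obtain ⟨n, hn⟩ := pow_unbounded_of_one_lt (1 / ‖(z : ℂ) - 1‖) (by norm_num : (1 : ℝ) < 3 / 2)
    have h1 := key n
    have h2 := h (2 ^ n)
    rw [div_lt_iff₀ hpos] at hn
    linarith
  exact Circle.ext (by simpa [sub_eq_zero] using h0)

theorem exists_nhds_mul_subset {R : Type*} [Ring R] [TopologicalSpace R] [IsTopologicalRing R]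
    {K : Set R} (hK : IsCompact K) {N : Set R}
    (hN : N ∈ 𝓝 (0 : R)) : ∃ U ∈ 𝓝 (0 : R), ∀ u ∈ U, ∀ a ∈ K, u * a ∈ N := by
  obtain ⟨u, v, hu, hv, h0, hKv, huv⟩ := generalized_tube_lemma (isCompact_singleton (x := (0 : R)))
    hK (n := (fun p : R × R => p.1 * p.2) ⁻¹' interior N)
    (isOpen_interior.preimage continuous_mul) (by
      rintro ⟨a, b⟩ ⟨ha, hb⟩
      rw [Set.mem_singleton_iff] at ha
      simp only at ha
      subst ha
      simpa using mem_interior_iff_mem_nhds.2 hN)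
  exact ⟨u, hu.mem_nhds (h0 rfl), fun a ha b hb => interior_subset (show (a, b).1 * (a, b).2 ∈ interior N from
    huv (Set.mk_mem_prod ha (hKv hb)))⟩

variable {k : Type*} [Field k] [IsCocompactAdelic k]

/-- Among infinitely many adeles, two are congruent modulo `k` up to a small error. -/
theorem exists_diag_sub_mem (m : ℕ → Adele k) {U : Set (Adele k)} (hU : U ∈ 𝓝 (0 : Adele k)) :
    ∃ n l, n ≠ l ∧ ∃ x : k, diag k x - (m n - m l) ∈ U := by
  obtain ⟨V, hV, hVU⟩ : ∃ V ∈ 𝓝 (0 : Adele k), ∀ v ∈ V, ∀ w ∈ V, v - w ∈ U := by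
    have h : Tendsto (fun p : Adele k × Adele k => p.1 - p.2) (𝓝 0 ×ˢ 𝓝 0) (𝓝 0) := by
      have := (continuous_sub (G := Adele k)).tendsto (0, 0)
      rwa [sub_self, nhds_prod_eq] at this
    obtain ⟨V, hV, h⟩ := mem_prod_self_iff.1 (h hU)
    exact ⟨V, hV, fun v hv w hw => h (Set.mk_mem_prod hv hw)⟩
  have hV0 : (0 : Adele k) ∈ interior V := mem_interior_iff_mem_nhds.2 hV
  obtain ⟨K, hK, hcov⟩ := exists_isCompact_cover (k := k)
  obtain ⟨t, ht⟩ := hK.elim_finite_subcover (fun c : Adele k => (fun a => a - c) ⁻¹' interior V)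
    (fun c => isOpen_interior.preimage (continuous_id.sub continuous_const))
    (fun a _ => Set.mem_iUnion.2 ⟨a, by simpa using hV0⟩)
  have h : ∀ n, ∃ x : k, ∃ c : t, m n - diag k x - c ∈ V := by
    intro n
    obtain ⟨x, hx⟩ := hcov (m n)
    obtain ⟨c, hc, hac⟩ := Set.mem_iUnion₂.1 (ht hx)
    exact ⟨x, ⟨c, hc⟩, interior_subset hac⟩
  choose x c hxc using h
  obtain ⟨n, l, hne, hnl⟩ := Finite.exists_ne_map_eq_of_infinite c
  refine ⟨n, l, hne, x n - x l, ?_⟩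
  have := hVU _ (hxc l) _ (hxc n)
  rw [← hnl] at this
  rw [map_sub]
  convert this using 1
  abel

section Character

variable {ψ : AddChar (Adele k) Circle} (hc : Continuous ψ) (hk : ∀ a ∈ principal k, ψ a = 1)

include hc in
theorem character_nhds : {a : Adele k | ‖((ψ a : Circle) : ℂ) - 1‖ ≤ 1 / 2} ∈ 𝓝 (0 : Adele k) := by
  have h : Continuous fun a => ‖((ψ a : Circle) : ℂ) - 1‖ :=
    ((continuous_subtype_val.comp hc).sub continuous_const).norm
  have h2 := h.tendsto 0
  simp only [AddChar.map_zero_eq_one, Circle.coe_one, sub_self, norm_zero] at h2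
  exact (h2.eventually_lt_const (by norm_num : (0 : ℝ) < 1 / 2)).mono fun a ha => ha.le

/-- A character with values near `1` on a multiple of a fundamental domain is trivial there. -/
theorem character_mul_eq_one {K : Set (Adele k)} (hcov : ∀ a : Adele k, ∃ x : k, a - diag k x ∈ K)
    {y : Adele k} (hy : ∀ x : k, ψ (y * diag k x) = 1)
    (hsmall : ∀ a ∈ K, ‖((ψ (y * a) : Circle) : ℂ) - 1‖ ≤ 1 / 2) (a : Adele k) : ψ (y * a) = 1 := by
  refine Circle.eq_one_of_forall_norm_pow_sub_one_le fun n => ?_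
  obtain ⟨x, hx⟩ := hcov (n • a)
  -- Every multiple of `a` can be moved into `K` by an element of `k`, where `ψ (y ·)` is trivial.
  -- So all powers of `ψ (y * a)` stay near `1`.
  have h1 : ψ (y * a) ^ n = ψ (y * (n • a - diag k x)) := by
    rw [mul_sub, AddChar.map_sub_eq_div, hy, div_one, mul_smul_comm, AddChar.map_nsmul_eq_pow]
  rw [h1]
  exact hsmall _ hx

include hk in
theorem character_diag_mul_diag (x y : k) : ψ (diag k x * diag k y) = 1 := by
  rw [← map_mul]; exact hk _ (diag_mem_principal _)

theorem character_eq_one_of_diag {x : k} (hx : x ≠ 0) (h : ∀ a, ψ (diag k x * a) = 1) : ψ = 1 := by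
  ext1 a
  have := h (diag k x⁻¹ * a)
  rwa [← mul_assoc, ← map_mul, mul_inv_cancel₀ hx, map_one, one_mul] at this

include hc hk in
-- By compactness of `𝔸/k`, some `x ∈ k` is `m n - m l` up to a small error, and `x ≠ 0` because the
-- difference is not integral. Then `ψ (x ·)` is close to `1` on `K`, hence trivial, and dividing by
-- `x` gives `ψ = 1`. Both non-degeneracy statements below come from a suitable sequence `m`.
theorem character_eq_one_of_sequence {K : Set (Adele k)} (hK : IsCompact K)
    (hcov : ∀ a : Adele k, ∃ x : k, a - diag k x ∈ K) (m : ℕ → Adele k)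
    (hm : ∀ n l, n ≠ l → m n - m l ∉ integralAdeles k) (hψ : ∀ n, ∀ a ∈ K, ψ (m n * a) = 1) :
    ψ = 1 := by
  obtain ⟨U, hU, hUK⟩ := exists_nhds_mul_subset hK (character_nhds hc)
  obtain ⟨n, l, hnl, x, hx⟩ := exists_diag_sub_mem m
    (inter_mem hU (isOpen_integralAdeles.mem_nhds (zero_mem (integralAdeles k))))
  have hx0 : x ≠ 0 := by
    rintro rfl
    refine hm n l hnl ?_
    have := neg_mem hx.2
    simpa using this
  refine character_eq_one_of_diag hx0 fun a => ?_
  refine character_mul_eq_one hcov (character_diag_mul_diag hk x) (fun a ha => ?_) a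
  have h1 : diag k x * a = (diag k x - (m n - m l)) * a + m n * a - m l * a := by ring
  rw [h1, AddChar.map_sub_eq_div, AddChar.map_add_eq_mul, hψ n a ha, hψ l a ha, div_one, mul_one]
  exact hUK _ hx.1 _ ha

variable (hψ : ψ ≠ 1)

include hc hk hψ in
/-- A non-trivial character of the adele class group is non-trivial on every `k_v`. -/
theorem exists_character_single_ne_one (v : FinitePlace k) :
    ∃ y : v.Completion, ψ (Adele.single v y) ≠ 1 := by
  by_contra! h
  obtain ⟨K, hK, hcov⟩ := exists_isCompact_cover (k := k)
  -- Poles of pairwise different orders at `v`, so that no difference is integral.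
  choose z hz using fun n : ℕ => v.valued_surjective (WithZero.exp ((n : ℤ) + 1))
  refine hψ (character_eq_one_of_sequence hc hk hK hcov (fun n => Adele.single v (z n)) ?_ ?_)
  · intro n l hnl hmem
    have h1 := hmem v
    simp only [← Adele.single_sub, Adele.single_snd_self] at h1
    have hne : Valued.v (z n) ≠ Valued.v (z l) := by
      rw [hz, hz]
      intro h
      have := WithZero.exp_injective h
      omega
    rw [sub_eq_add_neg, Valuation.map_add_of_distinct_val _ (by rwa [Valuation.map_neg]),
      Valuation.map_neg, hz, hz, ← WithZero.exp_zero, max_le_iff, WithZero.exp_le_exp] at h1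
    have := h1.1
    omega
  · intro n a _
    rw [Adele.single_mul]
    exact h _

include hc hk hψ in
/-- A non-trivial character of the adele class group is non-trivial on almost every `p_v⁻¹`. -/
theorem finite_character_trivial :
    {v : FinitePlace k | ∀ y : v.Completion, Valued.v y ≤ WithZero.exp (1 : ℤ) →
      ψ (Adele.single v y) = 1}.Finite := by
  by_contra hinf
  obtain ⟨α, r, hα⟩ := IsCocompactAdelic.cocompact (k := k)
  -- Only places where `α` is a unit are kept. There, multiplying a simple pole by an element of the
  -- compact set `α · box` still lands in `p_v⁻¹`, where `ψ` is assumed trivial.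
  have hinf' := (Set.Infinite.sdiff hinf (finite_support_ideleDivisor α))
  have := hinf'.to_subtype
  let s := Infinite.natEmbedding ↥({v : FinitePlace k | ∀ y : v.Completion,
    Valued.v y ≤ WithZero.exp (1 : ℤ) → ψ (Adele.single v y) = 1} \
      Function.support (ideleDivisor α).finite)
  choose z hz using fun n : ℕ => (s n).1.valued_surjective (WithZero.exp (1 : ℤ))
  refine hψ (character_eq_one_of_sequence hc hk (K := (fun b => (α : Adele k) * b) '' adeleBox k r)
    ((isCompact_adeleBox r).image (continuous_const.mul continuous_id)) (fun a => ?_)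
    (fun n => Adele.single (s n).1 (z n)) ?_ ?_)
  · obtain ⟨x, b, hb, rfl⟩ := hα a
    exact ⟨x, b, hb, by simp⟩
  · intro n l hnl hmem
    have h1 := hmem (s n).1
    have hne : (s n).1 ≠ (s l).1 := fun h => hnl (s.injective (Subtype.ext h))
    rw [Adele.sub_snd, Adele.single_snd_self, Adele.single_snd_of_ne hne, sub_zero, hz,
      ← WithZero.exp_zero, WithZero.exp_le_exp] at h1
    omega
  · rintro n _ ⟨b, hb, rfl⟩
    rw [Adele.single_mul]
    refine (s n).2.1 _ ?_
    have h0 : (ideleDivisor α).finite (s n).1 = 0 := by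
      by_contra h
      exact (s n).2.2 h
    simp only [Adele.mul_snd, map_mul]
    rw [hz, valued_idele, h0, WithZero.exp_zero, one_mul]
    exact mul_le_of_le_one_right' (hb.2 _)

end Character

end GlobalAdele

/-! ### The conductor of a character and the Fourier transform of the adelic Gaussian -/

namespace GlobalAdele

open Filter Topology MeasureTheory

variable {k : Type*} [Field k] [IsCocompactAdelic k]

/-- The exponent of the largest fractional ideal of `k_v` on which `ψ` is trivial. -/
noncomputable def conductorExponent (ψ : AddChar (Adele k) Circle) (v : FinitePlace k) : ℤ :=
  sSup {n : ℤ | ∀ y : v.Completion, Valued.v y ≤ WithZero.exp n → ψ (Adele.single v y) = 1}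

theorem characterDivisor_finite (ψ : AddChar (Adele k) Circle) (v : FinitePlace k) :
    (characterDivisor ψ).finite v = -conductorExponent ψ v := by
  refine congrArg (fun s : Set ℤ => -sSup s) (Set.ext fun n => ?_)
  constructor
  · intro h y hy
    exact h _ rfl (fun w hw => Adele.single_snd_of_ne hw y) (by rwa [Adele.single_snd_self])
  · intro h a h1 h2 ha
    rw [Adele.eq_single h1 h2]
    exact h _ ha

section Character

variable {ψ : AddChar (Adele k) Circle} (hc : Continuous ψ) (hk : ∀ a ∈ principal k, ψ a = 1)
  (hψ : ψ ≠ 1)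

/-- A subgroup of values of a continuous character near the identity is trivial. -/
theorem character_eq_one_of_nsmul {a : Adele k}
    (h : ∀ n : ℕ, ‖((ψ (n • a) : Circle) : ℂ) - 1‖ ≤ 1 / 2) : ψ a = 1 :=
  Circle.eq_one_of_forall_norm_pow_sub_one_le fun n => by
    rw [← AddChar.map_nsmul_eq_pow]; exact h n

include hc in
-- A neighbourhood of zero contains a whole subgroup of finite adeles: natural numbers are integral
-- at every finite place, so multiples stay in the box. On it `ψ` is near `1`, and the circle has no
-- small subgroups.
theorem exists_box_character_eq_one : ∃ S : Finset (FinitePlace k), ∃ n : ℤ, ∀ a : Adele k, a.1 = 0 →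
    (∀ v, Valued.v (a.2 v) ≤ 1) → (∀ v ∈ S, Valued.v (a.2 v) ≤ WithZero.exp n) → ψ a = 1 := by
  obtain ⟨ε, hε, S, n, h⟩ := Adele.exists_box_subset (character_nhds hc)
  refine ⟨S, n, fun a h1 h2 h3 => character_eq_one_of_nsmul fun m => h _ (fun w => ?_) (fun v => ?_)
    fun v hv => ?_⟩
  · have : (m • a).1 w = m • a.1 w := rfl
    rw [this, h1]
    change ‖m • (0 : w.Completion)‖ < ε
    rw [smul_zero, norm_zero]
    exact hε
  · have : (m • a).2 v = m • a.2 v := rfl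
    rw [this, nsmul_eq_mul, map_mul]
    refine mul_le_one' ?_ (h2 v)
    exact natCast_mem v.integers m
  · have : (m • a).2 v = m • a.2 v := rfl
    rw [this, nsmul_eq_mul, map_mul]
    refine mul_le_of_le_one_of_le ?_ (h3 v hv)
    exact natCast_mem v.integers m

include hc hk hψ in
-- The exponents form a downward closed set, non-empty by continuity of `ψ` and bounded above
-- because `ψ` is non-trivial on `k_v`. So the supremum in `conductorExponent` is attained and is
-- not the default value of `sSup`.
theorem character_single_iff (v : FinitePlace k) (n : ℤ) :
    (∀ y : v.Completion, Valued.v y ≤ WithZero.exp n → ψ (Adele.single v y) = 1) ↔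
      n ≤ conductorExponent ψ v := by
  set s := {n : ℤ | ∀ y : v.Completion, Valued.v y ≤ WithZero.exp n → ψ (Adele.single v y) = 1}
  have hdown : ∀ m ∈ s, ∀ l ≤ m, l ∈ s := fun m hm l hl y hy =>
    hm y (hy.trans (WithZero.exp_le_exp.2 hl))
  have hne : s.Nonempty := by
    obtain ⟨S, n, h⟩ := exists_box_character_eq_one hc
    refine ⟨min n 0, fun y hy => h _ rfl (fun w => ?_) fun w _ => ?_⟩
    · by_cases hw : w = v
      · subst hw
        rw [Adele.single_snd_self]
        exact hy.trans (by rw [← WithZero.exp_zero, WithZero.exp_le_exp]; exact min_le_right _ _)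
      · rw [Adele.single_snd_of_ne hw, map_zero]; exact zero_le
    · by_cases hw : w = v
      · subst hw
        rw [Adele.single_snd_self]
        exact hy.trans (WithZero.exp_le_exp.2 (min_le_left _ _))
      · rw [Adele.single_snd_of_ne hw, map_zero]; exact zero_le
  have hbdd : BddAbove s := by
    obtain ⟨y, hy⟩ := exists_character_single_ne_one hc hk hψ v
    have hy0 : Valued.v y ≠ 0 := by
      rw [Valuation.ne_zero_iff]
      rintro rfl
      refine hy ?_
      have : Adele.single v (0 : v.Completion) = 0 := (Adele.eq_single (a := 0) rfl fun _ _ => rfl).symm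
      rw [this, AddChar.map_zero_eq_one]
    obtain ⟨m, hm⟩ := WithZero.exists_exp_eq hy0
    refine ⟨m, fun l hl => ?_⟩
    by_contra! hlt
    exact hy (hl y (by rw [hm, WithZero.exp_le_exp]; exact hlt.le))
  exact ⟨fun h => le_csSup hbdd h, fun h => hdown _ (Int.csSup_mem hne hbdd) _ h⟩

include hc hk hψ in
-- Continuity makes the exponent non-negative at almost all places, and `finite_character_trivial`
-- makes it less than one at almost all places.
theorem finite_support_conductorExponent : (Function.support (conductorExponent ψ)).Finite := by
  obtain ⟨S, n, h⟩ := exists_box_character_eq_one hc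
  refine ((S.finite_toSet).union (finite_character_trivial hc hk hψ)).subset fun v hv => ?_
  by_contra hv'
  rw [Set.mem_union, not_or] at hv'
  have h1 : ¬ 1 ≤ conductorExponent ψ v := fun h =>
    hv'.2 ((character_single_iff hc hk hψ v 1).2 h)
  have h2 : 0 ≤ conductorExponent ψ v := by
    refine (character_single_iff hc hk hψ v 0).1 fun y hy => h _ rfl (fun w => ?_) fun w hw => ?_
    · by_cases hw : w = v
      · subst hw
        rw [Adele.single_snd_self]
        exact hy
      · rw [Adele.single_snd_of_ne hw, map_zero]; exact zero_le
    · have hw' : w ≠ v := fun h => hv'.1 (h ▸ hw)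
      rw [Adele.single_snd_of_ne hw', map_zero]; exact zero_le
  exact hv (by omega)

include hc hk hψ in
theorem exists_idele_eq_characterDivisor :
    ∃ κ : (Adele k)ˣ, ideleDivisor κ = characterDivisor ψ := by
  obtain ⟨κ, h1, h2⟩ := exists_idele (k := k) (fun v => -conductorExponent ψ v)
    ((finite_support_conductorExponent hc hk hψ).subset fun v hv h => hv (by simp [h]))
  refine ⟨κ, RepleteDivisor.ext (funext fun v => ?_) (funext fun w => ?_)⟩
  · rw [characterDivisor_finite, h2]
  · refine (ideleDivisor_infinite_eq_zero_iff κ w).2 ?_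
    rw [h1]
    exact norm_one

include hc in
/-- A character that is trivial on the finite components of an adele is trivial on its finite part. -/
theorem character_eq_one_of_single {a : Adele k} (h1 : a.1 = 0)
    (h2 : ∀ v, ψ (Adele.single v (a.2 v)) = 1) : ψ a = 1 := by
  classical
  obtain ⟨S, n, h⟩ := exists_box_character_eq_one hc
  -- Subtracting the components in `T` leaves an adele that is integral everywhere and zero on `S`,
  -- hence in the box where `ψ` is trivial.
  let T := S ∪ (Adele.eventually_le_one a).toFinset
  have hsum : ∀ T : Finset (FinitePlace k), ψ (∑ v ∈ T, Adele.single v (a.2 v)) = 1 := by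
    intro T
    induction T using Finset.induction_on with
    | empty => exact AddChar.map_zero_eq_one ψ
    | insert v T hv ih => rw [Finset.sum_insert hv, AddChar.map_add_eq_mul, h2, ih, one_mul]
  have hfst : ∀ T : Finset (FinitePlace k), (∑ v ∈ T, Adele.single v (a.2 v)).1 = 0 := by
    intro T
    induction T using Finset.induction_on with
    | empty => rfl
    | insert v T hv ih =>
      rw [Finset.sum_insert hv]
      funext w
      rw [Adele.add_fst, ih]
      simp
  have hsnd : ∀ (T : Finset (FinitePlace k)) (w), (∑ v ∈ T, Adele.single v (a.2 v)).2 w =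
      if w ∈ T then a.2 w else 0 := by
    intro T w
    induction T using Finset.induction_on with
    | empty => rfl
    | insert v T hv ih =>
      rw [Finset.sum_insert hv, Adele.add_snd, ih]
      by_cases hw : w = v
      · subst hw; simp [hv]
      · simp [hw, Adele.single_snd_of_ne hw]
  have h3 : ψ (a - ∑ v ∈ T, Adele.single v (a.2 v)) = 1 := by
    refine h _ ?_ (fun v => ?_) fun v hv => ?_
    · funext w
      rw [Adele.sub_fst, h1, hfst]
      exact sub_self _
    · rw [Adele.sub_snd, hsnd]
      split_ifs with hv
      · simp
      · rw [sub_zero]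
        by_contra h
        exact hv (Finset.mem_union_right _ ((Set.Finite.mem_toFinset _).2 h))
    · rw [Adele.sub_snd, hsnd, if_pos (Finset.mem_union_left _ hv), sub_self, map_zero]
      exact zero_le
  rwa [AddChar.map_sub_eq_div, hsum, div_one] at h3

variable (hinf : ∀ a : Adele k, (∀ v, a.2 v = 0) →
  ((ψ a : Circle) : ℂ) = Complex.exp (2 * Real.pi * Complex.I * archTrace a.1))

include hinf in
-- Triviality of `ψ (y ·)` on the archimedean part says that a real linear form takes only integral
-- values; a non-zero form would take the value `1 / 2`.
theorem fst_eq_zero_of_character {y : Adele k} (hy : ∀ a, ψ (y * a) = 1) : y.1 = 0 := by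
  have hint : ∀ z : archSpace k, ∃ n : ℤ, inner ℝ z (archConj (archEmbedding y.1)) = (n : ℝ) := by
    intro z
    obtain ⟨a, rfl, ha⟩ := exists_toArch_eq z
    have h1 := hinf (y * a) (fun v => by rw [Adele.mul_snd, ha, mul_zero])
    rw [hy] at h1
    have h2 : archTrace (y * a).1 = inner ℝ (toArch a) (archConj (archEmbedding y.1)) :=
      archTrace_mul y.1 a.1
    rw [h2, Circle.coe_one, eq_comm, Complex.exp_eq_one_iff] at h1
    obtain ⟨n, hn⟩ := h1
    refine ⟨n, ?_⟩
    have h3 : (2 * Real.pi * Complex.I : ℂ) ≠ 0 := Complex.two_pi_I_ne_zero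
    have h4 : ((inner ℝ (toArch a) (archConj (archEmbedding y.1)) : ℝ) : ℂ) = ((n : ℝ) : ℂ) := by
      refine mul_left_cancel₀ h3 ?_
      rw [hn]; push_cast; ring
    exact_mod_cast h4
  have hzero : ‖archEmbedding y.1‖ ^ 2 = 0 := by
    by_contra hne
    set c := archConj (archEmbedding y.1) with hcdef
    have hcc : inner ℝ c c ≠ (0 : ℝ) := by
      rw [real_inner_self_eq_norm_sq, hcdef, norm_archConj]; exact hne
    obtain ⟨n, hn⟩ := hint ((1 / 2 * (inner ℝ c c)⁻¹ : ℝ) • c)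
    have hsm : inner ℝ ((1 / 2 * (inner ℝ c c)⁻¹ : ℝ) • c) c =
        (1 / 2 * (inner ℝ c c)⁻¹ : ℝ) * inner ℝ c c := real_inner_smul_left c c _
    rw [hsm, mul_assoc, inv_mul_cancel₀ hcc] at hn
    have h5 : ((2 * n : ℤ) : ℝ) = ((1 : ℤ) : ℝ) := by push_cast; linarith
    have h6 : 2 * n = 1 := by exact_mod_cast h5
    omega
  funext w
  have h7 := norm_le_norm_archEmbedding y.1 w
  have h8 : ‖archEmbedding y.1‖ = 0 := by simpa using hzero
  rw [h8] at h7
  exact norm_le_zero_iff.1 h7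

include hc hk hψ hinf in
theorem eq_zero_of_character {y : Adele k} (hy : ∀ a, ψ (y * a) = 1) : y = 0 := by
  refine Adele.ext (fun w => by rw [fst_eq_zero_of_character hinf hy]; rfl) fun v => ?_
  by_contra h
  rw [Adele.zero_snd] at h
  obtain ⟨z, hz⟩ := exists_character_single_ne_one hc hk hψ v
  refine hz ?_
  have := hy (Adele.single v ((y.2 v)⁻¹ * z))
  rwa [mul_comm, Adele.single_mul, mul_comm, mul_inv_cancel_left₀ h] at this

include hc hk hψ hinf in
/-- The annihilator of `k` for the pairing given by a character of the adele class group is `k`. -/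
theorem mem_principal_of_character {y : Adele k} (hy : ∀ x : k, ψ (y * diag k x) = 1) :
    y ∈ principal k := by
  obtain ⟨K, hK, hcov⟩ := exists_isCompact_cover (k := k)
  obtain ⟨U, hU, hUK⟩ := exists_nhds_mul_subset hK (character_nhds hc)
  have := IsAdelic.infinite (k := k)
  let c := Infinite.natEmbedding k
  -- The whole line `k y` annihilates `k`. Two of its points are congruent modulo `k` up to a small
  -- error. The error also annihilates `k`, so smallness makes it zero, and `y` is a quotient of
  -- elements of `k`.
  obtain ⟨n, l, hnl, x, hx⟩ := exists_diag_sub_mem (fun n => diag k (c n) * y) hU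
  have hz : diag k x - (diag k (c n) * y - diag k (c l) * y) = 0 := by
    refine eq_zero_of_character hc hk hψ hinf fun a => ?_
    refine character_mul_eq_one hcov (fun t => ?_) (fun b hb => hUK _ hx _ hb) a
    have h1 : (diag k x - (diag k (c n) * y - diag k (c l) * y)) * diag k t =
        diag k x * diag k t - y * diag k ((c n - c l) * t) := by
      rw [map_mul, map_sub]; ring
    rw [h1, AddChar.map_sub_eq_div, hy, character_diag_mul_diag hk, div_one]
  have hne : c n - c l ≠ 0 := sub_ne_zero.2 fun h => hnl (c.injective h)
  refine mem_principal.2 ⟨(c n - c l)⁻¹ * x, ?_⟩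
  have h2 : diag k x = diag k (c n - c l) * y := by
    rw [sub_eq_zero] at hz
    rw [hz, map_sub]; ring
  rw [map_mul, h2, ← mul_assoc, ← map_mul, inv_mul_cancel₀ hne, map_one, one_mul]

include hc hk hψ in
-- The divisor of `κ` is minus the conductor, so integrality of `κ y` at `v` means that `y_v O_v`
-- lies in the largest fractional ideal on which `ψ` is trivial.
theorem character_trivial_iff {κ : (Adele k)ˣ} (hκ : ideleDivisor κ = characterDivisor ψ)
    (y : Adele k) (v : FinitePlace k) :
    Valued.v (((κ : Adele k) * y).2 v) ≤ 1 ↔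
      ∀ z : v.Completion, Valued.v z ≤ Valued.v (y.2 v) → ψ (Adele.single v z) = 1 := by
  rw [Adele.mul_snd, map_mul, valued_idele, hκ, characterDivisor_finite]
  rcases eq_or_ne (Valued.v (y.2 v)) 0 with h0 | h0
  · rw [h0, mul_zero]
    refine iff_of_true zero_le fun z hz => ?_
    have hz0 : z = 0 := (Valuation.zero_iff _).1 (le_antisymm hz zero_le)
    have : Adele.single v (0 : v.Completion) = 0 := (Adele.eq_single (a := 0) rfl fun _ _ => rfl).symm
    rw [hz0, this, AddChar.map_zero_eq_one]
  · obtain ⟨n, hn⟩ := WithZero.exists_exp_eq h0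
    rw [hn, character_single_iff hc hk hψ, ← WithZero.exp_add, ← WithZero.exp_zero,
      WithZero.exp_le_exp]
    omega

include hc hk hψ hinf in
/-- The Fourier transform of the adelic Gaussian. -/
theorem fourier_adelicGaussian {κ : (Adele k)ˣ} (hκ : ideleDivisor κ = characterDivisor ψ)
    (y : Adele k) : ∫ u : Adele k, (adelicGaussian 1 u : ℂ) * ψ (y * u) ∂(adeleMeasure k) =
      (∫ u : Adele k, adelicGaussian 1 u ∂(adeleMeasure k) : ℝ) *
        adelicGaussian 1 ((κ : Adele k) * y) := by
  by_cases hy : (κ : Adele k) * y ∈ integralAdeles k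
  · have h1 : ∀ u : Adele k, (adelicGaussian 1 u : ℂ) * ψ (y * u) = (adelicGaussian 1 u : ℂ) *
        Complex.exp (2 * Real.pi * Complex.I * archTrace (y.1 * u.1)) := by
      intro u
      by_cases hu : u ∈ integralAdeles k
      · congr 1
        -- For integral `u` the finite part of `y u` is killed by `ψ`, so only the archimedean
        -- character remains.
        let b : Adele k := Adele.mk (y * u).1 0 (by simp)
        have h2 : ψ (y * u - b) = 1 := by
          refine character_eq_one_of_single hc ?_ fun v => ?_
          · funext w
            exact sub_self _
          · refine (character_trivial_iff hc hk hψ hκ y v).1 (hy v) _ ?_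
            have : (y * u - b).2 v = y.2 v * u.2 v := sub_zero _
            rw [this, map_mul]
            exact mul_le_of_le_one_right' (hu v)
        rw [AddChar.map_sub_eq_div, div_eq_one] at h2
        rw [h2, hinf b fun v => rfl]
        rfl
      · rw [adelicGaussian_of_notMem 1 hu]; simp
    simp_rw [h1]
    rw [integral_adelicGaussian_mul_character, adelicGaussian_of_mem 1 hy]
    congr 4
    rw [one_mul]
    congr 1
    refine Finset.sum_congr rfl fun w _ => ?_
    have h3 : ‖(κ : Adele k).1 w‖ = 1 := by
      rw [← ideleDivisor_infinite_eq_zero_iff, hκ]; rfl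
    rw [Adele.mul_fst, norm_mul, h3, one_mul]
  · rw [adelicGaussian_of_notMem 1 hy, Complex.ofReal_zero, mul_zero]
    obtain ⟨v, hv⟩ := not_forall.1 hy
    rw [character_trivial_iff hc hk hψ hκ] at hv
    push Not at hv
    obtain ⟨z, hz, hz1⟩ := hv
    have hy0 : y.2 v ≠ 0 := by
      intro h0
      rw [h0, map_zero] at hz
      have hz0 : z = 0 := (Valuation.zero_iff _).1 (le_antisymm hz zero_le)
      have : Adele.single v (0 : v.Completion) = 0 :=
        (Adele.eq_single (a := 0) rfl fun _ _ => rfl).symm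
      rw [hz0, this, AddChar.map_zero_eq_one] at hz1
      exact hz1 rfl
    -- Translation by this integral adele fixes the Gaussian but multiplies the integrand by `ψ(z) ≠
    -- 1`, so the integral vanishes.
    let b : Adele k := Adele.single v ((y.2 v)⁻¹ * z)
    have hb : y * b = Adele.single v z := by
      rw [mul_comm, Adele.single_mul, mul_comm, mul_inv_cancel_left₀ hy0]
    have hbi : b ∈ integralAdeles k := by
      intro w
      by_cases hw : w = v
      · subst hw
        rw [Adele.single_snd_self, map_mul, map_inv₀]
        exact inv_mul_le_one_of_le₀ hz zero_le
      · rw [Adele.single_snd_of_ne hw, map_zero]; exact zero_le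
    have hG : ∀ u, adelicGaussian 1 (b + u) = adelicGaussian 1 u := by
      intro u
      refine adelicGaussian_congr 1 ?_ ((integralAdeles k).add_mem_cancel_left hbi)
      refine congrArg archNormSq (funext fun w => ?_)
      rw [Adele.add_fst]
      simp [b]
    have h4 : ∫ u : Adele k, (adelicGaussian 1 u : ℂ) * ψ (y * u) ∂(adeleMeasure k) =
        ψ (Adele.single v z) * ∫ u : Adele k, (adelicGaussian 1 u : ℂ) * ψ (y * u) ∂(adeleMeasure k) := by
      conv_lhs => rw [← integral_add_left_eq_self _ b]
      rw [← integral_const_mul]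
      refine integral_congr_ae (.of_forall fun u => ?_)
      simp only [hG, mul_add, hb, AddChar.map_add_eq_mul, Circle.coe_mul]
      ring
    have h5 : ((ψ (Adele.single v z) : ℂ) - 1) *
        ∫ u : Adele k, (adelicGaussian 1 u : ℂ) * ψ (y * u) ∂(adeleMeasure k) = 0 := by
      rw [sub_mul, ← h4]; ring
    refine (mul_eq_zero.1 h5).resolve_left (sub_ne_zero.2 fun h => hz1 (Circle.ext ?_))
    simpa using h

end Character

end GlobalAdele

/-! ### Poisson summation and duality -/

namespace GlobalAdele

open Filter Topology MeasureTheory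

variable {k : Type*} [Field k] [IsCocompactAdelic k]

section Character

variable {ψ : AddChar (Adele k) Circle} (hc : Continuous ψ) (hk : ∀ a ∈ principal k, ψ a = 1)
  (hψ : ψ ≠ 1)

variable (ψ) in
/-- The character `a ↦ ψ(x a)` as a function on the adele class group. -/
noncomputable def quotientCharacter (x : k) (q : AdeleQuotient k) : ℂ :=
  ψ (diag k x * (Quotient.out (s := QuotientAddGroup.leftRel (principal k)) q : Adele k))

include hk in
theorem quotientCharacter_apply (x : k) (a : Adele k) :
    quotientCharacter ψ x (toAdeleQuotient k a) = ψ (diag k x * a) := by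
  obtain ⟨u, hu⟩ := isLatticeQuotient_adele.exists_add_eq
    (toAdeleQuotient_out (toAdeleQuotient k a))
  obtain ⟨y, hy⟩ := mem_principal.1 u.2
  rw [quotientCharacter]
  conv_rhs => rw [hu, ← hy]
  rw [mul_add, AddChar.map_add_eq_mul, character_diag_mul_diag hk, mul_one]

include hc hk in
theorem continuous_quotientCharacter (x : k) : Continuous (quotientCharacter ψ x) := by
  rw [(isLatticeQuotient_adele (k := k)).isOpenQuotientMap.isQuotientMap.continuous_iff]
  have : quotientCharacter ψ x ∘ toAdeleQuotient k = fun a => (ψ (diag k x * a) : ℂ) :=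
    funext (quotientCharacter_apply hk x)
  rw [this]
  exact continuous_subtype_val.comp (hc.comp (continuous_const.mul continuous_id))

theorem toAdeleQuotient_surjective : Function.Surjective (toAdeleQuotient k) :=
  isLatticeQuotient_adele.isOpenQuotientMap.surjective

variable (hinf : ∀ a : Adele k, (∀ v, a.2 v = 0) →
  ((ψ a : Circle) : ℂ) = Complex.exp (2 * Real.pi * Complex.I * archTrace a.1))

include hc hk hψ hinf in
/-- The Fourier coefficients of a periodized function. -/
theorem integral_quotientFunction_mul_character {κ : (Adele k)ˣ}
    (hκ : ideleDivisor κ = characterDivisor ψ) (α : (Adele k)ˣ) (x : k) :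
    ∫ q, ((quotientFunction (ideleFunction α) q : ℝ) : ℂ) * quotientCharacter ψ x q
      ∂(quotientMeasure k) =
      (((ideleModule α * ∫ u : Adele k, adelicGaussian 1 u ∂(adeleMeasure k)) * (expH0 α)⁻¹ *
        ideleFunction (κ⁻¹ * α⁻¹) (diag k x) : ℝ) : ℂ) := by
  have hnorm : ∀ a, ‖((ψ a : Circle) : ℂ)‖ = 1 := fun a => Circle.norm_coe _
  have hcont : Continuous fun a : Adele k => (ψ (diag k x * a) : ℂ) :=
    continuous_subtype_val.comp (hc.comp (continuous_const.mul continuous_id))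
  have h1 := integral_adele_eq (f := fun a => (ideleFunction α a : ℂ) * ψ (diag k x * a))
    ((integrable_ideleFunction α).ofReal.mul_bdd (c := 1) hcont.aestronglyMeasurable
      (.of_forall fun a => (hnorm _).le))
    (fun a => by
      refine Summable.of_norm ?_
      have := summable_ideleFunction α a
      convert this using 2 with u
      rw [norm_mul, hnorm, mul_one, Complex.norm_real, Real.norm_of_nonneg (ideleFunction_nonneg _ _)])
    (fun q => ((quotientFunction (ideleFunction α) q * expH0 α : ℝ) : ℂ) * quotientCharacter ψ x q)
    (fun a => by
      rw [quotientFunction_apply, inv_mul_cancel_right₀ (expH0_pos α).ne',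
        quotientCharacter_apply hk, Complex.ofReal_tsum, ← tsum_mul_right]
      refine tsum_congr fun u => ?_
      obtain ⟨y, hy⟩ := mem_principal.1 u.2
      rw [← hy, mul_add, AddChar.map_add_eq_mul, character_diag_mul_diag hk, mul_one])
  -- The substitution `u ↦ α u` reduces the Fourier transform of `f_α` at `x` to that of `f_1` at `x
  -- α`, with a factor `|α|`.
  have h2 := integral_comp_idele_mul α
    (fun u => (adelicGaussian 1 u : ℂ) * ψ ((diag k x * (α : Adele k)) * u))
  rw [fourier_adelicGaussian hc hk hψ hinf hκ] at h2
  have h3 : ∀ u : Adele k, (diag k x * (α : Adele k)) * (((α⁻¹ : (Adele k)ˣ) : Adele k) * u) =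
      diag k x * u := fun u => by rw [mul_assoc, Units.mul_inv_cancel_left]
  simp only [h3, ← ideleFunction_apply] at h2
  have h4 : ideleFunction (κ⁻¹ * α⁻¹) (diag k x) =
      adelicGaussian 1 ((κ : Adele k) * (diag k x * (α : Adele k))) := by
    rw [ideleFunction_apply, mul_inv_rev, inv_inv, inv_inv, Units.val_mul]
    congr 1
    ring
  have h5 : ∀ q, ((quotientFunction (ideleFunction α) q * expH0 α : ℝ) : ℂ) *
      quotientCharacter ψ x q = (expH0 α : ℂ) *
      (((quotientFunction (ideleFunction α) q : ℝ) : ℂ) * quotientCharacter ψ x q) := fun q => by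
    push_cast; ring
  simp only [h5] at h1
  rw [integral_const_mul, h2] at h1
  have h6 : (expH0 α : ℂ) ≠ 0 := by exact_mod_cast (expH0_pos α).ne'
  rw [← mul_right_inj' h6, ← h1, h4, Complex.real_smul]
  push_cast
  field_simp

include hc hk hψ hinf in
/-- Poisson summation, in the form of a duality between `h¹` and `h⁰`. -/
theorem expH1_eq_expH0 {κ : (Adele k)ˣ}
    (hκ : ideleDivisor κ = characterDivisor ψ) (α : (Adele k)ˣ) :
    expH1 α = expH0 (κ⁻¹ * α⁻¹) := by
  set C : ℝ := (ideleModule α * ∫ u : Adele k, adelicGaussian 1 u ∂(adeleMeasure k)) * (expH0 α)⁻¹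
    with hC
  have hCpos : 0 < C := mul_pos (mul_pos (ideleModule_pos α)
    (integral_adelicGaussian_pos one_pos)) (inv_pos.2 (expH0_pos α))
  let e : k → C(AdeleQuotient k, ℂ) := fun x =>
    ⟨quotientCharacter ψ x, continuous_quotientCharacter hc hk x⟩
  have he : ∀ x a, e x (toAdeleQuotient k a) = ψ (diag k x * a) := quotientCharacter_apply hk
  have hext : ∀ {f g : C(AdeleQuotient k, ℂ)},
      (∀ a, f (toAdeleQuotient k a) = g (toAdeleQuotient k a)) → f = g := fun h =>
    ContinuousMap.ext fun q => by
      obtain ⟨a, rfl⟩ := toAdeleQuotient_surjective q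
      exact h a
  let f : C(AdeleQuotient k, ℂ) :=
    ⟨fun q => ((quotientFunction (ideleFunction α) q : ℝ) : ℂ),
      Complex.continuous_ofReal.comp (continuous_quotientFunction α)⟩
  have hcoef : ∀ x, ∫ q, f q * e x q ∂(quotientMeasure k) =
      ((C * ideleFunction (κ⁻¹ * α⁻¹) (diag k x) : ℝ) : ℂ) := fun x =>
    integral_quotientFunction_mul_character hc hk hψ hinf hκ α x
  have hsum0 : Summable fun x : k => ideleFunction (κ⁻¹ * α⁻¹) (diag k x) := by
    have h := summable_ideleFunction (κ⁻¹ * α⁻¹) 0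
    simp only [zero_add] at h
    have := (principalEquiv (k := k)).toEquiv.summable_iff.2 h
    exact this
  have htsum0 : ∑' x : k, ideleFunction (κ⁻¹ * α⁻¹) (diag k x) = expH0 (κ⁻¹ * α⁻¹) :=
    (principalEquiv (k := k)).toEquiv.tsum_eq
      (fun u : principal k => ideleFunction (κ⁻¹ * α⁻¹) (u : Adele k))
  have hmain := tsum_fourier_coefficients (quotientMeasure k) e
    (hext fun a => by rw [he, map_zero, zero_mul, AddChar.map_zero_eq_one]; rfl)
    (fun x y => hext fun a => by
      rw [he, map_add, add_mul, AddChar.map_add_eq_mul, ContinuousMap.mul_apply, he, he,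
        Circle.coe_mul])
    (fun x => hext fun a => by
      rw [he, map_neg, neg_mul, AddChar.map_neg_eq_inv, ContinuousMap.star_apply, he,
        Circle.coe_inv_eq_conj]
      rfl)
    (fun x a b => by
      obtain ⟨a, rfl⟩ := toAdeleQuotient_surjective a
      obtain ⟨b, rfl⟩ := toAdeleQuotient_surjective b
      rw [← map_add, he, he, he, mul_add, AddChar.map_add_eq_mul, Circle.coe_mul])
    (fun x a => Circle.norm_coe _)
    (fun x hx => by
      by_contra! h
      refine hψ (character_eq_one_of_diag hx fun a => Circle.ext ?_)
      rw [← he, h]; rfl)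
    -- Separation of points: if all `ψ (x ·)` agree at `a` and `b`, then `a - b` annihilates `k`,
    -- hence lies in `k`.
    (fun a b hab => by
      by_contra! h
      obtain ⟨a, rfl⟩ := toAdeleQuotient_surjective a
      obtain ⟨b, rfl⟩ := toAdeleQuotient_surjective b
      refine hab ?_
      rw [← sub_eq_zero, ← map_sub]
      refine isLatticeQuotient_adele.map_eq_zero_iff.2
        (mem_principal_of_character hc hk hψ hinf fun x => ?_)
      have h1 := h x
      rw [he, he] at h1
      rw [mul_comm, mul_sub, AddChar.map_sub_eq_div, Circle.ext h1, div_self']) f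
    (by
      simp only [hcoef, Complex.norm_real]
      exact (hsum0.mul_left C).norm)
  simp only [hcoef] at hmain
  rw [← Complex.ofReal_tsum, tsum_mul_left, htsum0] at hmain
  have hf0 : f 0 = 1 := by
    have h0 : quotientFunction (ideleFunction α) (toAdeleQuotient k 0) = 1 := by
      rw [quotientFunction_apply]
      simp only [zero_add]
      exact mul_inv_cancel₀ (expH0_pos α).ne'
    rw [map_zero] at h0
    change ((quotientFunction (ideleFunction α) 0 : ℝ) : ℂ) = 1
    rw [h0, Complex.ofReal_one]
  rw [hf0] at hmain
  -- The Fourier series evaluated at the origin, where the normalised periodised function equals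
  -- `1`.
  have h7 : C * expH0 (κ⁻¹ * α⁻¹) = 1 := by exact_mod_cast hmain
  have h8 : expH1 α = C⁻¹ := by
    rw [hC, mul_inv_rev, inv_inv, expH1_eq, integral_ideleFunction]
  rw [h8]
  exact (eq_inv_of_mul_eq_one_right h7).symm

include hc hk hψ hinf in
theorem h1_eq_h0 {κ : (Adele k)ˣ} (hκ : ideleDivisor κ = characterDivisor ψ) (α : (Adele k)ˣ) :
    h1 α = h0 (κ⁻¹ * α⁻¹) := by
  rw [h1, h0, expH1_eq_expH0 hc hk hψ hinf hκ]

end Character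

end GlobalAdele

namespace GlobalAdele

open Filter Topology IsDedekindDomain

variable {k : Type*} [Field k]

/-! ### Places and prime ideals of a Dedekind domain -/

/-- Units of `v` are units of `w`, so `w` is a power of `v` determined by its value `exp m` at a
prime element `p` of `v`. Surjectivity of `w` forces `-m` to be a unit of `ℤ`, and `m ≤ 0` leaves `m
= -1`. -/
theorem FinitePlace.eq_of_le_one {v w : FinitePlace k} (h : ∀ x, v.1 x ≤ 1 → w.1 x ≤ 1) : v = w := by
  have hunit : ∀ x, v.1 x = 1 → w.1 x = 1 := by
    intro x hx
    have hx0 : x ≠ 0 := by rintro rfl; simp at hx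
    refine le_antisymm (h x hx.le) ?_
    have h1 := h x⁻¹ (by rw [map_inv₀, hx, inv_one])
    rw [map_inv₀] at h1
    exact (inv_le_one₀ (zero_lt_iff.2 ((Valuation.ne_zero_iff _).2 hx0))).1 h1
  obtain ⟨p, hp0, hp⟩ := v.exists_valuation_eq_exp (-1)
  obtain ⟨m, hm⟩ := WithZero.exists_exp_eq ((Valuation.ne_zero_iff w.1).2 hp0)
  have hm0 : m ≤ 0 := by
    have := h p (by rw [hp, ← WithZero.exp_zero, WithZero.exp_le_exp]; omega)
    rwa [hm, ← WithZero.exp_zero, WithZero.exp_le_exp] at this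
  have key : ∀ x n, v.1 x = WithZero.exp n → w.1 x = WithZero.exp (-m * n) := by
    intro x n hx
    have h1 : v.1 (x * p ^ n) = 1 := by
      rw [map_mul, map_zpow₀, hx, hp, ← WithZero.exp_zsmul, ← WithZero.exp_add, ← WithZero.exp_zero]
      congr 1
      simp
    have h2 := hunit _ h1
    rw [map_mul, map_zpow₀, hm, ← WithZero.exp_zsmul] at h2
    rw [eq_inv_of_mul_eq_one_left h2, ← WithZero.exp_neg]
    congr 1
    simp [mul_comm]
  obtain ⟨x, hx0, hx⟩ := w.exists_valuation_eq_exp 1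
  obtain ⟨n, hn⟩ := WithZero.exists_exp_eq ((Valuation.ne_zero_iff v.1).2 hx0)
  have h3 := key x n hn
  rw [hx] at h3
  have h4 := WithZero.exp_injective h3
  have hm1 : m = -1 := by
    have h5 : IsUnit (-m) := IsUnit.of_mul_eq_one n h4.symm
    rcases Int.isUnit_iff.1 h5 with h | h <;> omega
  refine Subtype.ext (Valuation.ext fun y => ?_)
  rcases eq_or_ne y 0 with rfl | hy
  · simp
  · obtain ⟨l, hl⟩ := WithZero.exists_exp_eq ((Valuation.ne_zero_iff v.1).2 hy)
    rw [key y l hl, hl, hm1]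
    simp

section Dedekind

variable {R : Type*} [CommRing R] [IsDedekindDomain R] [Algebra R k] [IsFractionRing R k]

variable (R) in
/-- The place `v` is integral on `R`. -/
def FinitePlace.IntegralOn (v : FinitePlace k) : Prop := ∀ r : R, v.1 (algebraMap R k r) ≤ 1

variable (k) in
/-- The place of a non-zero prime ideal. -/
noncomputable def placeOfPrime (p : HeightOneSpectrum R) : FinitePlace k :=
  ⟨p.valuation k, p.valuation_surjective k⟩

/-- The elements of `R` with `v < 1` form a prime ideal, non-zero because otherwise `v` would be
trivial on the fraction field. A fraction integral at this prime has a denominator that is a unit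
for `v`, so `FinitePlace.eq_of_le_one` applies. -/
theorem FinitePlace.IntegralOn.exists_prime {v : FinitePlace k} (hv : v.IntegralOn R) :
    ∃ p : HeightOneSpectrum R, placeOfPrime k p = v := by
  let I : Ideal R :=
    { carrier := {r | v.1 (algebraMap R k r) < 1}
      zero_mem' := by simp
      add_mem' := fun {a b} ha hb => by
        change v.1 (algebraMap R k (a + b)) < 1
        rw [map_add]
        exact Valuation.map_add_lt _ ha hb
      smul_mem' := fun c a ha => by
        change v.1 (algebraMap R k (c * a)) < 1
        rw [map_mul, map_mul]
        exact lt_of_le_of_lt (mul_le_of_le_one_left' (hv c)) ha }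
  have hI : ∀ r, r ∈ I ↔ v.1 (algebraMap R k r) < 1 := fun r => Iff.rfl
  have hprime : I.IsPrime := by
    refine ⟨?_, fun {a b} hab => ?_⟩
    · rw [Ideal.ne_top_iff_one, hI]
      simp
    · by_contra! h
      rw [hI, hI, not_lt, not_lt] at h
      rw [hI, map_mul, map_mul, le_antisymm (hv a) h.1, le_antisymm (hv b) h.2] at hab
      simp at hab
  have hne : I ≠ ⊥ := by
    intro hbot
    obtain ⟨x, hx0, hx⟩ := v.exists_valuation_eq_exp 1
    obtain ⟨a, b, hb, rfl⟩ := IsFractionRing.div_surjective (A := R) x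
    have hb1 : v.1 (algebraMap R k b) = 1 := by
      refine le_antisymm (hv b) (not_lt.1 fun h => ?_)
      rw [← hI, hbot, Ideal.mem_bot] at h
      exact nonZeroDivisors.ne_zero hb h
    rw [map_div₀, hb1, div_one] at hx
    have := hv a
    rw [hx, ← WithZero.exp_zero, WithZero.exp_le_exp] at this
    omega
  let p : HeightOneSpectrum R := ⟨I, hprime, hne⟩
  refine ⟨p, FinitePlace.eq_of_le_one fun x hx => ?_⟩
  obtain ⟨n, d, hnd⟩ := p.exists_primeCompl_mul_eq_of_integer x hx
  have hd : v.1 (algebraMap R k d) = 1 :=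
    le_antisymm (hv d) (not_lt.1 fun h => d.2 ((hI _).2 h))
  have := hv n
  rwa [← hnd, map_mul, hd, mul_one] at this

theorem placeOfPrime_injective : Function.Injective (placeOfPrime k : HeightOneSpectrum R → _) := by
  intro p q h
  refine HeightOneSpectrum.ext (Ideal.ext fun r => ?_)
  rw [← p.valuation_lt_one_iff_mem (K := k), ← q.valuation_lt_one_iff_mem (K := k)]
  have : p.valuation k = q.valuation k := congrArg Subtype.val h
  rw [this]

variable (R) in
theorem finite_integralOn_ne_one {x : k} (hx : x ≠ 0) :
    {v : FinitePlace k | v.IntegralOn R ∧ v.1 x ≠ 1}.Finite := by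
  refine (((HeightOneSpectrum.Support.finite R x).union
    (HeightOneSpectrum.Support.finite R x⁻¹)).image (placeOfPrime k)).subset ?_
  rintro v ⟨hv, hvx⟩
  obtain ⟨p, rfl⟩ := hv.exists_prime
  refine ⟨p, ?_, rfl⟩
  have hpx : p.valuation k x ≠ 1 := hvx
  rcases lt_or_gt_of_ne hpx with h | h
  · right
    change 1 < p.valuation k x⁻¹
    rw [map_inv₀]
    exact (one_lt_inv₀ (zero_lt_iff.2 ((Valuation.ne_zero_iff _).2 hx))).2 h
  · left; exact h

theorem FinitePlace.IntegralOn.exists_sub_lt {v : FinitePlace k} (hv : v.IntegralOn R) {x : k}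
    (hx : v.1 x ≤ 1) : ∃ r : R, v.1 (algebraMap R k r - x) < 1 := by
  obtain ⟨p, rfl⟩ := hv.exists_prime
  exact p.exists_valuation_sub_lt_of_integer hx 1

theorem FinitePlace.IntegralOn.finite_residueField [Ring.HasFiniteQuotients R] {v : FinitePlace k}
    (hv : v.IntegralOn R) : Finite (IsLocalRing.ResidueField v.1.valuationSubring) := by
  obtain ⟨p, hp⟩ := id hv.exists_prime
  let f : R →+* IsLocalRing.ResidueField v.1.valuationSubring :=
    (IsLocalRing.residue _).comp ((algebraMap R k).codRestrict v.1.valuationSubring hv)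
  have hf : Function.Surjective f := by
    intro c
    obtain ⟨⟨x, hx⟩, rfl⟩ := IsLocalRing.residue_surjective c
    obtain ⟨r, hr⟩ := hv.exists_sub_lt hx
    refine ⟨r, ?_⟩
    rw [← sub_eq_zero]
    change IsLocalRing.residue _ _ - IsLocalRing.residue _ _ = 0
    rw [← map_sub, IsLocalRing.residue_eq_zero_iff, Valuation.mem_maximalIdeal_iff]
    exact hr
  have hker : ∀ r ∈ p.asIdeal, f r = 0 := by
    intro r hr
    change IsLocalRing.residue _ _ = 0
    rw [IsLocalRing.residue_eq_zero_iff, Valuation.mem_maximalIdeal_iff]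
    subst hp
    exact (p.valuation_lt_one_iff_mem r).2 hr
  have : Finite (R ⧸ p.asIdeal) := Ring.HasFiniteQuotients.finiteQuotient p.ne_bot
  exact Finite.of_surjective (Ideal.Quotient.lift p.asIdeal f hker)
    (Ideal.Quotient.lift_surjective_of_surjective _ _ hf)

/-- Strong approximation over a Dedekind domain, for prime ideals. -/
theorem exists_forall_valuation_sub_le_prime (S : Finset (HeightOneSpectrum R))
    (y : HeightOneSpectrum R → k) (N : HeightOneSpectrum R → ℕ) :
    ∃ x : k, (∀ p ∈ S, p.valuation k (x - y p) ≤ WithZero.exp (-(N p : ℤ))) ∧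
      ∀ p ∉ S, p.valuation k x ≤ 1 := by
  classical
  obtain ⟨⟨d, hd⟩, hdy⟩ := IsLocalization.exist_integer_multiples_of_finset
    (nonZeroDivisors R) (S.image y)
  have hd0 : d ≠ 0 := nonZeroDivisors.ne_zero hd
  have hdk : algebraMap R k d ≠ 0 := fun h => hd0 (by simpa using h)
  -- Besides `S`, the primes dividing the common denominator `d` need a congruence, so that `r / d`
  -- stays integral there.
  let S' := S ∪ (HeightOneSpectrum.Support.finite R (algebraMap R k d)⁻¹).toFinset
  have hz : ∀ p : HeightOneSpectrum R, ∃ z : R,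
      algebraMap R k z = algebraMap R k d * if p ∈ S then y p else 0 := by
    intro p
    split_ifs with hp
    · obtain ⟨z, hz⟩ := hdy (y p) (Finset.mem_image_of_mem _ hp)
      exact ⟨z, by rw [hz, Algebra.smul_def]⟩
    · exact ⟨0, by simp⟩
  choose z hz using hz
  have he : ∀ p : HeightOneSpectrum R, ∃ e : ℕ,
      p.valuation k (algebraMap R k d) = WithZero.exp (-(e : ℤ)) := by
    intro p
    obtain ⟨n, hn⟩ := WithZero.exists_exp_eq ((Valuation.ne_zero_iff (p.valuation k)).2 hdk)
    have h1 := p.valuation_le_one (K := k) d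
    rw [hn, ← WithZero.exp_zero, WithZero.exp_le_exp] at h1
    exact ⟨(-n).toNat, by rw [hn]; congr 1; omega⟩
  choose e he using he
  -- Chinese remainder theorem for the numerators `d y_p`; the exponent is raised by the order `e p`
  -- of `d`, which is lost on dividing.
  obtain ⟨r, hr⟩ := IsDedekindDomain.exists_forall_sub_mem_ideal (s := S')
    (fun p : HeightOneSpectrum R => p.asIdeal) (fun p => N p + e p) (fun p _ => p.prime)
    (fun p _ q _ hpq h => hpq (HeightOneSpectrum.ext h)) (fun p => z p)
  refine ⟨algebraMap R k r / algebraMap R k d, ?_⟩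
  have hmain : ∀ p ∈ S', p.valuation k (algebraMap R k r / algebraMap R k d -
      if p ∈ S then y p else 0) ≤ WithZero.exp (-(N p : ℤ)) := by
    intro p hp
    have h1 : p.valuation k (algebraMap R k (r - z p)) ≤ WithZero.exp (-((N p + e p : ℕ) : ℤ)) := by
      rw [p.valuation_of_algebraMap, p.intValuation_le_pow_iff_mem]
      exact hr p hp
    rw [map_sub, hz] at h1
    have h2 : algebraMap R k r / algebraMap R k d - (if p ∈ S then y p else 0) =
        (algebraMap R k r - algebraMap R k d * if p ∈ S then y p else 0) / algebraMap R k d := by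
      field_simp
    rw [h2, map_div₀, he p, div_le_iff₀ WithZero.exp_pos, ← WithZero.exp_add]
    refine h1.trans (WithZero.exp_le_exp.2 ?_)
    push_cast
    omega
  refine ⟨fun p hp => ?_, fun p hp => ?_⟩
  · have := hmain p (Finset.mem_union_left _ hp)
    rwa [if_pos hp] at this
  · by_cases hp' : p ∈ S'
    · have := hmain p hp'
      rw [if_neg hp, sub_zero] at this
      refine this.trans ?_
      rw [← WithZero.exp_zero, WithZero.exp_le_exp]
      omega
    · have hd1 : 1 ≤ p.valuation k (algebraMap R k d) := by
        by_contra! h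
        refine hp' (Finset.mem_union_right _ ((Set.Finite.mem_toFinset _).2 ?_))
        change 1 < p.valuation k (algebraMap R k d)⁻¹
        rw [map_inv₀]
        exact (one_lt_inv₀ (zero_lt_iff.2 ((Valuation.ne_zero_iff _).2 hdk))).2 h
      rw [map_div₀, le_antisymm (p.valuation_le_one d) hd1, div_one]
      exact p.valuation_le_one r

variable (R) in
/-- Strong approximation over a Dedekind domain. -/
theorem exists_forall_valuation_sub_le {S : Set (FinitePlace k)} (hS : S.Finite)
    (hSR : ∀ v ∈ S, v.IntegralOn R) (y : FinitePlace k → k) (N : ℤ) :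
    ∃ x : k, (∀ v ∈ S, v.1 (x - y v) ≤ WithZero.exp N) ∧
      ∀ v : FinitePlace k, v.IntegralOn R → v ∉ S → v.1 x ≤ 1 := by
  classical
  have hS' : (placeOfPrime k ⁻¹' S : Set (HeightOneSpectrum R)).Finite :=
    hS.preimage placeOfPrime_injective.injOn
  obtain ⟨x, h1, h2⟩ := exists_forall_valuation_sub_le_prime hS'.toFinset
    (fun p => y (placeOfPrime k p)) (fun _ => (-N).toNat)
  refine ⟨x, fun v hv => ?_, fun v hv hvS => ?_⟩
  · obtain ⟨p, rfl⟩ := (hSR v hv).exists_prime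
    exact (h1 p (hS'.mem_toFinset.2 hv)).trans (WithZero.exp_le_exp.2 (by omega))
  · obtain ⟨p, rfl⟩ := hv.exists_prime
    exact h2 p fun h => hvS (hS'.mem_toFinset.1 h)

variable (R) in
-- The finitely many non-integral components are approximated in `k` one by one by density, and
-- strong approximation merges these approximations.
theorem exists_forall_valued_sub_le_one (a : Adele k) :
    ∃ x : k, ∀ v : FinitePlace k, v.IntegralOn R →
      Valued.v (a.2 v - (x : v.Completion)) ≤ 1 := by
  choose y hy using fun v : FinitePlace k => v.exists_valued_sub_le (a.2 v) 0
  obtain ⟨x, h1, h2⟩ := exists_forall_valuation_sub_le R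
    (S := {v | v.IntegralOn R ∧ ¬ Valued.v (a.2 v) ≤ 1})
    ((Adele.eventually_le_one a).subset fun v hv => hv.2) (fun v hv => hv.1) y 0
  refine ⟨x, fun v hv => ?_⟩
  by_cases hva : Valued.v (a.2 v) ≤ 1
  · refine (Valuation.map_sub _ _ _).trans (max_le hva ?_)
    rw [v.valued_coe]
    exact h2 v hv fun h => h.2 hva
  · have h3 : a.2 v - (x : v.Completion) = (a.2 v - (y v : v.Completion)) -
        ((x - y v : k) : v.Completion) := by
      have : ((x - y v : k) : v.Completion) = (x : v.Completion) - (y v : v.Completion) :=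
        map_sub v.coeHom x (y v)
      rw [this]; ring
    rw [h3]
    refine (Valuation.map_sub _ _ _).trans (max_le ?_ ?_)
    · simpa using hy v
    · rw [v.valued_coe]
      simpa using h1 v ⟨hv, hva⟩

/-- An integral closure is contained in every valuation ring that contains the base. -/
theorem FinitePlace.valuation_le_one_of_isIntegral {v : FinitePlace k} {A : Type*} [CommRing A]
    [Algebra A k] (hv : ∀ a : A, v.1 (algebraMap A k a) ≤ 1) {x : k} (hx : IsIntegral A x) :
    v.1 x ≤ 1 := by
  let f : A →+* v.1.valuationSubring := (algebraMap A k).codRestrict v.1.valuationSubring hv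
  have h1 : IsIntegral v.1.valuationSubring x := by
    obtain ⟨P, hP, hPx⟩ := hx
    refine ⟨P.map f, hP.map f, ?_⟩
    rw [Polynomial.eval₂_map]
    exact hPx
  obtain ⟨y, rfl⟩ := IsIntegrallyClosed.isIntegral_iff.1 h1
  exact y.2

end Dedekind

end GlobalAdele

namespace GlobalAdele

open Filter Topology MeasureTheory

variable {k : Type*} [Field k]

/-! ### The module of an idele as an index -/

section Index

variable [IsCocompactAdelic k]

/-- The module of an integral idele is the inverse of the index of the ideal it generates in the finite
integral adeles. -/
theorem ideleModule_mul_card {β : (Adele k)ˣ} (hβ : ∀ w, ‖(β : Adele k).1 w‖ = 1) {T : Type*} [Finite T]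
    (s : T → Adele k) (hs0 : ∀ t, (s t).1 = 0)
    (hs1 : ∀ t v, ∀ y : v.Completion, Valued.v y ≤ Valued.v ((β : Adele k).2 v) →
      Valued.v ((s t).2 v + y) ≤ 1)
    (hdisj : ∀ t t', (∀ v, Valued.v ((s t - s t').2 v) ≤ Valued.v ((β : Adele k).2 v)) → t = t')
    (hcov : ∀ a ∈ integralAdeles k, ∃ t, ∀ v, Valued.v ((a - s t).2 v) ≤ Valued.v ((β : Adele k).2 v)) :
    ideleModule β * Nat.card T = 1 := by
  have hmem : ∀ a : Adele k, a ∈ (fun b => (β : Adele k) * b) '' adeleBox k 1 ↔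
      (∀ w, ‖a.1 w‖ ≤ 1) ∧ ∀ v, Valued.v (a.2 v) ≤ Valued.v ((β : Adele k).2 v) := by
    intro a
    constructor
    · rintro ⟨b, hb, rfl⟩
      refine ⟨fun w => ?_, fun v => ?_⟩
      · change ‖((β : Adele k) * b).1 w‖ ≤ 1
        rw [Adele.mul_fst, norm_mul, hβ, one_mul]
        exact hb.1 w
      · change Valued.v (((β : Adele k) * b).2 v) ≤ _
        rw [Adele.mul_snd, map_mul]
        exact mul_le_of_le_one_right' (hb.2 v)
    · rintro ⟨h1, h2⟩
      refine ⟨((β⁻¹ : (Adele k)ˣ) : Adele k) * a, ⟨fun w => ?_, fun v => ?_⟩, by simp⟩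
      · rw [Adele.mul_fst, idele_inv_fst, norm_mul, norm_inv, hβ, inv_one, one_mul]
        exact h1 w
      · rw [Adele.mul_snd, idele_inv_snd, map_mul, map_inv₀]
        exact inv_mul_le_one_of_le₀ (h2 v) zero_le
  set B := (fun b => (β : Adele k) * b) '' adeleBox k 1 with hB
  have hBm : MeasurableSet B :=
    ((isCompact_adeleBox 1).image (continuous_const.mul continuous_id)).measurableSet
  -- The box is the disjoint union of the translates of `β · box` by representatives, so comparing
  -- Haar measures yields `1 = |T| |β|`.
  have hunion : adeleBox k 1 = ⋃ t : T, (fun a => -s t + a) ⁻¹' B := by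
    ext a
    simp only [Set.mem_iUnion, Set.mem_preimage, hmem, neg_add_eq_sub]
    have hfst : ∀ t w, (a - s t).1 w = a.1 w := by
      intro t w
      rw [Adele.sub_fst, hs0]
      exact sub_zero _
    constructor
    · rintro ⟨h1, h2⟩
      obtain ⟨t, ht⟩ := hcov a h2
      exact ⟨t, fun w => by rw [hfst]; exact h1 w, ht⟩
    · rintro ⟨t, h1, h2⟩
      refine ⟨fun w => by rw [← hfst t]; exact h1 w, fun v => ?_⟩
      have := hs1 t v _ (h2 v)
      rwa [Adele.sub_snd, add_sub_cancel] at this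
  have hd : Pairwise (Function.onFun Disjoint fun t : T => (fun a => -s t + a) ⁻¹' B) := by
    intro t t' htt'
    refine Set.disjoint_left.2 fun a ha ha' => htt' (hdisj t t' fun v => ?_)
    simp only [Set.mem_preimage, hmem, neg_add_eq_sub] at ha ha'
    have : (s t - s t').2 v = (a - s t').2 v - (a - s t).2 v := by
      simp only [Adele.sub_snd]; ring
    rw [this]
    exact (Valuation.map_sub _ _ _).trans (max_le (ha'.2 v) (ha.2 v))
  have hcount : Countable T := inferInstance
  have h1 : adeleMeasure k (adeleBox k 1) = Nat.card T * (ENNReal.ofReal (ideleModule β) *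
      adeleMeasure k (adeleBox k 1)) := by
    conv_lhs => rw [hunion]
    rw [measure_iUnion hd fun t => (measurable_const_add _) hBm]
    simp_rw [measure_preimage_add]
    rw [ENNReal.tsum_const, ENat.card_eq_coe_natCard, hB, adeleMeasure_image]
    rfl
  have h2 : adeleMeasure k (adeleBox k 1) ≠ 0 :=
    (Measure.measure_pos_of_mem_nhds _ (adeleBox_mem_nhds one_pos)).ne'
  have h3 : adeleMeasure k (adeleBox k 1) ≠ ⊤ := (isCompact_adeleBox 1).measure_lt_top.ne
  have h4 := congrArg ENNReal.toReal h1
  rw [ENNReal.toReal_mul, ENNReal.toReal_mul, ENNReal.toReal_ofReal (ideleModule_pos β).le,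
    ENNReal.toReal_natCast] at h4
  have h5 : (adeleMeasure k (adeleBox k 1)).toReal ≠ 0 := ENNReal.toReal_ne_zero.2 ⟨h2, h3⟩
  have h6 : (1 : ℝ) * (adeleMeasure k (adeleBox k 1)).toReal =
      (ideleModule β * Nat.card T) * (adeleMeasure k (adeleBox k 1)).toReal := by
    linear_combination h4
  exact (mul_right_cancel₀ h5 h6).symm

theorem ideleModule_eq_one {β : (Adele k)ˣ} (hβ : ∀ w, ‖(β : Adele k).1 w‖ = 1)
    (h : ∀ v, (ideleDivisor β).finite v = 0) : ideleModule β = 1 := by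
  have hv : ∀ v, Valued.v ((β : Adele k).2 v) = 1 := fun v => by
    rw [valued_idele, h, WithZero.exp_zero]
  have := ideleModule_mul_card hβ (T := Unit) (fun _ => 0) (fun _ => rfl)
    (fun _ v y hy => by rw [Adele.zero_snd, zero_add]; rwa [hv] at hy) (fun _ _ _ => rfl)
    (fun a ha => ⟨(), fun v => by rw [sub_zero, hv]; exact ha v⟩)
  simpa using this

/-- The index is that of the maximal ideal in `O_v`; lifts to `k` of the residue classes serve as
coset representatives. -/
theorem ideleModule_of_single {β : (Adele k)ˣ} (hβ : ∀ w, ‖(β : Adele k).1 w‖ = 1) (v : FinitePlace k)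
    (h : ∀ w, w ≠ v → (ideleDivisor β).finite w = 0) (hv : (ideleDivisor β).finite v = -1) :
    ideleModule β * Nat.card (IsLocalRing.ResidueField v.1.valuationSubring) = 1 := by
  have := IsAdelic.finite_residueField v
  have hvw : ∀ w, w ≠ v → Valued.v ((β : Adele k).2 w) = 1 := fun w hw => by
    rw [valued_idele, h w hw, WithZero.exp_zero]
  have hvv : Valued.v ((β : Adele k).2 v) = WithZero.exp (-1 : ℤ) := by rw [valued_idele, hv]
  have hle : ∀ w, Valued.v ((β : Adele k).2 w) ≤ 1 := by
    intro w
    by_cases hw : w = v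
    · subst hw
      rw [hvv, ← WithZero.exp_zero, WithZero.exp_le_exp]; omega
    · rw [hvw w hw]
  let l : IsLocalRing.ResidueField v.1.valuationSubring → v.1.valuationSubring :=
    Function.surjInv IsLocalRing.residue_surjective
  have hl : ∀ c, IsLocalRing.residue _ (l c) = c := Function.surjInv_eq _
  have hres : ∀ x y : v.1.valuationSubring, IsLocalRing.residue _ x = IsLocalRing.residue _ y ↔
      v.1 ((x : k) - y) ≤ WithZero.exp (-1 : ℤ) := by
    intro x y
    rw [← sub_eq_zero, ← map_sub, IsLocalRing.residue_eq_zero_iff, Valuation.mem_maximalIdeal_iff,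
      ← WithZero.exp_zero, WithZero.lt_exp_iff]
    rfl
  have hsub : ∀ x y : k, Valued.v ((x : v.Completion) - (y : v.Completion)) = v.1 (x - y) := by
    intro x y
    rw [← v.valued_coe]
    exact congrArg _ (map_sub v.coeHom x y).symm
  refine ideleModule_mul_card hβ (T := IsLocalRing.ResidueField v.1.valuationSubring)
    (fun c => Adele.single v ((l c : k) : v.Completion)) (fun _ => rfl) (fun c w y hy => ?_)
    (fun c c' hcc' => ?_) fun a ha => ?_
  · refine (Valuation.map_add _ _ _).trans (max_le ?_ (hy.trans (hle w)))
    by_cases hw : w = v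
    · subst hw
      rw [Adele.single_snd_self, FinitePlace.valued_coe]
      exact (l c).2
    · rw [Adele.single_snd_of_ne hw, map_zero]; exact zero_le
  · have h1 := hcc' v
    rw [Adele.sub_snd, Adele.single_snd_self, Adele.single_snd_self, hvv, hsub] at h1
    rw [← hl c, ← hl c']
    exact (hres _ _).2 h1
  · obtain ⟨x, hx⟩ := v.exists_valued_sub_le (a.2 v) (-1)
    have hx1 : v.1 x ≤ 1 := by
      rw [← v.valued_coe, ← sub_sub_cancel (a.2 v) (x : v.Completion)]
      refine (Valuation.map_sub _ _ _).trans (max_le (ha v) (hx.trans ?_))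
      rw [← WithZero.exp_zero, WithZero.exp_le_exp]; omega
    refine ⟨IsLocalRing.residue _ ⟨x, hx1⟩, fun w => ?_⟩
    by_cases hw : w = v
    · subst hw
      rw [Adele.sub_snd, Adele.single_snd_self, hvv, ← sub_add_sub_cancel _ (x : w.Completion)]
      refine (Valuation.map_add _ _ _).trans (max_le hx ?_)
      rw [hsub]
      exact (hres ⟨x, hx1⟩ _).1 (hl _).symm
    · rw [Adele.sub_snd, Adele.single_snd_of_ne hw, sub_zero, hvw w hw]
      exact ha w

end Index

/-! ### Discreteness and cocompactness -/

section Criteria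

variable [IsAdelic k]

theorem discreteTopology_principal_of_nhds {U : Set (Adele k)} (hU : U ∈ 𝓝 (0 : Adele k))
    (h : ∀ x : k, diag k x ∈ U → x = 0) : DiscreteTopology (principal k) := by
  refine discreteTopology_of_isOpen_singleton_zero ?_
  have : ({0} : Set (principal k)) = Subtype.val ⁻¹' interior U := by
    ext u
    rw [Set.mem_singleton_iff, Set.mem_preimage]
    constructor
    · rintro rfl
      exact mem_interior_iff_mem_nhds.2 hU
    · intro hu
      obtain ⟨x, hx⟩ := mem_principal.1 u.2
      have h0 := h x (by rw [hx]; exact interior_subset hu)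
      refine Subtype.ext ?_
      rw [← hx, h0, map_zero]
      rfl
  rw [this]
  exact isOpen_interior.preimage continuous_subtype_val

end Criteria

end GlobalAdele

namespace GlobalAdele

open Filter Topology IsDedekindDomain NumberField

/-! ### Number fields: discreteness and cocompactness -/

section NumberField

variable {k : Type*} [Field k] [NumberField k]

theorem FinitePlace.integralOn_ringOfIntegers (v : FinitePlace k) : v.IntegralOn (𝓞 k) := fun r =>
  FinitePlace.valuation_le_one_of_isIntegral (A := ℤ) (fun n => by
    rw [eq_intCast]
    exact intCast_mem v.1.valuationSubring n) r.2

variable (k) in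
theorem isAdelic_of_numberField : IsAdelic k where
  countable := (Module.finBasis ℚ k).equivFun.toEquiv.injective.countable
  infinite := inferInstance
  finite_infinitePlace := inferInstance
  finite_residueField v := (FinitePlace.integralOn_ringOfIntegers v).finite_residueField
  finite_ne_one _ hx := (finite_integralOn_ne_one (𝓞 k) hx).subset fun v hv =>
    ⟨FinitePlace.integralOn_ringOfIntegers v, hv⟩

theorem mem_ringOfIntegers_of_forall_le_one {x : k} (h : ∀ v : FinitePlace k, v.1 x ≤ 1) :
    ∃ r : 𝓞 k, (r : k) = x :=
  HeightOneSpectrum.mem_integers_of_valuation_le_one k x fun p => h (placeOfPrime k p)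

theorem norm_algebraMap_completion {k : Type*} [Field k] (w : InfinitePlace k) (x : k) :
    ‖algebraMap k w.Completion x‖ = w x :=
  InfinitePlace.Completion.norm_coe w ((WithAbs.equiv w.1).symm x)

/-- The vector is first replaced by a nearby element of `k`, by density, and then its coordinates in
an integral basis are rounded down. The fractional parts contribute at most the sum of the
`|b_i|_w`. -/
theorem exists_ringOfIntegers_norm_sub_le : ∃ C : ℝ, ∀ a : InfiniteAdeleRing k,
    ∃ r : 𝓞 k, ∀ w, ‖a w - algebraMap k w.Completion (r : k)‖ ≤ C := by
  let b := integralBasis k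
  let B : ℝ := ∑ i, ∑ w : InfinitePlace k, w (b i)
  refine ⟨1 + B, fun a => ?_⟩
  obtain ⟨x, hx⟩ : ∃ x : k, ∀ w, ‖a w - algebraMap k w.Completion x‖ < 1 := by
    have ho : {z : InfiniteAdeleRing k | ∀ w, ‖a w - z w‖ < 1} ∈ 𝓝 a := by
      have : ∀ w : InfinitePlace k, ∀ᶠ z : InfiniteAdeleRing k in 𝓝 a, ‖a w - z w‖ < 1 := by
        intro w
        have hc : Continuous fun z : InfiniteAdeleRing k => ‖a w - z w‖ :=
          (continuous_const.sub (continuous_apply w)).norm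
        have := hc.tendsto a
        simp only [sub_self, norm_zero] at this
        exact this.eventually_lt_const one_pos
      exact eventually_all.2 this
    obtain ⟨_, ⟨x, rfl⟩, hz⟩ := (InfiniteAdeleRing.denseRange_algebraMap k).inter_nhds_nonempty ho
    exact ⟨x, hz⟩
  let r : 𝓞 k := ∑ i, ⌊b.repr x i⌋ • RingOfIntegers.basis k i
  refine ⟨r, fun w => ?_⟩
  have h1 : x - (r : k) = ∑ i, ((Int.fract (b.repr x i) : ℚ)) • b i := by
    conv_lhs => rw [← b.sum_repr x]
    simp only [r, map_sum, map_zsmul]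
    rw [← Finset.sum_sub_distrib]
    refine Finset.sum_congr rfl fun i _ => ?_
    rw [← integralBasis_apply, ← Int.self_sub_floor, sub_smul, Int.cast_smul_eq_zsmul]
  have h2 : w (x - r) ≤ B := by
    rw [h1]
    refine (AbsoluteValue.sum_le w.1 _ _).trans (Finset.sum_le_sum fun i _ => ?_)
    have h3 : w ((Int.fract (b.repr x i) : ℚ) • b i) ≤ w (b i) := by
      rw [Rat.smul_def, map_mul, ← InfinitePlace.norm_embedding_eq w ((Int.fract (b.repr x i) : ℚ) : k),
        map_ratCast, Complex.norm_ratCast]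
      refine mul_le_of_le_one_left (apply_nonneg w _) ?_
      rw [abs_of_nonneg (by exact_mod_cast Int.fract_nonneg _)]
      exact_mod_cast (Int.fract_lt_one _).le
    refine h3.trans ?_
    exact Finset.single_le_sum (f := fun w : InfinitePlace k => w (b i))
      (fun w _ => apply_nonneg w _) (Finset.mem_univ w)
  have h3 : a w - algebraMap k w.Completion (r : k) =
      (a w - algebraMap k w.Completion x) + algebraMap k w.Completion (x - r) := by
    rw [map_sub]; ring
  rw [h3]
  refine (norm_add_le _ _).trans (add_le_add (hx w).le ?_)
  rwa [norm_algebraMap_completion]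

theorem norm_diag_fst {k : Type*} [Field k] [IsAdelic k] (x : k) (w : InfinitePlace k) :
    ‖(diag k x).1 w‖ = w x :=
  norm_algebraMap_completion w x

variable (k) in
theorem isCocompactAdelic_of_numberField : IsCocompactAdelic k := by
  have h := isAdelic_of_numberField k
  refine { h with nonempty_finitePlace := ?_, discreteTopology := ?_, cocompact := ?_ }
  · obtain ⟨p, hp0, hp⟩ :=
      Ring.not_isField_iff_exists_prime.1 (RingOfIntegers.not_isField k)
    exact ⟨placeOfPrime k ⟨p, hp, hp0⟩⟩
  · have hU : {a : Adele k | ∀ w, ‖a.1 w‖ < 1} ∩ (integralAdeles k : Set (Adele k)) ∈ 𝓝 0 := by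
      refine inter_mem ?_ (isOpen_integralAdeles.mem_nhds (zero_mem _))
      refine eventually_all.2 fun w => ?_
      have := (Adele.continuous_fst_apply w).norm.tendsto (0 : Adele k)
      simp only [Adele.zero_fst, norm_zero] at this
      exact this.eventually_lt_const one_pos
    refine discreteTopology_principal_of_nhds hU fun x hx => ?_
    obtain ⟨r, rfl⟩ := mem_ringOfIntegers_of_forall_le_one (x := x) fun v => by
      rw [← v.valued_coe]; exact hx.2 v
    by_contra h0
    have hr : r ≠ 0 := fun h => h0 (by rw [h]; rfl)
    obtain ⟨w⟩ := (inferInstance : Nonempty (InfinitePlace k))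
    have h1 : 1 ≤ w (r : k) := InfinitePlace.one_le_of_lt_one hr fun z _ => by
      rw [← norm_diag_fst]; exact hx.1 z
    have h2 := hx.1 w
    rw [norm_diag_fst] at h2
    linarith
  · obtain ⟨C, hC⟩ := exists_ringOfIntegers_norm_sub_le (k := k)
    refine ⟨1, C, fun a => ?_⟩
    obtain ⟨x, hx⟩ := exists_forall_valued_sub_le_one (𝓞 k) a
    obtain ⟨r, hr⟩ := hC (a - diag k x).1
    refine ⟨x + r, a - diag k (x + r), ⟨fun w => ?_, fun v => ?_⟩, by simp⟩
    · rw [map_add, ← sub_sub]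
      exact hr w
    · rw [map_add, ← sub_sub, Adele.sub_snd]
      refine (Valuation.map_sub _ _ _).trans
        (max_le (hx v (FinitePlace.integralOn_ringOfIntegers v)) ?_)
      rw [diag_snd, v.valued_coe]
      exact FinitePlace.integralOn_ringOfIntegers v r

end NumberField

end GlobalAdele

namespace GlobalAdele

open Filter Topology IsDedekindDomain NumberField

/-! ### Number fields: the standard character -/

section NumberField

variable {k : Type*} [Field k] [NumberField k]

/-- The trace is the sum over all complex embeddings; `w.mult` of them lie over `w`, and conjugate
embeddings have the same real part. -/
theorem sum_mult_mul_re_eq_trace (x : k) :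
    ∑ w : InfinitePlace k, (w.mult : ℝ) * (w.embedding x).re = (Algebra.trace ℚ k x : ℝ) := by
  classical
  have h1 : (algebraMap ℚ ℂ (Algebra.trace ℚ k x)).re = ∑ φ : k →+* ℂ, (φ x).re := by
    rw [trace_eq_sum_embeddings ℂ, Complex.re_sum]
    exact (Fintype.sum_equiv (RingHom.equivRatAlgHom k ℂ) _ _ fun φ => rfl).symm
  rw [eq_ratCast, Complex.ratCast_re] at h1
  rw [h1, ← Finset.sum_fiberwise Finset.univ (InfinitePlace.mk : (k →+* ℂ) → _)]
  refine Finset.sum_congr rfl fun w _ => ?_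
  rw [← InfinitePlace.card_filter_mk_eq w, ← nsmul_eq_mul, ← Finset.sum_const]
  refine Finset.sum_congr rfl fun φ hφ => ?_
  rw [Finset.mem_filter] at hφ
  rw [← hφ.2]
  rcases InfinitePlace.embedding_mk_eq φ with h | h
  · rw [h]
  · rw [h, ComplexEmbedding.conjugate_coe_eq, Complex.conj_re]

variable [IsCocompactAdelic k]

theorem archTrace_diag (x : k) : archTrace (diag k x).1 = (Algebra.trace ℚ k x : ℝ) := by
  rw [← sum_mult_mul_re_eq_trace, archTrace]
  refine Finset.sum_congr (by ext; simp) fun w _ => ?_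
  rw [diag_fst, InfinitePlace.Completion.extensionEmbedding_coe]
  rfl

theorem archTrace_add (a b : InfiniteAdeleRing k) :
    archTrace (a + b) = archTrace a + archTrace b := by
  rw [archTrace, archTrace, archTrace, ← Finset.sum_add_distrib]
  refine Finset.sum_congr rfl fun w _ => ?_
  have : (a + b) w = a w + b w := rfl
  rw [this, map_add, Complex.add_re, mul_add]

theorem continuous_archTrace : Continuous (archTrace (k := k)) := by
  refine continuous_finsetSum _ fun w _ => continuous_const.mul ?_
  exact Complex.continuous_re.comp
    ((InfinitePlace.Completion.isometry_extensionEmbedding w).continuous.comp (continuous_apply w))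

theorem exists_sub_diag_mem (a : Adele k) : ∃ x : k, a - diag k x ∈ integralAdeles k := by
  obtain ⟨x, hx⟩ := exists_forall_valued_sub_le_one (𝓞 k) a
  exact ⟨x, fun v => hx v (FinitePlace.integralOn_ringOfIntegers v)⟩

/-- The exponential `t ↦ exp(2π i t)` with values in the circle. -/
noncomputable def circleExp (t : ℝ) : Circle := Circle.exp (2 * Real.pi * t)

theorem circleExp_add (s t : ℝ) : circleExp (s + t) = circleExp s * circleExp t := by
  rw [circleExp, circleExp, circleExp, mul_add, Circle.exp_add]

theorem circleExp_eq_one_iff {t : ℝ} : circleExp t = 1 ↔ ∃ n : ℤ, t = n := by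
  rw [circleExp, Circle.exp_eq_one]
  have : (2 * Real.pi) ≠ 0 := by positivity
  refine exists_congr fun n => ?_
  rw [mul_comm (n : ℝ), mul_right_inj' this]

theorem circleExp_archTrace_integer (r : 𝓞 k) : circleExp (archTrace (diag k (r : k)).1) = 1 := by
  rw [circleExp_eq_one_iff, archTrace_diag]
  refine ⟨Algebra.trace ℤ (𝓞 k) r, ?_⟩
  rw [← Algebra.coe_trace_int]
  simp

/-- Two choices of `x` that make the finite part integral differ by an algebraic integer, whose
trace is an integer. This makes the standard character well defined. -/
theorem circleExp_archTrace_congr {a : Adele k} {x y : k} (hx : a - diag k x ∈ integralAdeles k)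
    (hy : a - diag k y ∈ integralAdeles k) :
    circleExp (archTrace (a - diag k x).1) = circleExp (archTrace (a - diag k y).1) := by
  obtain ⟨r, hr⟩ := mem_ringOfIntegers_of_forall_le_one (x := x - y) fun v => by
    have := sub_mem hy hx v
    rwa [sub_sub_sub_cancel_left, ← map_sub, diag_snd, v.valued_coe] at this
  have h1 : (a - diag k y).1 = (a - diag k x).1 + (diag k (r : k)).1 := by
    rw [hr]
    have : a - diag k y = a - diag k x + diag k (x - y) := by rw [map_sub]; abel
    rw [this]
    rfl
  rw [h1, archTrace_add, circleExp_add, circleExp_archTrace_integer, mul_one]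

variable (k) in
/-- The standard character of the adele class group of a number field. -/
noncomputable def standardCharacter : AddChar (Adele k) Circle where
  toFun a := circleExp (archTrace (a - diag k (exists_sub_diag_mem a).choose).1)
  map_zero_eq_one' := by
    rw [circleExp_archTrace_congr (exists_sub_diag_mem (0 : Adele k)).choose_spec
      (y := 0) (by simp)]
    simpa using circleExp_archTrace_integer (0 : 𝓞 k)
  map_add_eq_mul' a b := by
    rw [circleExp_archTrace_congr (exists_sub_diag_mem (a + b)).choose_spec
      (y := (exists_sub_diag_mem a).choose + (exists_sub_diag_mem b).choose) (by
        rw [map_add, add_sub_add_comm]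
        exact add_mem (exists_sub_diag_mem a).choose_spec (exists_sub_diag_mem b).choose_spec),
      map_add, add_sub_add_comm, ← circleExp_add]
    exact congrArg circleExp (archTrace_add _ _)

theorem standardCharacter_apply {a : Adele k} {x : k} (hx : a - diag k x ∈ integralAdeles k) :
    standardCharacter k a = circleExp (archTrace (a - diag k x).1) :=
  circleExp_archTrace_congr (exists_sub_diag_mem a).choose_spec hx

theorem standardCharacter_of_mem {a : Adele k} (ha : a ∈ integralAdeles k) :
    standardCharacter k a = circleExp (archTrace a.1) := by
  rw [standardCharacter_apply (x := 0) (by simpa using ha), map_zero, sub_zero]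

theorem continuous_standardCharacter : Continuous (standardCharacter k) := by
  rw [continuous_iff_continuousAt]
  intro a
  obtain ⟨x, hx⟩ := exists_sub_diag_mem a
  have hc : Continuous fun b : Adele k => circleExp (archTrace (b - diag k x).1) := by
    refine Circle.exp.continuous.comp (continuous_const.mul ?_)
    exact continuous_archTrace.comp (Adele.continuous_fst.comp (continuous_id.sub continuous_const))
  refine hc.continuousAt.congr ?_
  have ho : IsOpen ((fun b : Adele k => b - diag k x) ⁻¹' (integralAdeles k : Set (Adele k))) :=
    isOpen_integralAdeles.preimage (continuous_id.sub continuous_const)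
  filter_upwards [ho.mem_nhds hx] with b hb
  exact (standardCharacter_apply hb).symm

theorem standardCharacter_principal {a : Adele k} (ha : a ∈ principal k) :
    standardCharacter k a = 1 := by
  obtain ⟨x, rfl⟩ := mem_principal.1 ha
  rw [standardCharacter_apply (x := x) (by simp), sub_self]
  simpa using circleExp_archTrace_integer (0 : 𝓞 k)

theorem standardCharacter_infinite {a : Adele k} (ha : ∀ v, a.2 v = 0) :
    ((standardCharacter k a : Circle) : ℂ) =
      Complex.exp (2 * Real.pi * Complex.I * archTrace a.1) := by
  rw [standardCharacter_of_mem fun v => by rw [ha, map_zero]; exact zero_le, circleExp, Circle.coe_exp]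
  congr 1
  push_cast
  ring

theorem standardCharacter_ne_one : standardCharacter k ≠ 1 := by
  intro h
  have hd : (Module.finrank ℚ k : ℚ) ≠ 0 := by exact_mod_cast Module.finrank_pos.ne'
  -- Scaling by the inverse of the degree makes the trace of the archimedean part equal to `1 / 2`,
  -- so the character takes the value `-1`.
  let a : Adele k := Adele.mk (diag k (algebraMap ℚ k (1 / 2 * (Module.finrank ℚ k : ℚ)⁻¹))).1 0 (by simp)
  have ha : a ∈ integralAdeles k := fun v => by
    change Valued.v (0 : v.Completion) ≤ 1
    simp
  have h1 : standardCharacter k a = 1 := by rw [h]; rfl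
  rw [standardCharacter_of_mem ha] at h1
  have h2 : archTrace a.1 = (1 / 2 : ℚ) := by
    refine (archTrace_diag _).trans ?_
    rw [Algebra.trace_algebraMap, nsmul_eq_mul]
    congr 1
    field_simp
  rw [h2, circleExp_eq_one_iff] at h1
  obtain ⟨n, hn⟩ := h1
  have h3 : ((2 * n : ℤ) : ℝ) = (1 : ℤ) := by push_cast; push_cast at hn; linarith
  have h4 : 2 * n = 1 := by exact_mod_cast h3
  omega

end NumberField

end GlobalAdele

namespace GlobalAdele

open Filter Topology IsDedekindDomain NumberField

/-! ### Number fields: the different -/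

section Compare

theorem exists_forall_mem_ge (s : Finset ℤ) : ∃ M, ∀ i ∈ s, M ≤ i :=
  ⟨_, fun _ hi => s.bddBelow.some_mem hi⟩

variable {k : Type*} [Field k] (R : Type*) [CommRing R] [IsDedekindDomain R] [Algebra R k]
  [IsFractionRing R k]

include R in
/-- Exponents of integral divisors are determined by the corresponding fractional ideals. -/
theorem le_of_forall_valuation_le (hR : ∀ v : FinitePlace k, v.IntegralOn R) {A B : FinitePlace k → ℤ}
    (hA : (Function.support A).Finite) (h : ∀ y : k, (∀ v : FinitePlace k, v.1 y ≤ WithZero.exp (A v)) →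
      ∀ v : FinitePlace k, v.1 y ≤ WithZero.exp (B v)) (v : FinitePlace k) : A v ≤ B v := by
  classical
  let S : Set (FinitePlace k) := insert v (Function.support A)
  have hS : S.Finite := hA.insert v
  obtain ⟨M, hM⟩ := exists_forall_mem_ge (hS.toFinset.image A)
  have hM' : ∀ w ∈ S, M ≤ A w := fun w hw =>
    hM _ (Finset.mem_image_of_mem _ (hS.mem_toFinset.2 hw))
  obtain ⟨c, hc0, hc⟩ := v.exists_valuation_eq_exp (A v)
  -- This `x` has order exactly that allowed by `A` at `v` and satisfies the bounds elsewhere. The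
  -- precision `M - 1` is strictly finer than `A v`, so `x` inherits the valuation of `c`.
  obtain ⟨x, h1, h2⟩ := exists_forall_valuation_sub_le R hS (fun w _ => hR w)
    (fun w => if w = v then c else 0) (M - 1)
  have hx : v.1 x = WithZero.exp (A v) := by
    have h3 := h1 v (Set.mem_insert _ _)
    rw [if_pos rfl] at h3
    have h4 : v.1 (x - c) < v.1 c := by
      rw [hc]
      refine h3.trans_lt (WithZero.exp_lt_exp.2 ?_)
      have := hM' v (Set.mem_insert _ _)
      omega
    rw [← hc, ← Valuation.map_add_eq_of_lt_left v.1 h4, add_sub_cancel]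
  have h5 := h x (fun w => ?_) v
  · rwa [hx, WithZero.exp_le_exp] at h5
  · by_cases hwv : w = v
    · subst hwv; exact hx.le
    by_cases hw : w ∈ S
    · have h3 := h1 w hw
      rw [if_neg hwv, sub_zero] at h3
      refine h3.trans (WithZero.exp_le_exp.2 ?_)
      have := hM' w hw
      omega
    · have h0 : A w = 0 := by
        by_contra h0
        exact hw (Set.mem_insert_of_mem _ h0)
      rw [h0, WithZero.exp_zero]
      exact h2 w (hR w) hw

end Compare

section NumberField

variable {k : Type*} [Field k] [NumberField k]

/-- The exponent of the different at a place. -/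
noncomputable def differentExponent (v : FinitePlace k) : ℤ :=
  sInf {n : ℤ | ∃ d : 𝓞 k, d ∈ differentIdeal ℤ (𝓞 k) ∧ d ≠ 0 ∧ n = -WithZero.log (v.1 (d : k))}

theorem differentIdeal_ne_bot' : differentIdeal ℤ (𝓞 k) ≠ ⊥ := differentIdeal_ne_bot

theorem valuation_ringOfIntegers (v : FinitePlace k) {d : 𝓞 k} (hd : d ≠ 0) :
    v.1 (d : k) = WithZero.exp (WithZero.log (v.1 (d : k))) :=
  (WithZero.exp_log ((Valuation.ne_zero_iff _).2 (by simpa using hd))).symm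

theorem log_valuation_nonpos (v : FinitePlace k) {d : 𝓞 k} (hd : d ≠ 0) :
    WithZero.log (v.1 (d : k)) ≤ 0 := by
  rw [← WithZero.exp_le_exp, ← valuation_ringOfIntegers v hd, WithZero.exp_zero]
  exact FinitePlace.integralOn_ringOfIntegers v d

theorem differentExponent_bddBelow (v : FinitePlace k) : BddBelow {n : ℤ | ∃ d : 𝓞 k,
    d ∈ differentIdeal ℤ (𝓞 k) ∧ d ≠ 0 ∧ n = -WithZero.log (v.1 (d : k))} := by
  refine ⟨0, ?_⟩
  rintro n ⟨d, _, hd0, rfl⟩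
  have := log_valuation_nonpos v hd0
  omega

theorem exists_valuation_eq_differentExponent (v : FinitePlace k) :
    ∃ d : 𝓞 k, d ∈ differentIdeal ℤ (𝓞 k) ∧ d ≠ 0 ∧
      v.1 (d : k) = WithZero.exp (-differentExponent v) := by
  obtain ⟨d, hd, hd0⟩ := Submodule.exists_mem_ne_zero_of_ne_bot (differentIdeal_ne_bot' (k := k))
  obtain ⟨d, hd, hd0, h⟩ := Int.csInf_mem (s := {n : ℤ | ∃ d : 𝓞 k,
    d ∈ differentIdeal ℤ (𝓞 k) ∧ d ≠ 0 ∧ n = -WithZero.log (v.1 (d : k))})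
    ⟨_, d, hd, hd0, rfl⟩ (differentExponent_bddBelow v)
  refine ⟨d, hd, hd0, ?_⟩
  rw [differentExponent, h, neg_neg]
  exact valuation_ringOfIntegers v hd0

theorem valuation_le_of_mem_differentIdeal (v : FinitePlace k) {d : 𝓞 k}
    (hd : d ∈ differentIdeal ℤ (𝓞 k)) : v.1 (d : k) ≤ WithZero.exp (-differentExponent v) := by
  rcases eq_or_ne d 0 with rfl | hd0
  · simp
  · rw [valuation_ringOfIntegers v hd0, WithZero.exp_le_exp]
    have := csInf_le (differentExponent_bddBelow v) ⟨d, hd, hd0, rfl⟩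
    change differentExponent v ≤ _ at this
    omega

theorem differentExponent_nonneg (v : FinitePlace k) : 0 ≤ differentExponent v := by
  obtain ⟨d, _, hd0, h⟩ := exists_valuation_eq_differentExponent v
  have := FinitePlace.integralOn_ringOfIntegers v d
  have h' : v.1 (d : k) ≤ 1 := this
  rw [h, ← WithZero.exp_zero, WithZero.exp_le_exp] at h'
  omega

theorem finite_support_differentExponent :
    (Function.support (differentExponent (k := k))).Finite := by
  obtain ⟨d, hd, hd0⟩ := Submodule.exists_mem_ne_zero_of_ne_bot (differentIdeal_ne_bot' (k := k))
  refine (finite_integralOn_ne_one (𝓞 k) (x := (d : k)) (by simpa using hd0)).subset fun v hv =>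
    ⟨FinitePlace.integralOn_ringOfIntegers v, fun h => hv ?_⟩
  have h1 := valuation_le_of_mem_differentIdeal v hd
  rw [h, ← WithZero.exp_zero, WithZero.exp_le_exp] at h1
  have := differentExponent_nonneg v
  omega

open nonZeroDivisors in
theorem mem_dual_iff_trace (y : k) : y ∈ FractionalIdeal.dual ℤ ℚ (1 : FractionalIdeal (𝓞 k)⁰ k) ↔
    ∀ r : 𝓞 k, ∃ n : ℤ, Algebra.trace ℚ k (y * r) = n := by
  rw [FractionalIdeal.mem_dual (one_ne_zero' (FractionalIdeal (𝓞 k)⁰ k))]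
  constructor
  · intro h r
    obtain ⟨n, hn⟩ := h r (FractionalIdeal.coe_mem_one _ r)
    exact ⟨n, by rw [← Algebra.traceForm_apply, ← hn]; simp⟩
  · rintro h a ha
    obtain ⟨r, rfl⟩ := (FractionalIdeal.mem_one_iff _).1 ha
    obtain ⟨n, hn⟩ := h r
    exact ⟨n, by rw [Algebra.traceForm_apply, hn]; simp⟩

open nonZeroDivisors in
-- The trace dual is the inverse of the different, so membership means that `y d` is integral for
-- all `d` in the different. At each place it suffices to test a `d` of minimal order.
theorem mem_dual_iff_valuation (y : k) :
    y ∈ FractionalIdeal.dual ℤ ℚ (1 : FractionalIdeal (𝓞 k)⁰ k) ↔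
    ∀ v : FinitePlace k, v.1 y ≤ WithZero.exp (differentExponent v) := by
  have h1 : FractionalIdeal.dual ℤ ℚ (1 : FractionalIdeal (𝓞 k)⁰ k) =
      ((differentIdeal ℤ (𝓞 k) : FractionalIdeal (𝓞 k)⁰ k))⁻¹ := by
    rw [coeIdeal_differentIdeal ℤ ℚ k (𝓞 k), inv_inv]
  rw [h1, FractionalIdeal.mem_inv_iff (by
    rw [Ne, FractionalIdeal.coeIdeal_eq_zero]; exact differentIdeal_ne_bot')]
  constructor
  · intro h v
    obtain ⟨d, hd, hd0, hv⟩ := exists_valuation_eq_differentExponent v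
    obtain ⟨r, hr⟩ := (FractionalIdeal.mem_one_iff _).1
      (h (d : k) (FractionalIdeal.mem_coeIdeal_of_mem _ hd))
    have h2 := FinitePlace.integralOn_ringOfIntegers v r
    rw [hr, map_mul, hv, WithZero.exp_neg] at h2
    have := mul_inv_le_iff₀ (WithZero.exp_pos (a := differentExponent v)) (b := v.1 y) (a := 1)
    rw [this, one_mul] at h2
    exact h2
  · intro h z hz
    obtain ⟨d, hd, rfl⟩ := (FractionalIdeal.mem_coeIdeal _).1 hz
    obtain ⟨r, hr⟩ := mem_ringOfIntegers_of_forall_le_one (x := y * (d : k)) fun v => by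
      rw [map_mul, ← WithZero.exp_zero, ← add_neg_cancel (differentExponent v), WithZero.exp_add]
      exact mul_le_mul' (h v) (valuation_le_of_mem_differentIdeal v hd)
    exact (FractionalIdeal.mem_one_iff _).2 ⟨r, hr⟩

open nonZeroDivisors in
-- For the converse, the different is the inverse of the dual, whose elements are already described
-- by their valuations.
theorem mem_differentIdeal_iff (r : 𝓞 k) : r ∈ differentIdeal ℤ (𝓞 k) ↔
    ∀ v : FinitePlace k, v.1 (r : k) ≤ WithZero.exp (-differentExponent v) := by
  refine ⟨fun h v => valuation_le_of_mem_differentIdeal v h, fun h => ?_⟩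
  have h1 : (r : k) ∈ (differentIdeal ℤ (𝓞 k) : FractionalIdeal (𝓞 k)⁰ k) := by
    rw [coeIdeal_differentIdeal ℤ ℚ k (𝓞 k),
      FractionalIdeal.mem_inv_iff (FractionalIdeal.dual_ne_zero _ _ (one_ne_zero' (FractionalIdeal (𝓞 k)⁰ k)))]
    intro y hy
    rw [mem_dual_iff_valuation] at hy
    obtain ⟨s, hs⟩ := mem_ringOfIntegers_of_forall_le_one (x := (r : k) * y) fun v => by
      rw [map_mul, ← WithZero.exp_zero, ← neg_add_cancel (differentExponent v), WithZero.exp_add]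
      exact mul_le_mul' (h v) (hy v)
    exact (FractionalIdeal.mem_one_iff _).2 ⟨s, hs⟩
  obtain ⟨d, hd, hdr⟩ := (FractionalIdeal.mem_coeIdeal _).1 h1
  rwa [← RingOfIntegers.ext hdr]

variable [IsCocompactAdelic k]

/-- The finite part of a principal adele. -/
noncomputable def diagFinite (x : k) : Adele k := diag k x - Adele.mk (diag k x).1 0 (by simp)

theorem diagFinite_fst (x : k) : (diagFinite x).1 = 0 := funext fun _ => sub_self _

theorem diagFinite_snd (x : k) (v : FinitePlace k) : (diagFinite x).2 v = (x : v.Completion) :=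
  sub_zero _

/-- The character is trivial on `x` as a whole, so on the finite part of `x` it is inverse to its
value `exp (2πi Tr x)` on the archimedean part. -/
theorem standardCharacter_diagFinite (x : k) :
    standardCharacter k (diagFinite x) = 1 ↔ ∃ n : ℤ, Algebra.trace ℚ k x = n := by
  rw [diagFinite, AddChar.map_sub_eq_div, standardCharacter_principal (diag_mem_principal x),
    one_div, inv_eq_one, standardCharacter_of_mem (fun v => by
      change Valued.v (0 : v.Completion) ≤ 1
      simp), circleExp_eq_one_iff]
  have : archTrace (Adele.mk (k := k) (diag k x).1 0 (by simp)).1 = (Algebra.trace ℚ k x : ℝ) :=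
    archTrace_diag x
  rw [this]
  exact exists_congr fun n => by norm_cast

/-- The left side says that `ψ` is trivial on the finite parts of `y 𝓞`. By strong approximation, a
local element `z ∈ y O_v` differs from such a finite part by an adele so small that `ψ` ignores it.
Conversely, `ψ` on a finite part is controlled by its local components. -/
theorem trace_iff_conductorExponent (y : k) : (∀ r : 𝓞 k, ∃ n : ℤ, Algebra.trace ℚ k (y * r) = n) ↔
    ∀ v : FinitePlace k, v.1 y ≤ WithZero.exp (conductorExponent (standardCharacter k) v) := by
  classical
  have hc := continuous_standardCharacter (k := k)
  have hk := fun a (ha : a ∈ principal k) => standardCharacter_principal ha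
  have hψ := standardCharacter_ne_one (k := k)
  simp only [← standardCharacter_diagFinite]
  constructor
  · intro h v
    rcases eq_or_ne y 0 with rfl | hy
    · simp
    obtain ⟨m, hm⟩ := WithZero.exists_exp_eq ((Valuation.ne_zero_iff v.1).2 hy)
    rw [hm, WithZero.exp_le_exp, ← character_single_iff hc hk hψ]
    intro z hz
    obtain ⟨S, n, hS⟩ := exists_box_character_eq_one hc
    let S' : Finset (FinitePlace k) := insert v (S ∪ (IsAdelic.finite_ne_one y hy).toFinset)
    -- The precision `M` is chosen so that errors of size `exp M`, after multiplication by `y`,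
    -- still lie in the box on which `ψ` is trivial. `S'` also contains the places where `y` is not
    -- a unit.
    obtain ⟨M, hM⟩ := exists_forall_mem_ge
      (insert 0 (S'.image fun w => min n 0 - WithZero.log (w.1 y)))
    have hM0 : M ≤ 0 := hM 0 (Finset.mem_insert_self _ _)
    have hMS : ∀ w ∈ S', w.1 y * WithZero.exp M ≤ WithZero.exp (min n 0) := by
      intro w hw
      have h1 := hM _ (Finset.mem_insert_of_mem (Finset.mem_image_of_mem _ hw))
      rw [← WithZero.exp_log ((Valuation.ne_zero_iff w.1).2 hy), ← WithZero.exp_add,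
        WithZero.exp_le_exp]
      omega
    have hyv : (y : v.Completion) ≠ 0 := fun h0 => hy (v.coeHom.injective (h0.trans (map_zero _).symm))
    obtain ⟨c, hcz⟩ := v.exists_valued_sub_le (z / (y : v.Completion)) M
    obtain ⟨x, h1, h2⟩ := exists_forall_valuation_sub_le (𝓞 k) (S := (S' : Set (FinitePlace k)))
      S'.finite_toSet (fun w _ => FinitePlace.integralOn_ringOfIntegers w)
      (fun w => if w = v then c else 0) M
    have hzy : Valued.v (z / (y : v.Completion)) ≤ 1 := by
      rw [map_div₀, v.valued_coe, hm]
      exact div_le_one_of_le₀ hz zero_le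
    have hexpM : WithZero.exp M ≤ 1 := by rwa [← WithZero.exp_zero, WithZero.exp_le_exp]
    have hv : Valued.v (z / (y : v.Completion) - (x : v.Completion)) ≤ WithZero.exp M := by
      have h3 := h1 v (Finset.mem_insert_self _ _)
      rw [if_pos rfl, ← v.valued_coe] at h3
      have h4 : ((x - c : k) : v.Completion) = (x : v.Completion) - (c : v.Completion) :=
        map_sub v.coeHom x c
      rw [h4] at h3
      have h5 := (Valuation.map_sub (Valued.v) _ _).trans (max_le hcz h3)
      rwa [sub_sub_sub_cancel_right] at h5
    have hw : ∀ w ∈ S', w ≠ v → w.1 x ≤ WithZero.exp M := by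
      intro w hw hne
      have h3 := h1 w hw
      rwa [if_neg hne, sub_zero] at h3
    obtain ⟨r, rfl⟩ := mem_ringOfIntegers_of_forall_le_one (x := x) fun w => by
      by_cases hwv : w = v
      · subst hwv
        rw [← w.valued_coe, ← sub_sub_cancel (z / (y : w.Completion)) (x : w.Completion)]
        exact (Valuation.map_sub _ _ _).trans (max_le hzy (hv.trans hexpM))
      · by_cases hwS : w ∈ S'
        · exact (hw w hwS hwv).trans hexpM
        · exact h2 w (FinitePlace.integralOn_ringOfIntegers w) hwS
    have hbox : ∀ w, Valued.v ((Adele.single v z - diagFinite (y * r)).2 w) ≤ 1 ∧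
        (w ∈ S' → Valued.v ((Adele.single v z - diagFinite (y * r)).2 w) ≤ WithZero.exp (min n 0)) := by
      intro w
      have hmul : ((y * r : k) : w.Completion) = (y : w.Completion) * ((r : k) : w.Completion) :=
        map_mul w.coeHom y r
      have hexp : WithZero.exp (min n 0) ≤ 1 := by
        rw [← WithZero.exp_zero, WithZero.exp_le_exp]; omega
      rw [Adele.sub_snd, diagFinite_snd, hmul]
      by_cases hwv : w = v
      · subst hwv
        rw [Adele.single_snd_self]
        have h6 : Valued.v (z - (y : w.Completion) * ((r : k) : w.Completion)) ≤
            WithZero.exp (min n 0) := by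
          have : z - (y : w.Completion) * ((r : k) : w.Completion) =
              (y : w.Completion) * (z / (y : w.Completion) - ((r : k) : w.Completion)) := by
            field_simp
          rw [this, map_mul, w.valued_coe]
          exact (mul_le_mul' le_rfl hv).trans (hMS w (Finset.mem_insert_self _ _))
        exact ⟨h6.trans hexp, fun _ => h6⟩
      · rw [Adele.single_snd_of_ne hwv, zero_sub, Valuation.map_neg, map_mul, w.valued_coe,
          w.valued_coe]
        by_cases hwS : w ∈ S'
        · have h6 := (mul_le_mul' le_rfl (hw w hwS hwv)).trans (hMS w hwS)
          exact ⟨h6.trans hexp, fun _ => h6⟩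
        · refine ⟨?_, fun h => absurd h hwS⟩
          have h7 : w.1 y = 1 := by
            by_contra h7
            exact hwS (Finset.mem_insert_of_mem (Finset.mem_union_right _
              ((Set.Finite.mem_toFinset _).2 h7)))
          rw [h7, one_mul]
          exact FinitePlace.integralOn_ringOfIntegers w r
    have h8 := hS (Adele.single v z - diagFinite (y * r)) (by
        funext w
        rw [Adele.sub_fst, diagFinite_fst]
        exact sub_self _) (fun w => (hbox w).1) fun w hw =>
      ((hbox w).2 (Finset.mem_insert_of_mem (Finset.mem_union_left _ hw))).trans
        (WithZero.exp_le_exp.2 (min_le_left _ _))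
    rwa [AddChar.map_sub_eq_div, h r, div_one] at h8
  · intro h r
    refine character_eq_one_of_single hc (diagFinite_fst _) fun v => ?_
    rw [diagFinite_snd]
    refine (character_single_iff hc hk hψ v _).2 le_rfl _ ?_
    rw [v.valued_coe, map_mul]
    exact (mul_le_of_le_one_right' (FinitePlace.integralOn_ringOfIntegers v r)).trans (h v)

/-- Both exponents cut out the trace dual of the integers, and a finitely supported exponent is
determined by its fractional ideal. -/
theorem conductorExponent_standardCharacter (v : FinitePlace k) :
    conductorExponent (standardCharacter k) v = differentExponent v := by
  have h : ∀ y : k, (∀ v : FinitePlace k, v.1 y ≤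
      WithZero.exp (conductorExponent (standardCharacter k) v)) ↔
      ∀ v : FinitePlace k, v.1 y ≤ WithZero.exp (differentExponent v) := fun y => by
    rw [← trace_iff_conductorExponent, ← mem_dual_iff_trace, mem_dual_iff_valuation]
  exact le_antisymm
    (le_of_forall_valuation_le (𝓞 k) FinitePlace.integralOn_ringOfIntegers
      (finite_support_conductorExponent continuous_standardCharacter
        (fun _ => standardCharacter_principal) standardCharacter_ne_one) (fun y => (h y).1) v)
    (le_of_forall_valuation_le (𝓞 k) FinitePlace.integralOn_ringOfIntegers
      finite_support_differentExponent (fun y => (h y).2) v)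

theorem characterDivisor_standardCharacter :
    characterDivisor (standardCharacter k) = numberFieldDivisor k := by
  refine RepleteDivisor.ext (funext fun v => ?_) rfl
  rw [characterDivisor_finite, conductorExponent_standardCharacter]
  rfl

/-- The module of an idele whose divisor is that of the different. -/
theorem ideleModule_numberField {κ : (Adele k)ˣ} (hκ : ideleDivisor κ = numberFieldDivisor k) :
    ideleModule κ = |(discr k : ℝ)|⁻¹ := by
  have hv : ∀ v, Valued.v ((κ : Adele k).2 v) = WithZero.exp (-differentExponent v) := fun v => by
    rw [valued_idele, hκ]; rfl
  have hle : ∀ v : FinitePlace k, WithZero.exp (-differentExponent v) ≤ 1 := fun v => by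
    rw [← WithZero.exp_zero, WithZero.exp_le_exp]
    have := differentExponent_nonneg v
    omega
  have hfin : Finite (𝓞 k ⧸ differentIdeal ℤ (𝓞 k)) :=
    Ring.HasFiniteQuotients.finiteQuotient differentIdeal_ne_bot'
  have hsub : ∀ (v : FinitePlace k) (x y : k),
      Valued.v ((x : v.Completion) - (y : v.Completion)) = v.1 (x - y) := by
    intro v x y
    rw [← v.valued_coe]
    exact congrArg _ (map_sub v.coeHom x y).symm
  -- The index is computed with representatives of `𝓞` modulo the different; strong approximation
  -- shows that they meet every coset of integral adeles.
  have h := ideleModule_mul_card (β := κ) (fun w => by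
      rw [← ideleDivisor_infinite_eq_zero_iff, hκ]; rfl)
    (T := 𝓞 k ⧸ differentIdeal ℤ (𝓞 k)) (fun t => diagFinite (t.out : k)) (fun t => diagFinite_fst _)
    (fun t v y hy => by
      rw [diagFinite_snd]
      rw [hv] at hy
      refine (Valuation.map_add _ _ _).trans (max_le ?_ (hy.trans (hle v)))
      rw [v.valued_coe]
      exact FinitePlace.integralOn_ringOfIntegers v _)
    (fun t t' htt' => by
      rw [← Ideal.Quotient.mk_out t, ← Ideal.Quotient.mk_out t', Ideal.Quotient.eq,
        mem_differentIdeal_iff]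
      intro v
      have := htt' v
      rwa [Adele.sub_snd, diagFinite_snd, diagFinite_snd, hv, hsub] at this)
    (fun a ha => by
      obtain ⟨M, hM⟩ := exists_forall_mem_ge (insert 0 (finite_support_differentExponent.toFinset.image
        fun v : FinitePlace k => -differentExponent v))
      choose y hy using fun v : FinitePlace k => v.exists_valued_sub_le (a.2 v) M
      obtain ⟨x, h1, h2⟩ := exists_forall_valuation_sub_le (𝓞 k)
        finite_support_differentExponent (fun v _ => FinitePlace.integralOn_ringOfIntegers v) y M
      have hax : ∀ v, Valued.v (a.2 v - (x : v.Completion)) ≤ WithZero.exp (-differentExponent v) := by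
        intro v
        by_cases hvs : v ∈ Function.support (differentExponent (k := k))
        · have h3 := h1 v hvs
          rw [← hsub] at h3
          have h5 := (Valuation.map_sub (Valued.v) _ _).trans (max_le (hy v) h3)
          rw [sub_sub_sub_cancel_right] at h5
          refine h5.trans (WithZero.exp_le_exp.2 (hM _ (Finset.mem_insert_of_mem
            (Finset.mem_image_of_mem _ ((Set.Finite.mem_toFinset _).2 hvs)))))
        · have h3 : differentExponent v = 0 := by
            by_contra h3
            exact hvs h3
          rw [h3, neg_zero, WithZero.exp_zero]
          refine (Valuation.map_sub _ _ _).trans (max_le (ha v) ?_)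
          rw [v.valued_coe]
          exact h2 v (FinitePlace.integralOn_ringOfIntegers v) hvs
      obtain ⟨r, rfl⟩ := mem_ringOfIntegers_of_forall_le_one (x := x) fun v => by
        rw [← v.valued_coe, ← sub_sub_cancel (a.2 v) (x : v.Completion)]
        exact (Valuation.map_sub _ _ _).trans (max_le (ha v) ((hax v).trans (hle v)))
      refine ⟨Ideal.Quotient.mk _ r, fun v => ?_⟩
      rw [Adele.sub_snd, diagFinite_snd, hv, ← sub_add_sub_cancel _ ((r : k) : v.Completion)]
      refine (Valuation.map_add _ _ _).trans (max_le (hax v) ?_)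
      rw [hsub]
      have hmem : r - (Ideal.Quotient.mk (differentIdeal ℤ (𝓞 k)) r).out ∈
          differentIdeal ℤ (𝓞 k) := by
        rw [← Ideal.Quotient.eq, Ideal.Quotient.mk_out]
      exact (mem_differentIdeal_iff _).1 hmem v)
  have h9 : Nat.card (𝓞 k ⧸ differentIdeal ℤ (𝓞 k)) = (discr k).natAbs :=
    absNorm_differentIdeal k (𝓞 k)
  rw [h9, Nat.cast_natAbs, Int.cast_abs] at h
  exact eq_inv_of_mul_eq_one_left h

end NumberField

end GlobalAdele

namespace GlobalAdele

open IsDedekindDomain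

open scoped IntermediateField.algebraAdjoinAdjoin

/-! ### Function fields in one variable -/

section FunctionField

variable {k : Type*} [Field k] (F : Type*) [Field F] [Algebra F k]

/-- `t` is a separating element of `k / F`: `k` is a finite separable extension of `F(t)`, and `t` is
transcendental. -/
structure IsSeparatingElement (t : k) : Prop where
  transcendental : Transcendental F t
  finiteDimensional : FiniteDimensional (IntermediateField.adjoin F {t}) k
  isSeparable : Algebra.IsSeparable (IntermediateField.adjoin F {t}) k

variable {F}

theorem adjoin_singleton_inv (t : k) :
    IntermediateField.adjoin F {t⁻¹} = IntermediateField.adjoin F {t} := by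
  refine le_antisymm ?_ ?_ <;> rw [IntermediateField.adjoin_simple_le_iff]
  · exact inv_mem (IntermediateField.mem_adjoin_simple_self F t)
  · rw [← inv_inv t]
    exact inv_mem (by simpa using IntermediateField.mem_adjoin_simple_self F t⁻¹)

theorem IsSeparatingElement.inv {t : k} (ht : IsSeparatingElement F t) : IsSeparatingElement F t⁻¹ where
  transcendental h := ht.transcendental (by simpa using h.inv)
  finiteDimensional := by rw [adjoin_singleton_inv]; exact ht.finiteDimensional
  isSeparable := by rw [adjoin_singleton_inv]; exact ht.isSeparable

/-- Over a perfect field a finitely generated extension has a separating transcendence basis. It has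
one element because `{t}` is also a transcendence basis, and finite generation makes the remaining
algebraic extension finite. -/
theorem exists_isSeparatingElement [PerfectField F] {t : k} (ht : Transcendental F t)
    (hfin : FiniteDimensional (IntermediateField.adjoin F {t}) k) : ∃ t : k, IsSeparatingElement F t := by
  have h1 : Algebra.EssFiniteType F (IntermediateField.adjoin F {t}) :=
    IntermediateField.essFiniteType_iff.2 ⟨{t}, by simp⟩
  have h2 : Algebra.EssFiniteType F k :=
    Algebra.EssFiniteType.comp F (IntermediateField.adjoin F {t}) k
  have h3 : IsTranscendenceBasis F fun _ : PUnit.{1} => t := by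
    rw [isTranscendenceBasis_iff_algebraicIndependent_isAlgebraic]
    refine ⟨algebraicIndependent_unique_type_iff.2 ht, ?_⟩
    rw [Set.range_const]
    exact Algebra.IsAlgebraic.trans (Algebra.adjoin F {t}) (IntermediateField.adjoin F {t}) k
  obtain ⟨s, hs, hsep⟩ := exists_isTranscendenceBasis_and_isSeparable_of_perfectField F k
  have hcard := h3.lift_cardinalMk_eq hs
  have hs1 : s.card = 1 := by
    simp only [Cardinal.mk_fintype, Fintype.card_coe, Cardinal.lift_natCast, Fintype.card_punit] at hcard
    exact_mod_cast hcard.symm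
  obtain ⟨u, rfl⟩ := Finset.card_eq_one.1 hs1
  rw [Finset.coe_singleton] at hsep
  refine ⟨u, ?_, ?_, hsep⟩
  · have h4 := hs.1
    exact (algebraicIndependent_singleton_iff (ι := ({u} : Finset k)) ⟨u, by simp⟩).1 h4
  · have h5 : Algebra.EssFiniteType (IntermediateField.adjoin F {u}) k := Algebra.EssFiniteType.of_comp F _ k
    exact Algebra.finite_of_essFiniteType_of_isAlgebraic

theorem hasFiniteQuotients_polynomial [Finite F] : Ring.HasFiniteQuotients (Polynomial F) where
  finiteQuotient {I} hI := by
    obtain ⟨p, hpI, hp⟩ := Submodule.exists_mem_ne_zero_of_ne_bot hI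
    have hfin : Finite (Polynomial.degreeLT F p.natDegree) :=
      Finite.of_equiv _ (Polynomial.degreeLTEquiv F p.natDegree).symm.toEquiv
    refine Finite.of_surjective
      (fun r : Polynomial.degreeLT F p.natDegree => Ideal.Quotient.mk I r.1) fun x => ?_
    obtain ⟨f, rfl⟩ := Ideal.Quotient.mk_surjective x
    refine ⟨⟨f % p, ?_⟩, ?_⟩
    · rw [Polynomial.mem_degreeLT, ← Polynomial.degree_eq_natDegree hp]
      exact EuclideanDomain.mod_lt f hp
    · refine (Ideal.Quotient.eq.2 ?_)
      have : f % p - f = -(p * (f / p)) := by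
        have := EuclideanDomain.div_add_mod f p
        linear_combination this
      change f % p - f ∈ I
      rw [this]
      exact I.neg_mem (I.mul_mem_right _ hpI)

theorem hasFiniteQuotients_of_surjective {R S : Type*} [CommRing R] [CommRing S]
    [Ring.HasFiniteQuotients R] {f : R →+* S} (hf : Function.Surjective f) :
    Ring.HasFiniteQuotients S where
  finiteQuotient {I} hI := by
    have : Finite (R ⧸ I.comap f) := Ring.HasFiniteQuotients.finiteQuotient fun h => hI (by
      rw [← Ideal.map_comap_of_surjective f hf I, h, Ideal.map_bot])
    exact Finite.of_surjective (Ideal.quotientMap I f le_rfl) (Ideal.quotientMap_surjective hf)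

section Adjoin

variable (F) (t : k)

/-- The evaluation of polynomials at `t`. -/
noncomputable def evalAdjoin : Polynomial F →ₐ[F] Algebra.adjoin F {t} :=
  Polynomial.aeval ⟨t, Algebra.self_mem_adjoin_singleton F t⟩

theorem coe_evalAdjoin (p : Polynomial F) : (evalAdjoin F t p : k) = Polynomial.aeval t p := by
  rw [evalAdjoin, ← Subalgebra.coe_val, ← Polynomial.aeval_algHom_apply]
  rfl

theorem evalAdjoin_surjective : Function.Surjective (evalAdjoin F t) := by
  rintro ⟨x, hx⟩
  obtain ⟨p, rfl⟩ : x ∈ (Polynomial.aeval t : Polynomial F →ₐ[F] k).range := by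
    rwa [← Algebra.adjoin_singleton_eq_range_aeval]
  exact ⟨p, Subtype.ext (coe_evalAdjoin F t p)⟩

instance : IsPrincipalIdealRing (Algebra.adjoin F {t}) :=
  IsPrincipalIdealRing.of_surjective (evalAdjoin F t).toRingHom (evalAdjoin_surjective F t)

instance [Finite F] : Ring.HasFiniteQuotients (Algebra.adjoin F {t}) :=
  haveI := hasFiniteQuotients_polynomial (F := F)
  hasFiniteQuotients_of_surjective (f := (evalAdjoin F t).toRingHom) (evalAdjoin_surjective F t)

instance [Countable F] : Countable (Algebra.adjoin F {t}) :=
  haveI : Countable (Polynomial F) :=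
    (Polynomial.basisMonomials F).repr.toEquiv.injective.countable
  (evalAdjoin_surjective F t).countable

/-- The ring of elements integral over `F[t]`. -/
abbrev integralRing : Subalgebra (Algebra.adjoin F {t}) k := integralClosure (Algebra.adjoin F {t}) k

end Adjoin

variable {t : k} (ht : IsSeparatingElement F t)

include ht

theorem IsSeparatingElement.isDedekindDomain : IsDedekindDomain (integralRing F t) :=
  haveI := ht.finiteDimensional
  haveI := ht.isSeparable
  integralClosure.isDedekindDomain (Algebra.adjoin F {t}) (IntermediateField.adjoin F {t}) k

theorem IsSeparatingElement.isFractionRing : IsFractionRing (integralRing F t) k :=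
  haveI := ht.finiteDimensional
  IsIntegralClosure.isFractionRing_of_finite_extension (Algebra.adjoin F {t})
    (IntermediateField.adjoin F {t}) k (integralRing F t)

theorem IsSeparatingElement.module_finite : Module.Finite (Algebra.adjoin F {t}) (integralRing F t) :=
  haveI := ht.finiteDimensional
  haveI := ht.isSeparable
  IsIntegralClosure.finite (Algebra.adjoin F {t}) (IntermediateField.adjoin F {t}) k (integralRing F t)

theorem IsSeparatingElement.hasFiniteQuotients [Finite F] : Ring.HasFiniteQuotients (integralRing F t) :=
  haveI := ht.module_finite
  Ring.HasFiniteQuotients.of_module_finite (Algebra.adjoin F {t}) (integralRing F t)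

end FunctionField

end GlobalAdele

/-! ### Places of a function field and vanishing at infinity -/

namespace GlobalAdele

open IsDedekindDomain

open scoped IntermediateField.algebraAdjoinAdjoin

section FunctionField

variable {k : Type*} [Field k] {F : Type*} [Field F] [Finite F] [Algebra F k]

theorem FinitePlace.valuation_evalAdjoin_le_one {v : FinitePlace k} {t : k} (hv : v.1 t ≤ 1)
    (a : Algebra.adjoin F {t}) : v.1 (a : k) ≤ 1 := by
  obtain ⟨p, rfl⟩ := evalAdjoin_surjective F t a
  rw [coe_evalAdjoin, Polynomial.aeval_eq_sum_range]
  refine Valuation.map_sum_le _ fun i _ => ?_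
  rw [Algebra.smul_def, map_mul, map_pow]
  exact mul_le_one' (Valuation.IsTrivialOn.valuation_algebraMap_le_one v.1 _) (pow_le_one' hv _)

theorem FinitePlace.integralOn_integralRing {v : FinitePlace k} {t : k} (hv : v.1 t ≤ 1) :
    v.IntegralOn (integralRing F t) := fun r =>
  FinitePlace.valuation_le_one_of_isIntegral (A := Algebra.adjoin F {t})
    (v.valuation_evalAdjoin_le_one hv) r.2

theorem isEmpty_infinitePlace (k F : Type*) [Field k] [Field F] [Finite F] [Algebra F k] : IsEmpty (NumberField.InfinitePlace k) := by
  refine ⟨fun w => ?_⟩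
  have h1 : ((Nat.card F : ℕ) : F) = 0 := by
    have := Fintype.ofFinite F
    rw [Nat.card_eq_fintype_card, Nat.cast_card_eq_zero]
  have h2 : ((Nat.card F : ℕ) : ℂ) = 0 := by
    rw [← map_natCast (w.embedding.comp (algebraMap F k)), h1, map_zero]
  exact Nat.card_pos.ne' (Nat.cast_eq_zero.1 h2)

variable (F) in
-- The two affine charts of the curve, where `t` respectively `t⁻¹` is regular, cover all places.
theorem FinitePlace.integralOn_integralRing_or (v : FinitePlace k) (t : k) :
    v.IntegralOn (integralRing F t) ∨ v.IntegralOn (integralRing F t⁻¹) := by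
  rcases le_total (v.1 t) 1 with h | h
  · exact Or.inl (FinitePlace.integralOn_integralRing h)
  · refine Or.inr (FinitePlace.integralOn_integralRing ?_)
    rw [map_inv₀]
    exact inv_le_one_of_one_le₀ h

/-- The norm is integral over the integrally closed ring `F[s]`. The field `L` is kept as a variable
so that `t` and `t⁻¹`, which generate the same field, give norms that can be compared directly. -/
theorem norm_mem_adjoin {L : IntermediateField F k} {s : k} (hL : L = IntermediateField.adjoin F {s})
    (hs : IsSeparatingElement F s)
    {x : k} (hx : IsIntegral (Algebra.adjoin F {s}) x) : (Algebra.norm L x : k) ∈ Algebra.adjoin F {s} := by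
  subst hL
  have := hs.finiteDimensional
  have h1 : IsIntegral (Algebra.adjoin F {s}) (Algebra.norm (IntermediateField.adjoin F {s}) x) :=
    Algebra.isIntegral_norm _ hx
  obtain ⟨a, ha⟩ := IsIntegrallyClosed.isIntegral_iff.1 h1
  rw [← ha]
  exact a.2

variable {t : k} (ht : IsSeparatingElement F t)

include ht

theorem IsSeparatingElement.ne_zero : t ≠ 0 := by
  rintro rfl
  exact ht.transcendental isAlgebraic_zero

theorem IsSeparatingElement.isAdelic : IsAdelic k where
  countable := by
    have := ht.module_finite
    have := ht.isFractionRing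
    have : Countable (integralRing F t) := by
      obtain ⟨n, f, hf⟩ := Module.Finite.exists_fin' (Algebra.adjoin F {t}) (integralRing F t)
      exact hf.countable
    refine Function.Surjective.countable
      (f := fun p : integralRing F t × integralRing F t => (p.1 / p.2 : k)) fun x => ?_
    obtain ⟨a, b, -, h⟩ := IsFractionRing.div_surjective (A := integralRing F t) x
    exact ⟨(a, b), h⟩
  infinite := Infinite.of_injective _ (transcendental_iff_injective.1 ht.transcendental)
  finite_infinitePlace := by
    have := isEmpty_infinitePlace k F
    infer_instance
  finite_residueField v := by
    rcases v.integralOn_integralRing_or F t with h | h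
    · have := ht.isDedekindDomain
      have := ht.isFractionRing
      have := ht.hasFiniteQuotients
      exact h.finite_residueField
    · have := ht.inv.isDedekindDomain
      have := ht.inv.isFractionRing
      have := ht.inv.hasFiniteQuotients
      exact h.finite_residueField
  finite_ne_one x hx := by
    have := ht.isDedekindDomain
    have := ht.isFractionRing
    have := ht.inv.isDedekindDomain
    have := ht.inv.isFractionRing
    refine ((finite_integralOn_ne_one (integralRing F t) hx).union
      (finite_integralOn_ne_one (integralRing F t⁻¹) hx)).subset fun v hv => ?_
    exact (v.integralOn_integralRing_or F t).imp (fun h => ⟨h, hv⟩) fun h => ⟨h, hv⟩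

/-- An element integral over `F[t]` that vanishes at infinity is zero. -/
theorem IsSeparatingElement.eq_zero_of_isIntegral {x : k} (h1 : IsIntegral (Algebra.adjoin F {t}) x)
    (h2 : IsIntegral (Algebra.adjoin F {t⁻¹}) (t * x)) : x = 0 := by
  have := ht.finiteDimensional
  let L := IntermediateField.adjoin F {t}
  let n := Module.finrank L k
  have hn : 0 < n := Module.finrank_pos
  have h3 := norm_mem_adjoin rfl ht h1
  have h4 := norm_mem_adjoin (adjoin_singleton_inv t).symm ht.inv h2
  have h5 : (Algebra.norm L (t * x) : k) = t ^ n * (Algebra.norm L x : k) := by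
    have : t * x = algebraMap L k (IntermediateField.AdjoinSimple.gen F t) * x := rfl
    rw [this, map_mul, Algebra.norm_algebraMap]
    rfl
  obtain ⟨p, hp⟩ : (Algebra.norm L x : k) ∈ (Polynomial.aeval t : Polynomial F →ₐ[F] k).range := by
    rwa [← Algebra.adjoin_singleton_eq_range_aeval]
  obtain ⟨q, hq⟩ : (Algebra.norm L (t * x) : k) ∈
      (Polynomial.aeval t⁻¹ : Polynomial F →ₐ[F] k).range := by
    rwa [← Algebra.adjoin_singleton_eq_range_aeval]
  have hN : Algebra.norm L x = 0 := by
    by_contra h0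
    have hp0 : p ≠ 0 := by
      rintro rfl
      exact h0 (Subtype.ext (by rw [← hp]; simp))
    -- With `N(x) = p(t)` and `N(t x) = t ^ n p(t) = q(t⁻¹)`, clearing denominators gives `X ^ (n +
    -- deg q) p = q.reverse`. As `n > 0` and `p ≠ 0`, the left side has too large a degree.
    have h6 : Polynomial.aeval t (Polynomial.X ^ (n + q.natDegree) * p - q.reverse) = 0 := by
      have h7 : Polynomial.aeval t q.reverse = t ^ q.natDegree * Polynomial.aeval t⁻¹ q := by
        let := invertibleOfNonzero (inv_ne_zero ht.ne_zero)
        have h := Polynomial.eval₂_reverse_mul_pow (algebraMap F k) t⁻¹ q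
        rw [Polynomial.aeval_def, Polynomial.aeval_def, ← h, invOf_eq_inv, inv_inv, inv_pow,
          mul_comm _ (t ^ _)⁻¹, mul_inv_cancel_left₀ (pow_ne_zero _ ht.ne_zero)]
      rw [map_sub, h7]
      change _ - _ * (Polynomial.aeval t⁻¹ : Polynomial F →ₐ[F] k).toRingHom q = 0
      rw [map_mul, map_pow, Polynomial.aeval_X]
      change _ * (Polynomial.aeval t : Polynomial F →ₐ[F] k).toRingHom p - _ = 0
      rw [hp, hq, h5, pow_add]
      ring
    have h8 := sub_eq_zero.1 (transcendental_iff.1 ht.transcendental _ h6)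
    have h9 := congrArg Polynomial.natDegree h8
    rw [Polynomial.natDegree_X_pow_mul _ hp0] at h9
    have := Polynomial.reverse_natDegree_le q
    omega
  exact Algebra.norm_eq_zero_iff.1 hN

end FunctionField

end GlobalAdele

/-! ### Function fields: discreteness and cocompactness -/

namespace GlobalAdele

open IsDedekindDomain

open scoped IntermediateField.algebraAdjoinAdjoin

section FunctionField

variable {k : Type*} [Field k] {F : Type*} [Field F] [Finite F] [Algebra F k]

/-- Division with remainder splits a rational function into a polynomial and a proper fraction. At a
pole of `t` the valuation of a polynomial in `t` depends only on its degree, so the proper fraction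
is integral there. -/
theorem exists_forall_valuation_sub_aeval_le_one {t c : k} (hc : c ∈ IntermediateField.adjoin F {t}) :
    ∃ p : Polynomial F, ∀ v : FinitePlace k, 1 < v.1 t → v.1 (c - Polynomial.aeval t p) ≤ 1 := by
  obtain ⟨n, d, rfl⟩ := (IntermediateField.mem_adjoin_simple_iff F c).1 hc
  by_cases hd : Polynomial.aeval t d = 0
  · exact ⟨0, fun v _ => by simp [hd]⟩
  refine ⟨n / d, fun v hv => ?_⟩
  have hd0 : d ≠ 0 := by rintro rfl; simp at hd
  have h1 : Polynomial.aeval t n / Polynomial.aeval t d - Polynomial.aeval t (n / d) =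
      Polynomial.aeval t (n % d) / Polynomial.aeval t d := by
    rw [div_sub' hd, ← map_mul, ← map_sub]
    congr 2
    linear_combination -(EuclideanDomain.div_add_mod n d)
  rw [h1]
  by_cases hm : n % d = 0
  · simp [hm]
  rw [map_div₀, Polynomial.valuation_aeval_eq_valuation_X_pow_natDegree_of_one_lt_valuation_X t hv hm,
    Polynomial.valuation_aeval_eq_valuation_X_pow_natDegree_of_one_lt_valuation_X t hv hd0]
  refine div_le_one_of_le₀ (pow_le_pow_right₀ hv.le ?_) zero_le
  exact Polynomial.natDegree_le_natDegree (EuclideanDomain.mod_lt n hd0).le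

variable {t : k} (ht : IsSeparatingElement F t)

include ht

/-- The analogue of rounding in an integral basis: removing the polynomial part of each coordinate
leaves coefficients integral at the poles of `t`, so the error is bounded by the basis elements at
these finitely many places. -/
theorem IsSeparatingElement.exists_integral_sub_le : ∃ C : ℤ, 0 ≤ C ∧ ∀ y : k,
    ∃ r : integralRing F t, ∀ v : FinitePlace k, 1 < v.1 t → v.1 (y - r) ≤ WithZero.exp C := by
  classical
  have := ht.isAdelic
  have := ht.finiteDimensional
  have hS : {v : FinitePlace k | 1 < v.1 t}.Finite :=
    (IsAdelic.finite_ne_one t ht.ne_zero).subset fun v hv => ne_of_gt hv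
  obtain ⟨s, b, hb⟩ := FiniteDimensional.exists_is_basis_integral (Algebra.adjoin F {t})
    (IntermediateField.adjoin F {t}) k
  obtain ⟨M, hM⟩ := (insert 1 ((hS.toFinset ×ˢ (Finset.univ : Finset s)).image
    fun p => p.1.1 (b p.2))).exists_le
  have hM1 : 1 ≤ M := hM _ (Finset.mem_insert_self _ _)
  obtain ⟨C, rfl⟩ := WithZero.exists_exp_eq (zero_lt_one.trans_le hM1).ne'
  refine ⟨C, by rwa [← WithZero.exp_zero, WithZero.exp_le_exp] at hM1, fun y => ?_⟩
  choose p hp using fun i => exists_forall_valuation_sub_aeval_le_one (b.repr y i).2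
  have hint : IsIntegral (Algebra.adjoin F {t}) (∑ i, Polynomial.aeval t (p i) * b i) := by
    refine IsIntegral.sum _ fun i _ => IsIntegral.mul ?_ (hb i)
    rw [← coe_evalAdjoin]
    exact isIntegral_algebraMap (R := Algebra.adjoin F {t}) (A := k)
  refine ⟨⟨_, hint⟩, fun v hv => ?_⟩
  have h1 : y - ∑ i, Polynomial.aeval t (p i) * b i =
      ∑ i, ((b.repr y i : k) - Polynomial.aeval t (p i)) * b i := by
    conv_lhs => rw [← b.sum_repr y]
    rw [← Finset.sum_sub_distrib]
    refine Finset.sum_congr rfl fun i _ => ?_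
    rw [sub_mul]
    rfl
  change v.1 (y - ∑ i, Polynomial.aeval t (p i) * b i) ≤ _
  rw [h1]
  refine Valuation.map_sum_le _ fun i _ => ?_
  rw [map_mul]
  refine (mul_le_of_le_one_left' (hp i v hv)).trans (hM _ (Finset.mem_insert_of_mem
    (Finset.mem_image.2 ⟨(v, i), Finset.mem_product.2 ⟨hS.mem_toFinset.2 hv, Finset.mem_univ _⟩, rfl⟩)))

theorem IsSeparatingElement.mem_integralRing {x : k} (hx : ∀ v : FinitePlace k, v.1 x ≤ 1) :
    IsIntegral (Algebra.adjoin F {t}) x := by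
  have := ht.isDedekindDomain
  have := ht.isFractionRing
  obtain ⟨r, rfl⟩ := HeightOneSpectrum.mem_integers_of_valuation_le_one (R := integralRing F t) k x
    fun p => hx (placeOfPrime k p)
  exact r.2

/-- If the integral closure of `F[t]` were a field, it would contain `t⁻¹`; as `t · t⁻¹ = 1` is
integral over `F[t⁻¹]`, the vanishing lemma would give `t⁻¹ = 0`. -/
theorem IsSeparatingElement.nonempty_finitePlace : Nonempty (FinitePlace k) := by
  have := ht.isDedekindDomain
  have := ht.isFractionRing
  have hR : ¬ IsField (integralRing F t) := by
    intro h
    have h1 : IsIntegral (Algebra.adjoin F {t}) t :=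
      isIntegral_algebraMap (R := Algebra.adjoin F {t}) (A := k)
        (x := ⟨t, Algebra.self_mem_adjoin_singleton F t⟩)
    obtain ⟨b, hb⟩ := h.mul_inv_cancel (a := ⟨t, h1⟩) fun h0 => ht.ne_zero (congrArg Subtype.val h0)
    have hb' : t * (b : k) = 1 := congrArg Subtype.val hb
    have h2 := ht.eq_zero_of_isIntegral b.2 (by rw [hb']; exact isIntegral_one)
    rw [h2, mul_zero] at hb'
    exact zero_ne_one hb'
  obtain ⟨p, hp0, hp⟩ := Ring.not_isField_iff_exists_prime.1 hR
  exact ⟨placeOfPrime k ⟨p, hp, hp0⟩⟩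

theorem IsSeparatingElement.isCocompactAdelic : IsCocompactAdelic k := by
  have h := ht.isAdelic
  have hinf := isEmpty_infinitePlace k F
  refine { h with
    nonempty_finitePlace := ht.nonempty_finitePlace, discreteTopology := ?_, cocompact := ?_ }
  · have hU : (integralAdeles k : Set (Adele k)) ∩ (fun a => diag k t * a) ⁻¹' integralAdeles k ∈
        nhds (0 : Adele k) := by
      refine Filter.inter_mem (isOpen_integralAdeles.mem_nhds (zero_mem _)) ?_
      refine (isOpen_integralAdeles.preimage (continuous_const_mul (diag k t))).mem_nhds ?_
      change diag k t * 0 ∈ integralAdeles k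
      rw [mul_zero]
      exact zero_mem _
    refine discreteTopology_principal_of_nhds hU fun x hx => ?_
    refine ht.eq_zero_of_isIntegral (ht.mem_integralRing fun v => ?_)
      (ht.inv.mem_integralRing fun v => ?_)
    · rw [← v.valued_coe]
      exact hx.1 v
    · rw [← v.valued_coe]
      have h1 := hx.2
      rw [Set.mem_preimage, ← map_mul] at h1
      exact h1 v
  · classical
    obtain ⟨C, hC0, hC⟩ := ht.exists_integral_sub_le
    have hS : {v : FinitePlace k | 1 < v.1 t}.Finite :=
      (IsAdelic.finite_ne_one t ht.ne_zero).subset fun v hv => ne_of_gt hv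
    -- The idele `α` allows poles of order at most `C` at the poles of `t`.
    obtain ⟨α, -, hα⟩ := exists_idele (k := k) (fun v => if 1 < v.1 t then C else 0)
      (hS.subset fun v hv => by
        by_contra h
        exact hv (if_neg h))
    have := ht.isDedekindDomain
    have := ht.isFractionRing
    have := ht.inv.isDedekindDomain
    have := ht.inv.isFractionRing
    refine ⟨α, 0, fun a => ?_⟩
    -- Subtracting `x` makes `a` integral where `t` is, and `y` would correct the poles of `t`. Its
    -- replacement `r` is integral over `F[t]`, so it does not spoil the first chart and costs only
    -- the bounded error `C` at the poles of `t`.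
    obtain ⟨x, hx⟩ := exists_forall_valued_sub_le_one (integralRing F t) a
    obtain ⟨y, hy⟩ := exists_forall_valued_sub_le_one (integralRing F t⁻¹) (a - diag k x)
    obtain ⟨r, hr⟩ := hC y
    refine ⟨x + r, ((α⁻¹ : (Adele k)ˣ) : Adele k) * (a - diag k (x + r)),
      ⟨fun w => isEmptyElim w, ?_⟩, by rw [Units.mul_inv_cancel_left]; abel⟩
    change _ ∈ integralAdeles k
    rw [idele_mul_mem_integralAdeles_iff]
    intro v
    rw [hα, map_add, ← sub_sub, Adele.sub_snd, diag_snd]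
    beta_reduce
    split_ifs with hv
    · have h1 : (a - diag k x).2 v - ((r : k) : v.Completion) =
          ((a - diag k x).2 v - (y : v.Completion)) + ((y - r : k) : v.Completion) := by
        have : ((y - r : k) : v.Completion) = (y : v.Completion) - ((r : k) : v.Completion) :=
          map_sub v.coeHom y r
        rw [this]
        abel
      rw [h1]
      refine (Valuation.map_add _ _ _).trans (max_le ((hy v ?_).trans ?_) ?_)
      · refine FinitePlace.integralOn_integralRing ?_
        rw [map_inv₀]
        exact inv_le_one_of_one_le₀ hv.le
      · rwa [← WithZero.exp_zero, WithZero.exp_le_exp]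
      · rw [v.valued_coe]
        exact hr v hv
    · rw [WithZero.exp_zero]
      have hv' := FinitePlace.integralOn_integralRing (F := F) (not_lt.1 hv)
      refine (Valuation.map_sub _ _ _).trans (max_le (hx v hv') ?_)
      rw [v.valued_coe]
      exact hv' r

end FunctionField

end GlobalAdele

namespace GlobalAdele

/-! ### Existence of characters -/

/-- The quotient by an open subgroup of a compact group is finite and discrete, and characters of a
finite abelian group separate points. -/
theorem exists_addChar_of_isOpen {G : Type*} [AddCommGroup G] [TopologicalSpace G]
    [IsTopologicalAddGroup G] [CompactSpace G] {H : AddSubgroup G} (hH : IsOpen (H : Set G)) {g : G}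
    (hg : g ∉ H) : ∃ ψ : AddChar G Circle, Continuous ψ ∧ ψ g ≠ 1 := by
  have := AddSubgroup.quotient_finite_of_isOpen H hH
  have hg' : (QuotientAddGroup.mk' H g) ≠ 0 := fun h => hg ((QuotientAddGroup.eq_zero_iff g).1 h)
  obtain ⟨χ, hχ⟩ := AddChar.exists_apply_ne_zero.2 hg'
  let χ' : AddChar (G ⧸ H) Circle := AddChar.circleEquivComplex.symm χ
  refine ⟨χ'.compAddMonoidHom (QuotientAddGroup.mk' H), ?_, fun h => hχ ?_⟩
  · have := QuotientAddGroup.discreteTopology hH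
    exact (continuous_of_discreteTopology (f := χ')).comp QuotientAddGroup.continuous_mk
  · have h1 : AddChar.circleEquivComplex χ' = χ := AddEquiv.apply_symm_apply _ _
    rw [← h1]
    exact congrArg (fun z : Circle => (z : ℂ)) h

section FunctionField

variable {k : Type*} [Field k] [IsCocompactAdelic k]

/-- The subgroup `α O` of the adele ring, where `O` is the group of integral adeles. -/
noncomputable def ideleLattice (α : (Adele k)ˣ) : AddSubgroup (Adele k) :=
  (integralAdeles k).comap (AddMonoidHom.mulLeft ((α⁻¹ : (Adele k)ˣ) : Adele k))

theorem mem_ideleLattice {α : (Adele k)ˣ} {u : Adele k} :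
    u ∈ ideleLattice α ↔ ∀ v, Valued.v (u.2 v) ≤ WithZero.exp ((ideleDivisor α).finite v) :=
  idele_mul_mem_integralAdeles_iff α u

theorem isOpen_ideleLattice (α : (Adele k)ˣ) : IsOpen (ideleLattice α : Set (Adele k)) :=
  isOpen_integralAdeles.preimage (continuous_const_mul ((α⁻¹ : (Adele k)ˣ) : Adele k))

/-- Without archimedean places every neighbourhood of zero contains some `α O`, so discreteness of
`k` gives one that meets `k` only in `0`. It yields both a non-trivial character and a divisor with
`ℓ = 0`. -/
theorem exists_ideleLattice_inf_principal [IsEmpty (NumberField.InfinitePlace k)] :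
    ∃ α : (Adele k)ˣ, ∀ x ∈ principal k, x ∈ ideleLattice α → x = 0 := by
  classical
  obtain ⟨U, hU, hU0⟩ : ∃ U ∈ nhds (0 : Adele k), ∀ x ∈ principal k, x ∈ U → x = 0 := by
    have h1 : ({0} : Set (principal k)) ∈ nhds (0 : principal k) := by simp [nhds_discrete]
    rw [nhds_subtype_eq_comap, Filter.mem_comap] at h1
    obtain ⟨U, hU, h⟩ := h1
    exact ⟨U, hU, fun x hx hxU => congrArg Subtype.val (@h ⟨x, hx⟩ hxU)⟩
  obtain ⟨ε, -, S, n, h⟩ := Adele.exists_box_subset hU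
  obtain ⟨α, -, hα⟩ := exists_idele (k := k) (fun v => if v ∈ S then min n 0 else 0)
    (S.finite_toSet.subset fun v hv => by
      by_contra h
      exact hv (if_neg h))
  refine ⟨α, fun x hx hxα => hU0 x hx (h x (fun w => isEmptyElim w) (fun v => ?_) fun v hv => ?_)⟩
  · refine (mem_ideleLattice.1 hxα v).trans ?_
    rw [hα, ← WithZero.exp_zero, WithZero.exp_le_exp]
    beta_reduce
    split_ifs
    exacts [min_le_right _ _, le_rfl]
  · refine (mem_ideleLattice.1 hxα v).trans ?_
    rw [hα, WithZero.exp_le_exp]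
    beta_reduce
    rw [if_pos hv]
    exact min_le_left _ _

variable (k) in
theorem exists_character [IsEmpty (NumberField.InfinitePlace k)] :
    ∃ ψ : AddChar (Adele k) Circle, Continuous ψ ∧ ψ ≠ 1 ∧ ∀ a ∈ principal k, ψ a = 1 := by
  classical
  obtain ⟨α, hα⟩ := exists_ideleLattice_inf_principal (k := k)
  obtain ⟨v₀⟩ := IsCocompactAdelic.nonempty_finitePlace (k := k)
  -- Shrinking `α O` at one place excludes `α` itself. Since `α O` meets `k` trivially, `α` stays
  -- outside `β O` modulo `k`, so a character of `𝔸/k` detects it.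
  obtain ⟨β, -, hβ⟩ := exists_idele (k := k) (fun v => (ideleDivisor α).finite v - if v = v₀ then 1 else 0)
    (((finite_support_ideleDivisor α).union (Set.finite_singleton v₀)).subset fun v hv => by
      by_contra h
      rw [Set.mem_union, not_or, Function.notMem_support, Set.mem_singleton_iff] at h
      exact hv (by simp [h.1, h.2]))
  have hle : ideleLattice β ≤ ideleLattice α := fun u hu => mem_ideleLattice.2 fun v => by
    refine (mem_ideleLattice.1 hu v).trans ?_
    rw [hβ, WithZero.exp_le_exp]
    beta_reduce
    split_ifs <;> omega
  have hαα : (α : Adele k) ∈ ideleLattice α := mem_ideleLattice.2 fun v => (valued_idele α v).le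
  have hαβ : (α : Adele k) ∉ ideleLattice β := fun h => by
    have h1 := mem_ideleLattice.1 h v₀
    rw [valued_idele, hβ, WithZero.exp_le_exp] at h1
    beta_reduce at h1
    rw [if_pos rfl] at h1
    omega
  have hopen : IsOpen (((ideleLattice β).map (toAdeleQuotient k) : AddSubgroup (AdeleQuotient k)) :
      Set (AdeleQuotient k)) :=
    isLatticeQuotient_adele.isOpenQuotientMap.isOpenMap _ (isOpen_ideleLattice β)
  obtain ⟨ψ, hψ, hψ1⟩ := exists_addChar_of_isOpen hopen (g := toAdeleQuotient k α) (by
    rintro ⟨u, hu, hq⟩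
    have h1 : -u + (α : Adele k) ∈ principal k := QuotientAddGroup.eq.1 hq
    have h2 := hα _ h1 (add_mem (neg_mem (hle hu)) hαα)
    rw [neg_add_eq_zero] at h2
    exact hαβ (h2 ▸ hu))
  refine ⟨ψ.compAddMonoidHom (toAdeleQuotient k),
    hψ.comp isLatticeQuotient_adele.isOpenQuotientMap.continuous, fun h => hψ1 ?_, fun a ha => ?_⟩
  · exact DFunLike.congr_fun h (α : Adele k)
  · have : toAdeleQuotient k a = 0 := (QuotientAddGroup.eq_zero_iff a).2 ha
    rw [AddChar.compAddMonoidHom_apply, this, AddChar.map_zero_eq_one]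

end FunctionField

end GlobalAdele

namespace GlobalAdele

/-! ### Degrees and dimensions over a function field -/

section FunctionField

variable {k : Type*} [Field k] [IsCocompactAdelic k] [IsEmpty (NumberField.InfinitePlace k)]

theorem ideleFunction_eq_indicator (α : (Adele k)ˣ) :
    ideleFunction α = Set.indicator (ideleLattice α : Set (Adele k)) 1 := by
  classical
  funext u
  rw [ideleFunction_apply]
  by_cases hu : u ∈ ideleLattice α
  · refine (adelicGaussian_of_mem 1 hu).trans ?_
    rw [Set.indicator_of_mem hu]
    simp [archNormSq]
  · exact (adelicGaussian_of_notMem 1 hu).trans (Set.indicator_of_notMem hu _).symm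

variable (F : Subfield k) [Finite F]

theorem diag_mem_ideleLattice_iff {α : (Adele k)ˣ} {x : k} :
    diag k x ∈ ideleLattice α ↔ x ∈ riemannRochSpace F (ideleDivisor α).finite := by
  rw [mem_ideleLattice]
  refine forall_congr' fun v => ?_
  rw [diag_snd, v.valued_coe]

/-- A summable indicator function has finite support in `k`. -/
theorem finite_riemannRochSpace (α : (Adele k)ˣ) :
    Finite (riemannRochSpace F (ideleDivisor α).finite) := by
  have h1 := (summable_ideleFunction α 0).tendsto_cofinite_zero
  have h2 : ∀ᶠ u : principal k in Filter.cofinite, ideleFunction α (0 + (u : Adele k)) < 1 :=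
    h1.eventually_lt_const one_pos
  have h3 : ((principalEquiv (k := k)) ⁻¹'
      {u : principal k | ¬ ideleFunction α (0 + (u : Adele k)) < 1}).Finite :=
    Set.Finite.preimage (principalEquiv (k := k)).injective.injOn h2
  refine (h3.subset fun x hx => ?_ :
    (riemannRochSpace F (ideleDivisor α).finite : Set k).Finite).to_subtype
  have h4 := (diag_mem_ideleLattice_iff F).2 hx
  rw [Set.mem_preimage, Set.mem_ofPred_eq, zero_add, coe_principalEquiv, ideleFunction_eq_indicator,
    Set.indicator_of_mem h4]
  simp

theorem expH0_eq_card (α : (Adele k)ˣ) :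
    expH0 α = Nat.card (riemannRochSpace F (ideleDivisor α).finite) := by
  have := finite_riemannRochSpace F α
  have := Fintype.ofFinite (riemannRochSpace F (ideleDivisor α).finite)
  rw [expH0, ← (principalEquiv (k := k)).toEquiv.tsum_eq]
  have h1 : ∀ x : k, ideleFunction α ((principalEquiv (k := k)).toEquiv x : Adele k) =
      Set.indicator (riemannRochSpace F (ideleDivisor α).finite : Set k) (fun _ => (1 : ℝ)) x := by
    intro x
    have h2 : ((principalEquiv (k := k)).toEquiv x : Adele k) = diag k x := coe_principalEquiv x
    rw [h2, ideleFunction_eq_indicator]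
    by_cases hx : x ∈ riemannRochSpace F (ideleDivisor α).finite
    · rw [Set.indicator_of_mem ((diag_mem_ideleLattice_iff F).2 hx), Set.indicator_of_mem (by exact hx)]
      rfl
    · rw [Set.indicator_of_notMem (fun h => hx ((diag_mem_ideleLattice_iff F).1 h)),
        Set.indicator_of_notMem (by exact hx)]
  simp_rw [h1]
  rw [← tsum_subtype]
  change ∑' _ : riemannRochSpace F (ideleDivisor α).finite, (1 : ℝ) = _
  rw [tsum_fintype, Finset.sum_const, Nat.card_eq_fintype_card, Finset.card_univ, nsmul_one]

theorem h0_eq_ell_mul_log (α : (Adele k)ˣ) :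
    h0 α = ell F (ideleDivisor α).finite * Real.log (Nat.card F) := by
  have := finite_riemannRochSpace F α
  rw [h0, expH0_eq_card F, Module.natCard_eq_pow_finrank (K := F), Nat.cast_pow, Real.log_pow, ell]

theorem card_residueField (v : FinitePlace k) :
    Nat.card (IsLocalRing.ResidueField v.1.valuationSubring) = Nat.card F ^ v.degree F := by
  let := ((IsLocalRing.residue v.1.valuationSubring).comp (v.constants F)).toAlgebra
  have := IsAdelic.finite_residueField v
  exact Module.natCard_eq_pow_finrank

theorem divisorDegree_add (f g : FinitePlace k →₀ ℤ) :
    divisorDegree F (f + g) = divisorDegree F f + divisorDegree F g := by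
  have h : ∀ f : FinitePlace k →₀ ℤ, (Function.support fun v => f v * (v.degree F : ℤ)).Finite :=
    fun f => f.hasFiniteSupport.subset fun v hv hv' => hv (by simp [hv'])
  rw [divisorDegree, divisorDegree, divisorDegree, ← finsum_add_distrib (h f) (h g)]
  refine finsum_congr fun v => ?_
  rw [Pi.add_apply, add_mul]

theorem divisorDegree_neg (f : FinitePlace k → ℤ) : divisorDegree F (-f) = -divisorDegree F f := by
  rw [divisorDegree, divisorDegree, ← finsum_neg_distrib]
  refine finsum_congr fun v => ?_
  rw [Pi.neg_apply, neg_mul]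

theorem ideleDivisor_mul (α β : (Adele k)ˣ) :
    (ideleDivisor (α * β)).finite = (ideleDivisor α).finite + (ideleDivisor β).finite :=
  funext fun v => ideleDivisor_mul_finite α β v

theorem ideleDivisor_inv (α : (Adele k)ˣ) :
    (ideleDivisor α⁻¹).finite = -(ideleDivisor α).finite :=
  funext fun v => ideleDivisor_inv_finite α v

theorem card_constants_pos : (0 : ℝ) < Nat.card F := Nat.cast_pos.2 Nat.card_pos

/-- The divisors whose ideles have the expected module. -/
noncomputable def regularDivisors : AddSubgroup (FinitePlace k →₀ ℤ) where
  carrier := {n | ∀ α : (Adele k)ˣ, (ideleDivisor α).finite = n →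
    ideleModule α = (Nat.card F : ℝ) ^ divisorDegree F n}
  zero_mem' α hα := by
    rw [ideleModule_eq_one (fun w => isEmptyElim w) fun v => by rw [hα]; rfl]
    simp [divisorDegree]
  add_mem' {f g} hf hg α hα := by
    obtain ⟨β, -, hβ⟩ := exists_idele (k := k) f f.hasFiniteSupport
    have h1 := hf β hβ
    have h2 := hg (α * β⁻¹) (by
      rw [ideleDivisor_mul, ideleDivisor_inv, hα, hβ, Finsupp.coe_add, add_neg_cancel_comm])
    rw [ideleModule_mul, ideleModule_inv, h1, mul_inv_eq_iff_eq_mul₀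
      (zpow_ne_zero _ (card_constants_pos F).ne')] at h2
    rw [h2, Finsupp.coe_add, divisorDegree_add, zpow_add₀ (card_constants_pos F).ne', mul_comm]
  neg_mem' {f} hf α hα := by
    have h1 := hf α⁻¹ (by rw [ideleDivisor_inv, hα, Finsupp.coe_neg, neg_neg])
    rw [ideleModule_inv] at h1
    rw [Finsupp.coe_neg, divisorDegree_neg, zpow_neg, ← h1, inv_inv]

/-- Both sides are multiplicative in the divisor, so it suffices to check `-[v]`, where the module
is the inverse of the order of the residue field. -/
theorem ideleModule_eq_zpow (α : (Adele k)ˣ) :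
    ideleModule α = (Nat.card F : ℝ) ^ divisorDegree F (ideleDivisor α).finite := by
  classical
  have htop : ∀ n : FinitePlace k →₀ ℤ, n ∈ regularDivisors F := by
    intro n
    induction n using Finsupp.induction_linear with
    | zero => exact zero_mem _
    | add f g hf hg => exact add_mem hf hg
    | single v m =>
      have h1 : Finsupp.single v (-1 : ℤ) ∈ regularDivisors F := by
        intro β hβ
        have h2 := ideleModule_of_single (β := β) (fun w => isEmptyElim w) v
          (fun w hw => by rw [hβ, Finsupp.single_eq_of_ne hw]) (by rw [hβ, Finsupp.single_eq_same])
        have h3 : divisorDegree F (Finsupp.single v (-1 : ℤ)) = -(v.degree F : ℤ) := by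
          rw [divisorDegree, finsum_eq_single _ v fun w hw => by rw [Finsupp.single_eq_of_ne hw, zero_mul],
            Finsupp.single_eq_same, neg_one_mul]
        rw [card_residueField F, Nat.cast_pow] at h2
        rw [h3, zpow_neg, zpow_natCast]
        exact eq_inv_of_mul_eq_one_left h2
      have h2 := (regularDivisors F).zsmul_mem h1 (-m)
      rwa [Finsupp.smul_single, smul_eq_mul, neg_mul_neg, mul_one] at h2
  exact htop (Finsupp.ofSupportFinite _ (finite_support_ideleDivisor α)) α rfl

theorem log_ideleModule (α : (Adele k)ˣ) :
    Real.log (ideleModule α) = Real.log (Nat.card F) * divisorDegree F (ideleDivisor α).finite := by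
  rw [ideleModule_eq_zpow F, Real.log_zpow, mul_comm]

variable {κ : (Adele k)ˣ} (hκ : ∀ α : (Adele k)ˣ, h1 α = h0 (κ⁻¹ * α⁻¹))

include hκ

/-- Riemann–Roch divided by `log q`; the doubling clears the `½` before the degree of `κ` is known
to be even. -/
theorem two_mul_ell_sub_ell (α : (Adele k)ˣ) :
    2 * ((ell F (ideleDivisor α).finite : ℤ) - ell F (ideleDivisor (κ⁻¹ * α⁻¹)).finite) =
      2 * divisorDegree F (ideleDivisor α).finite + divisorDegree F (ideleDivisor κ).finite := by
  have h := (eulerChar_of_duality hκ α).2.2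
  rw [h0_eq_ell_mul_log F, h0_eq_ell_mul_log F, log_ideleModule F, log_ideleModule F] at h
  have hq : Real.log (Nat.card F) ≠ 0 :=
    (Real.log_pos (by exact_mod_cast Finite.one_lt_card)).ne'
  have h2 : (2 : ℝ) * (ell F (ideleDivisor α).finite - ell F (ideleDivisor (κ⁻¹ * α⁻¹)).finite) =
      2 * divisorDegree F (ideleDivisor α).finite + divisorDegree F (ideleDivisor κ).finite := by
    apply mul_left_cancel₀ hq
    linear_combination 2 * h
  exact_mod_cast h2

/-- Riemann–Roch turns `deg D - ℓ(D) + 1` into `1 - ½ deg κ - ℓ(D')` with `D'` the dual divisor. The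
maximum is therefore attained when `ℓ(D') = 0`, and it is the genus by definition. -/
theorem divisorDegree_eq_two_sub_genus :
    divisorDegree F (ideleDivisor κ).finite = 2 - 2 * genus F := by
  obtain ⟨α, hα⟩ := exists_ideleLattice_inf_principal (k := k)
  have h0 : ell F (ideleDivisor α).finite = 0 := by
    have : riemannRochSpace F (ideleDivisor α).finite = ⊥ := by
      refine (Submodule.eq_bot_iff _).2 fun x hx => ?_
      have h1 := hα _ (diag_mem_principal x) ((diag_mem_ideleLattice_iff F).2 hx)
      have := Adele.nontrivial_of_finitePlace (k := k)
      exact (map_eq_zero (diag k)).1 h1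
    rw [ell, this, finrank_bot]
  -- The maximum is attained at the divisor dual to one with `ℓ = 0`.
  have h1 := two_mul_ell_sub_ell F hκ (κ⁻¹ * α⁻¹)
  rw [mul_inv, inv_inv, inv_inv, inv_mul_cancel_left, h0] at h1
  have hgr : IsGreatest {m : ℤ | ∃ n : FinitePlace k →₀ ℤ, m = divisorDegree F n - ell F n + 1}
      (divisorDegree F (ideleDivisor (κ⁻¹ * α⁻¹)).finite -
        ell F (ideleDivisor (κ⁻¹ * α⁻¹)).finite + 1) := by
    refine ⟨⟨Finsupp.ofSupportFinite _ (finite_support_ideleDivisor _), rfl⟩, ?_⟩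
    rintro _ ⟨n, rfl⟩
    obtain ⟨β, -, hβ⟩ := exists_idele (k := k) n n.hasFiniteSupport
    have h2 := two_mul_ell_sub_ell F hκ β
    rw [hβ] at h2
    omega
  rw [genus, hgr.csSup_eq]
  push_cast at h1
  omega

theorem ideleModule_eq_zpow_genus : ideleModule κ = (Nat.card F : ℝ) ^ (2 - 2 * genus F) := by
  rw [ideleModule_eq_zpow F, divisorDegree_eq_two_sub_genus F hκ]

theorem ell_sub_ell (α : (Adele k)ˣ) :
    (ell F (ideleDivisor α).finite : ℤ) - ell F (ideleDivisor (κ⁻¹ * α⁻¹)).finite =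
      divisorDegree F (ideleDivisor α).finite + 1 - genus F := by
  have h1 := two_mul_ell_sub_ell F hκ α
  have h2 := divisorDegree_eq_two_sub_genus F hκ
  omega

end FunctionField

end GlobalAdele

namespace GlobalAdele

/-! ### Global fields -/

variable {k : Type*} [Field k]

theorem IsCurveFunctionField.isEmpty_infinitePlace {F : Subfield k} (hF : IsCurveFunctionField F) :
    IsEmpty (NumberField.InfinitePlace k) :=
  haveI := hF.finite
  GlobalAdele.isEmpty_infinitePlace k F

theorem IsCurveFunctionField.not_numberField {F : Subfield k} (hF : IsCurveFunctionField F) :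
    ¬ NumberField k := fun _ =>
  haveI := hF.isEmpty_infinitePlace
  (inferInstance : Nonempty (NumberField.InfinitePlace k)).elim isEmptyElim

theorem IsCurveFunctionField.isCocompactAdelic {F : Subfield k} (hF : IsCurveFunctionField F) :
    IsCocompactAdelic k := by
  have := hF.finite
  obtain ⟨t, ht, hfin⟩ := hF.exists_transcendental
  obtain ⟨u, hu⟩ := exists_isSeparatingElement ht hfin
  exact hu.isCocompactAdelic

theorem IsGlobalField.isCocompactAdelic (hk : IsGlobalField k) : IsCocompactAdelic k :=
  hk.elim (fun _ => isCocompactAdelic_of_numberField k) fun ⟨_, hF⟩ => hF.isCocompactAdelic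

theorem IsGlobalField.exists_isDifferentIdele (hk : IsGlobalField k) :
    ∃ κ : (Adele k)ˣ, IsDifferentIdele κ := by
  have := hk.isCocompactAdelic
  rcases hk with h | ⟨F, hF⟩
  · obtain ⟨κ, hκ⟩ := exists_idele_eq_characterDivisor (continuous_standardCharacter (k := k))
      (fun _ => standardCharacter_principal) standardCharacter_ne_one
    exact ⟨κ, Or.inl ⟨h, hκ.trans characterDivisor_standardCharacter⟩⟩
  · have := hF.isEmpty_infinitePlace
    obtain ⟨ψ, hc, hψ, hψk⟩ := exists_character k
    obtain ⟨κ, hκ⟩ := exists_idele_eq_characterDivisor hc hψk hψ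
    exact ⟨κ, Or.inr ⟨⟨F, hF⟩, ψ, hc, hψ, hψk, hκ⟩⟩

theorem IsDifferentIdele.h1_eq_h0 [IsCocompactAdelic k] {κ : (Adele k)ˣ} (hκ : IsDifferentIdele κ)
    (α : (Adele k)ˣ) : h1 α = h0 (κ⁻¹ * α⁻¹) := by
  rcases hκ with ⟨_, h⟩ | ⟨⟨F, hF⟩, ψ, hc, hψ, hψk, h⟩
  · exact GlobalAdele.h1_eq_h0 (continuous_standardCharacter (k := k))
      (fun _ => standardCharacter_principal) standardCharacter_ne_one
      (fun _ => standardCharacter_infinite) (h.trans characterDivisor_standardCharacter.symm) α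
  · have := hF.isEmpty_infinitePlace
    -- Without archimedean places an adele with zero finite part is zero, so the condition on `ψ` at
    -- infinity holds for every `ψ`.
    refine GlobalAdele.h1_eq_h0 hc hψk hψ (fun a ha => ?_) h α
    have ha0 : a = 0 := Adele.ext (fun w => isEmptyElim w) ha
    rw [ha0, AddChar.map_zero_eq_one]
    simp [archTrace]

end GlobalAdele

/-! ### The main theorem -/

theorem mainTheorem10 {k : Type*} [Field k] (hk : IsGlobalField k) :
    -- `k` lies diagonally and discretely in the locally compact group `𝔸`, and `𝔸 / k` is compact
    (∀ x : k, ∃ a : Adele k, IsDiagonal x a) ∧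
    LocallyCompactSpace (Adele k) ∧
    DiscreteTopology (principal k) ∧
    CompactSpace (AdeleQuotient k) ∧
    -- the measure on `𝔸` is a Haar measure
    MeasureTheory.Measure.IsAddHaarMeasure (adeleMeasure k) ∧
    -- `f_α`, and hence `h⁰`, `h¹` and `χ`, depend only on the replete divisor `D_α`
    (∀ α β : (Adele k)ˣ, ideleDivisor α = ideleDivisor β → ideleFunction α = ideleFunction β) ∧
    -- the integrals exist and `χ(D_α) = log ∫_𝔸 f_α`
    (∀ α : (Adele k)ˣ,
      (∀ a : Adele k,
        Summable fun u : principal k => ideleFunction α (a + u)) ∧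
      0 < expH0 α ∧
      MeasureTheory.Integrable (quotientFunction (ideleFunction α))
        (quotientMeasure k) ∧
      0 < expH1 α ∧
      MeasureTheory.Integrable (ideleFunction α) (adeleMeasure k) ∧
      0 < ∫ u, ideleFunction α u ∂(adeleMeasure k) ∧
      eulerChar α =
        Real.log (∫ u, ideleFunction α u ∂(adeleMeasure k))) ∧
    -- `χ(D_α) - χ(D_1) = log |α|`
    (∀ α : (Adele k)ˣ,
      eulerChar α - eulerChar (1 : (Adele k)ˣ) =
        Real.log (ideleModule α)) ∧
    -- there is an idele `κ` with `D_κ = 𝔎`, and for every such `κ`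
    (∃ κ : (Adele k)ˣ, IsDifferentIdele κ) ∧
    (∀ κ : (Adele k)ˣ, IsDifferentIdele κ →
      -- the value of `|κ|`
      (∀ _ : NumberField k, ideleModule κ = |(NumberField.discr k : ℝ)|⁻¹) ∧
      (∀ (F : Subfield k) [Finite F], IsCurveFunctionField F →
        ideleModule κ = (Nat.card F : ℝ) ^ (2 - 2 * genus F)) ∧
      ∀ α : (Adele k)ˣ,
        -- the Euler characteristic formula, duality and Riemann–Roch
        eulerChar α = Real.log (ideleModule α) +
          1 / 2 * Real.log (ideleModule κ) ∧
        h1 α = h0 (κ⁻¹ * α⁻¹) ∧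
        eulerChar α = -eulerChar (κ⁻¹ * α⁻¹) ∧
        h0 α - h0 (κ⁻¹ * α⁻¹) =
          Real.log (ideleModule α) + 1 / 2 * Real.log (ideleModule κ) ∧
        -- the classical form over a function field
        (∀ (F : Subfield k) [Finite F], IsCurveFunctionField F →
          h0 α = ell F (ideleDivisor α).finite *
            Real.log (Nat.card F) ∧
          eulerChar α - eulerChar (1 : (Adele k)ˣ) =
            Real.log (Nat.card F) *
              divisorDegree F (ideleDivisor α).finite ∧
          (ell F (ideleDivisor α).finite : ℤ) -
              ell F (ideleDivisor (κ⁻¹ * α⁻¹)).finite =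
            divisorDegree F (ideleDivisor α).finite + 1 -
              genus F)) := by
  have := hk.isCocompactAdelic
  refine ⟨fun x => ⟨diag k x, isDiagonal_iff.2 rfl⟩, inferInstance, inferInstance, inferInstance,
    inferInstance, fun α β => ideleFunction_congr, fun α => ⟨summable_ideleFunction α, expH0_pos α,
    integrable_quotientFunction α, expH1_pos α, integrable_ideleFunction α,
    integral_ideleFunction_pos α, eulerChar_eq α⟩,
    fun α => by rw [eulerChar_eq_log_ideleModule_add α, add_sub_cancel_right],
    hk.exists_isDifferentIdele, fun κ hκ => ⟨fun _ => ?_, fun F _ hF => ?_, fun α => ?_⟩⟩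
  · rcases hκ with ⟨_, h⟩ | ⟨⟨F, hF⟩, -⟩
    · exact ideleModule_numberField h
    · exact (hF.not_numberField inferInstance).elim
  · have := hF.isEmpty_infinitePlace
    exact ideleModule_eq_zpow_genus F hκ.h1_eq_h0
  · obtain ⟨h1, h2, h3⟩ := eulerChar_of_duality hκ.h1_eq_h0 α
    refine ⟨h2, hκ.h1_eq_h0 α, h1, h3, fun F _ hF => ?_⟩
    have := hF.isEmpty_infinitePlace
    refine ⟨h0_eq_ell_mul_log F α, ?_, ell_sub_ell F hκ.h1_eq_h0 α⟩
    rw [eulerChar_eq_log_ideleModule_add α, add_sub_cancel_right, log_ideleModule F]
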